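/- **Setting.** Let $(D,\mathcal F,A)$ be a *crossing domain*, i.e. one of the following. * *Rectangle.* $D\subset\mathbb R^2$ is a closed (non-degenerate) rectangle; $\mathcal F$ is a finite partition of $D$ into "faces": the interior of $D$, finitely many open intervals contained in $\partial D$ minus the corners, and finitely many boundary points, which include the four corners. Two distinguished sides $S_0,S_2\subset\partial D$ are given, each homeomorphic to a non-empty open interval and each a union of faces, with $\overline{S_0}\cap\overline{S_2}=\emptyset$. $A$ is the set of continuous $u:D\to\mathbb R$ such that some continuous path in $D\cap\{u\ge0\}$ joins $\overline{S_0}$ to $\overline{S_2}$. * *Annulus.* $D=\{a\le|x|\le b\}$ with $0<a<b$; $\mathcal F$ consists of the interior of $D$ and the two boundary circles; $A$ is the set of continuous $u:D\to\mathbb R$ such that some circuit (closed path) in $D\cap\{u\ge0\}$ separates the inner disc from infinity. For continuous $u:D\to\mathbb R$ the *threshold height* is $T_A(u)=\inf\{\ell\in\mathbb R: u+\ell\in A\}$. For $u\in C^1(D)$, a point $x$ of a face $F$ is a *stratified critical point* of $u$ if $\nabla_x(u|_F)=0$ (always true if $F$ is a point). A function $u\in C^2(D)$ is a *perfect Morse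 function* if (i) distinct stratified critical points have distinct values, (ii) for each face $F$ the critical points of $u|_F$ have invertible Hessian, and (iii) whenever $F\ne F'$ are faces with $F\subset\overline{F'}$ and $x\in F$, the orthogonal projection of $\nabla_xu$ on $T_x\overline{F'}$ (the limit of the tangent spaces of $F'$ at $x$) is non-zero. For such $u$ the *threshold location* $S_A(u)$ is the unique stratified critical point $x$ of $u$ with $u(x)=-T_A(u)$. **Lemma 3.1.** Let $f$ be a centred (not necessarily stationary) Gaussian field on $D$ with covariance kernel $K(x,y)=\mathbb E[f(x)f(y)]$ such that 1. $f$ is almost surely of class $C^3$ on $D$; 2. for all distinct $x,y\in D$ the Gaussian vector $(f(x),f(y),\nabla_xf,\nabla_yf)\in\mathbb R^6$ is non-degenerate; 3. for all $x\in D$ the Gaussian vector $(\nabla_xf,\nabla^2_xf)\in\mathbb R^2\times\mathrm{Sym}_2(\mathbb R)$ is non-degenerate. Let $\widetilde f$ be an independent copy of $f$ (as a random $C^3$ function), and for $t\ge0$ let $f_t=e^{-t}f+\sqrt{1-e^{-2t}}\,\widetilde f$. Then for each $t\ge 0$, almost surely, $f_t$ is a perfect Morse function and has exactly one stratified critical point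 with value $-T_A(f_t)$; in particular $S_A(f)$ and $S_A(f_t)$ are almost surely well defined. Moreover, for every $h\in C^1(\mathbb R)$ such that, for some $c>0$, $|h'(s)|\le ce^{c|s|}$ for all $s\in\mathbb R$, the random variable $h(T_A(f))$ is square integrable, the expectations and the integral below are those of integrable functions, and $$\mathrm{Var}\big(h(T_A(f))\big)=\int_0^\infty\mathbb E\big[K(S_A(f),S_A(f_t))\,h'(T_A(f))\,h'(T_A(f_t))\big]\,e^{-t}\,dt .$$ In particular, $$\mathrm{Var}\big(T_A(f)\big)=\int_0^\infty\mathbb E\big[K(S_A(f),S_A(f_t))\big]\,e^{-t}\,dt .$$ -/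

import Mathlib

open MeasureTheory ProbabilityTheory Set Filter Topology

noncomputable section

/-- The Euclidean plane `ℝ²`. A function on a subset `D` of the plane is represented by a function
`Plane → ℝ`; every notion below only uses its values on `D`. -/
abbrev Plane : Type := EuclideanSpace ℝ (Fin 2)

/-! ### Stratified domains and crossing domains -/

/-- The closed rectangle `[0, a] × [0, b]`. -/
def stdRectangle (a b : ℝ) : Set Plane :=
  {x | (0 ≤ x 0 ∧ x 0 ≤ a) ∧ (0 ≤ x 1 ∧ x 1 ≤ b)}

/-- The four corners of `[0, a] × [0, b]`. -/
def stdCorners (a b : ℝ) : Set Plane :=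
  {x | (x 0 = 0 ∨ x 0 = a) ∧ (x 1 = 0 ∨ x 1 = b)}

/-- A crossing domain whose underlying set is a closed rectangle of arbitrary position and
orientation: the image of `[0, width] × [0, height]` under an isometry `φ` of the plane, together
with its stratification `faces` and the two distinguished sides `S₀`, `S₂`. -/
structure RectangleData where
  φ : Plane ≃ᵃⁱ[ℝ] Plane
  width : ℝ
  height : ℝ
  width_pos : 0 < width
  height_pos : 0 < height
  faces : Set (Set Plane)
  finite_faces : faces.Finite
  /-- The faces are pairwise disjoint and cover the rectangle. -/
  disjoint_faces : faces.PairwiseDisjoint id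
  cover_faces : ⋃₀ faces = φ '' stdRectangle width height
  /-- The interior of the rectangle is a face. -/
  interior_mem : interior (φ '' stdRectangle width height) ∈ faces
  /-- Each corner is a face. -/
  corner_mem : ∀ c ∈ φ '' stdCorners width height, ({c} : Set Plane) ∈ faces
  /-- Each other face is a boundary point, or an open interval of the smooth part of the
  boundary. -/
  face_cases : ∀ F ∈ faces, F ≠ interior (φ '' stdRectangle width height) →
    (∃ p ∈ frontier (φ '' stdRectangle width height), F = {p}) ∨
    (∃ p q : Plane, p ≠ q ∧ F = openSegment ℝ p q ∧
      F ⊆ frontier (φ '' stdRectangle width height) \ (φ '' stdCorners width height))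
  S₀ : Set Plane
  S₂ : Set Plane
  S₀_subset : S₀ ⊆ frontier (φ '' stdRectangle width height)
  S₂_subset : S₂ ⊆ frontier (φ '' stdRectangle width height)
  /-- The distinguished sides are homeomorphic to a non-empty open interval. -/
  S₀_homeo : Nonempty (S₀ ≃ₜ Ioo (0 : ℝ) 1)
  S₂_homeo : Nonempty (S₂ ≃ₜ Ioo (0 : ℝ) 1)
  /-- The distinguished sides are unions of faces. -/
  S₀_union : ∃ G ⊆ faces, S₀ = ⋃₀ G
  S₂_union : ∃ G ⊆ faces, S₂ = ⋃₀ G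
  disjoint_sides : Disjoint (closure S₀) (closure S₂)

/-- A crossing domain whose underlying set is the annulus
`{x : inner ≤ |x| ≤ outer}`, centred at the origin. -/
structure AnnulusData where
  inner : ℝ
  outer : ℝ
  inner_pos : 0 < inner
  inner_lt_outer : inner < outer

/-- A crossing domain `(D, 𝓕, A)`: `D` is a rectangle or an annulus. -/
inductive CrossingDomain where
  | rectangle (R : RectangleData)
  | annulus (N : AnnulusData)

namespace CrossingDomain

/-- The compact set `D`. -/
def D : CrossingDomain → Set Plane
  | rectangle R => R.φ '' stdRectangle R.width R.height
  | annulus N => {x | N.inner ≤ ‖x‖ ∧ ‖x‖ ≤ N.outer}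

/-- The stratification `𝓕` of `D`. For an annulus it consists of the interior and the two boundary
circles. -/
def faces : CrossingDomain → Set (Set Plane)
  | rectangle R => R.faces
  | annulus N => {interior {x | N.inner ≤ ‖x‖ ∧ ‖x‖ ≤ N.outer},
      Metric.sphere 0 N.inner, Metric.sphere 0 N.outer}

/-- The set `A` of continuous functions `u` on `D` such that `{u ≥ 0}` has a crossing.
For a rectangle: some path in `D ∩ {u ≥ 0}` joins `closure S₀` to `closure S₂`.
For an annulus: some circuit (closed path) in `D ∩ {u ≥ 0}` separates the inner disc from infinity,
that is, the connected component of its complement which contains the centre (hence the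
inner disc) is bounded. -/
def A : CrossingDomain → Set (Plane → ℝ)
  | rectangle R => {u | ContinuousOn u (rectangle R).D ∧
      ∃ x ∈ closure R.S₀, ∃ y ∈ closure R.S₂, JoinedIn ((rectangle R).D ∩ {z | 0 ≤ u z}) x y}
  | annulus N => {u | ContinuousOn u (annulus N).D ∧
      ∃ (p : Plane) (γ : Path p p), range γ ⊆ (annulus N).D ∩ {z | 0 ≤ u z} ∧
        Bornology.IsBounded (connectedComponentIn (range γ)ᶜ 0)}

/-- The threshold height `T_A(u)`: the left end point of the half-line of levels `ℓ` such that
`u + ℓ ∈ A`. -/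
def T (𝔇 : CrossingDomain) (u : Plane → ℝ) : ℝ :=
  sInf {ℓ : ℝ | (fun x => u x + ℓ) ∈ 𝔇.A}

end CrossingDomain

/-! ### Stratified critical points and perfect Morse functions -/

/-- The tangent space at `x` of a face `F` (for `x ∈ F`). Applied to the closure of a face at a
boundary point `x`, it is the limit at `x` of the tangent spaces of that face. It is `ℝ²` for
a two-dimensional face, a line for an interval or a circle, and `0` for a point. -/
def tangentSpaceAt (F : Set Plane) (x : Plane) : Submodule ℝ Plane :=
  Submodule.span ℝ (tangentConeAt ℝ F x)

/-- `x ∈ F` is a critical point of the restriction to the face `F` of the function `u`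
on `D`. -/
def IsCriticalOn (D F : Set Plane) (u : Plane → ℝ) (x : Plane) : Prop :=
  x ∈ F ∧ ∀ v ∈ tangentSpaceAt F x, fderivWithin ℝ u D x v = 0

/-- `ψ` is a smooth local parametrization of the submanifold `F` near `x`, with `ψ 0 = x`. -/
structure IsLocalParam {k : ℕ} (F : Set Plane) (x : Plane)
    (ψ : EuclideanSpace ℝ (Fin k) → Plane) : Prop where
  smooth : ContDiffAt ℝ (⊤ : ℕ∞) ψ 0
  map_zero : ψ 0 = x
  injective_fderiv : Function.Injective (fderiv ℝ ψ 0)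
  map_nhds : Filter.map ψ (𝓝 0) = 𝓝[F] x

/-- The Hessian at `x` of the restriction of `u` to `F` is invertible, as computed in a local
parametrization (at a critical point this does not depend on the parametrization). -/
def HasInvertibleHessianOn (F : Set Plane) (u : Plane → ℝ) (x : Plane) : Prop :=
  ∃ (k : ℕ) (ψ : EuclideanSpace ℝ (Fin k) → Plane), IsLocalParam F x ψ ∧
    ∀ v, (∀ w, fderiv ℝ (fderiv ℝ (u ∘ ψ)) 0 v w = 0) → v = 0

namespace CrossingDomain

/-- `x` is a stratified critical point of `u`. -/
def IsStratifiedCritical (𝔇 : CrossingDomain) (u : Plane → ℝ) (x : Plane) : Prop :=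
  ∃ F ∈ 𝔇.faces, IsCriticalOn 𝔇.D F u x

/-- `u` is a `(D, 𝓕)`-perfect Morse function. -/
structure IsPerfectMorse (𝔇 : CrossingDomain) (u : Plane → ℝ) : Prop where
  contDiffOn : ContDiffOn ℝ 2 u 𝔇.D
  /-- Distinct stratified critical points have distinct values. -/
  critical_values : ∀ x y, 𝔇.IsStratifiedCritical u x → 𝔇.IsStratifiedCritical u y →
    x ≠ y → u x ≠ u y
  /-- The critical points of the restriction of `u` to each face are non-degenerate. -/
  nondegenerate : ∀ F ∈ 𝔇.faces, ∀ x, IsCriticalOn 𝔇.D F u x → HasInvertibleHessianOn F u x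
  /-- A point of a face is not critical for an adjacent face of larger dimension: the
  projection of the gradient on the limiting tangent space does not vanish. -/
  boundary_regular : ∀ F ∈ 𝔇.faces, ∀ F' ∈ 𝔇.faces, F ≠ F' → F ⊆ closure F' → ∀ x ∈ F,
    ∃ v ∈ tangentSpaceAt (closure F') x, fderivWithin ℝ u 𝔇.D x v ≠ 0

/-- `x` is a stratified critical point of `u` at the level `u x = - T_A(u)`. -/
def IsThresholdPoint (𝔇 : CrossingDomain) (u : Plane → ℝ) (x : Plane) : Prop :=
  𝔇.IsStratifiedCritical u x ∧ u x = - 𝔇.T u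

/-- The threshold location `S_A(u)`: for a perfect Morse function `u`, the unique stratified
critical point at which `u` takes the value `- T_A(u)`. -/
def S (𝔇 : CrossingDomain) (u : Plane → ℝ) : Plane :=
  Classical.epsilon (𝔇.IsThresholdPoint u)

end CrossingDomain

/-! ### Gaussian fields -/

/-- The partial derivative `∂ᵢ u` on the closed domain `D` (one-sided at the boundary). -/
def partialWithin (D : Set Plane) (i : Fin 2) (u : Plane → ℝ) (x : Plane) : ℝ :=
  fderivWithin ℝ u D x (EuclideanSpace.single i 1)

/-- The vector `(u(x), u(y), ∇u(x), ∇u(y)) ∈ ℝ⁶`. -/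
def twoPointJet (D : Set Plane) (u : Plane → ℝ) (x y : Plane) : Fin 6 → ℝ :=
  ![u x, u y, partialWithin D 0 u x, partialWithin D 1 u x,
    partialWithin D 0 u y, partialWithin D 1 u y]

/-- The vector `(∇u(x), ∇²u(x)) ∈ ℝ² × Sym₂(ℝ) = ℝ⁵`. -/
def derivativeJet (D : Set Plane) (u : Plane → ℝ) (x : Plane) : Fin 5 → ℝ :=
  ![partialWithin D 0 u x, partialWithin D 1 u x,
    partialWithin D 0 (partialWithin D 0 u) x,
    partialWithin D 0 (partialWithin D 1 u) x,
    partialWithin D 1 (partialWithin D 1 u) x]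

variable {Ω : Type*} [MeasurableSpace Ω]

/-- A (Gaussian) random vector is non-degenerate if its covariance matrix is positive definite,
that is, every non-trivial linear combination of its coordinates has positive variance. -/
def NondegenerateVector {n : ℕ} (P : Measure Ω) (X : Ω → Fin n → ℝ) : Prop :=
  ∀ c : Fin n → ℝ, c ≠ 0 → 0 < Var[fun ω => ∑ i, c i * X ω i; P]

/-- `f` is a centred Gaussian field on `D`, almost surely of class `C³`, which satisfies the two
non-degeneracy conditions. -/
structure IsNondegenerateGaussianField (D : Set Plane) (P : Measure Ω)
    (f : Ω → Plane → ℝ) : Prop where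
  gaussian : IsGaussianProcess (fun (x : D) ω => f ω x) P
  centred : ∀ x ∈ D, ∫ ω, f ω x ∂P = 0
  smooth : ∀ᵐ ω ∂P, ContDiffOn ℝ 3 (f ω) D
  nondegenerate_pair : ∀ x ∈ D, ∀ y ∈ D, x ≠ y →
    NondegenerateVector P (fun ω => twoPointJet D (f ω) x y)
  nondegenerate_jet : ∀ x ∈ D, NondegenerateVector P (fun ω => derivativeJet D (f ω) x)

/-- `g` is an independent copy of the random `C³` function `f` on `D`: it is almost surely `C³`,
has the same law as `f`, and is independent of `f`. -/
structure IsIndependentCopy (D : Set Plane) (P : Measure Ω) (f g : Ω → Plane → ℝ) : Prop where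
  smooth : ∀ᵐ ω ∂P, ContDiffOn ℝ 3 (g ω) D
  identDistrib : IdentDistrib (fun ω (x : D) => f ω x) (fun ω (x : D) => g ω x) P P
  indep : IndepFun (fun ω (x : D) => f ω x) (fun ω (x : D) => g ω x) P

/-- The covariance kernel `K(x, y)` of `f`. -/
def covKernel (P : Measure Ω) (f : Ω → Plane → ℝ) (x y : Plane) : ℝ :=
  cov[fun ω => f ω x, fun ω => f ω y; P]

/-- The interpolation `f_t = e^{-t} f + √(1 - e^{-2t}) g`. -/
def interpolate (f g : Ω → Plane → ℝ) (t : ℝ) (ω : Ω) (x : Plane) : ℝ :=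
  Real.exp (-t) * f ω x + Real.sqrt (1 - Real.exp (-2 * t)) * g ω x

end

/-!
# The covariance formula for the threshold height of a Gaussian field

**The perfect Morse property.** Each condition in the definition of a perfect Morse function excludes
the zeros of a random map with more components than parameters. Bulinskaya's lemma
(`ae_forall_exists_ne_zero`) says that such zeros almost surely do not exist if, at each parameter, the
values have a bounded density: the parameter set has null Hausdorff measure in the dimension of the
target, and covers it by sets on which the map is small. The derivatives of the field within `D` are
iterated limits of linear combinations of values (`IsLimitFunctional`), so they are jointly Gaussian,
with a law determined by the law of the field; the two non-degeneracy hypotheses then bound the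
densities. This gives `ae_isPerfectMorse`. The interpolations `f_t` satisfy the same hypotheses as `f`
because the law of a pair of independent copies is invariant under rotations
(`identDistrib_rotation`).

**The derivative of the threshold height.** Let `x₀` be the only stratified critical point of `u` at
the level `-T(u)`. Away from `x₀`, a deformation of `D` which preserves the faces, and hence transports
crossings to crossings, increases `u` at a linear rate near that level (`HasAscendingDeformations`,
`exists_push`). It compensates any small perturbation of `u`, so that only the size of a perturbation
near `x₀` affects the threshold (`T_add_le_of_small_near`). Hence there is a stratified critical point
at the level `-T(u)`, and for a perfect Morse function `T` has the directional derivatives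
`v ↦ -v(S(u))` (`IsPerfectMorse.hasDerivAt_T`). For an annulus, the deformations are restrictions of
homeomorphisms of the plane, which transport the separation property of circuits.

**The covariance formula.** The law `μ` of `f` on the space `C(D, ℝ)` is such that `μ ⊗ μ` is invariant
under rotations, which is the only property of Gaussian measures that the formula needs. For a locally
Lipschitz function `H` with exponential bounds which is almost everywhere Gateaux differentiable, the
derivative in `θ` of `E[H(X) H(cos θ X + sin θ Y)]` is computed by the Gaussian integration by parts
`integral_mul_eq_integral_gateauxDeriv`, itself a consequence of the rotation invariance. Integration
from `0` to `π / 2` and the change of variables `cos θ = exp (-t)` give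
`variance_eq_integral_gateauxCov`, which is applied to `H = h ∘ T`.
-/

open MeasureTheory ProbabilityTheory Set Filter Topology

noncomputable section

/-! ### Limits of Gaussian variables and limit functionals -/

section GaussianLimits

variable {Ω : Type*} [MeasurableSpace Ω] {P : Measure Ω} [IsProbabilityMeasure P]

lemma tendsto_charFun_map_of_tendsto_ae {X : ℕ → Ω → ℝ} {Y : Ω → ℝ}
    (hX : ∀ n, AEMeasurable (X n) P) (h : ∀ᵐ ω ∂P, Tendsto (fun n => X n ω) atTop (𝓝 (Y ω)))
    (s : ℝ) :
    Tendsto (fun n => charFun (P.map (X n)) s) atTop (𝓝 (charFun (P.map Y) s)) := by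
  have hY : AEMeasurable Y P := aemeasurable_of_tendsto_metrizable_ae atTop hX h
  have key : ∀ Z : Ω → ℝ, AEMeasurable Z P →
      charFun (P.map Z) s = ∫ ω, Complex.exp (s * Z ω * Complex.I) ∂P := by
    intro Z hZ
    rw [charFun_apply_real, integral_map hZ (by fun_prop)]
  simp only [key _ (hX _), key _ hY]
  refine tendsto_integral_of_dominated_convergence (fun _ => 1) ?_ (integrable_const _) ?_ ?_
  · intro n
    have := (hX n).aestronglyMeasurable
    refine AEMeasurable.aestronglyMeasurable ?_
    have := hX n
    fun_prop
  · intro n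
    refine ae_of_all _ fun ω => ?_
    rw [← Complex.ofReal_mul, Complex.norm_exp_ofReal_mul_I]
  · filter_upwards [h] with ω hω
    have hc : Continuous fun x : ℝ => Complex.exp (s * x * Complex.I) := by fun_prop
    exact (hc.tendsto _).comp hω

/-- An almost sure limit of centred Gaussian variables is a centred Gaussian variable. -/
lemma exists_map_eq_gaussianReal_of_tendsto_ae {X : ℕ → Ω → ℝ} {Y : Ω → ℝ}
    (hX : ∀ n, AEMeasurable (X n) P) (hg : ∀ n, ∃ v, P.map (X n) = gaussianReal 0 v)
    (h : ∀ᵐ ω ∂P, Tendsto (fun n => X n ω) atTop (𝓝 (Y ω))) :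
    ∃ v, P.map Y = gaussianReal 0 v := by
  have hY : AEMeasurable Y P := aemeasurable_of_tendsto_metrizable_ae atTop hX h
  have := Measure.isProbabilityMeasure_map hY
  choose v hv using hg
  have hlim : ∀ s : ℝ, Tendsto (fun n => Complex.exp (-(v n * s ^ 2 / 2 : ℝ))) atTop
      (𝓝 (charFun (P.map Y) s)) := by
    intro s
    refine (tendsto_charFun_map_of_tendsto_ae hX h s).congr fun n => ?_
    rw [hv, charFun_gaussianReal]
    push_cast
    congr 1
    simp
  -- The limiting characteristic function does not vanish near `0`, so the variances converge.
  obtain ⟨s, hs0, hs⟩ : ∃ s : ℝ, s ≠ 0 ∧ charFun (P.map Y) s ≠ 0 := by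
    have h1 : ∀ᶠ s in 𝓝 (0 : ℝ), charFun (P.map Y) s ≠ 0 :=
      continuous_charFun.continuousAt.eventually_ne (by simp)
    have h2 : ∀ᶠ s in 𝓝[≠] (0 : ℝ), charFun (P.map Y) s ≠ 0 := h1.filter_mono nhdsWithin_le_nhds
    obtain ⟨s, h3, h4⟩ := (h2.and self_mem_nhdsWithin).exists
    exact ⟨s, h4, h3⟩
  have hnorm : Tendsto (fun n => Real.exp (-(v n * s ^ 2 / 2))) atTop
      (𝓝 ‖charFun (P.map Y) s‖) := by
    refine (hlim s).norm.congr fun n => ?_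
    rw [← Complex.ofReal_neg, ← Complex.ofReal_exp, Complex.norm_real, Real.norm_eq_abs,
      Real.abs_exp]
  have hlog := (Real.continuousAt_log (norm_ne_zero_iff.2 hs)).tendsto.comp hnorm
  simp only [Function.comp_def, Real.log_exp] at hlog
  have hv' : Tendsto (fun n => (v n : ℝ)) atTop
      (𝓝 (-(2 / s ^ 2) * Real.log ‖charFun (P.map Y) s‖)) := by
    refine (hlog.const_mul (-(2 / s ^ 2))).congr fun n => ?_
    field_simp
  set w := -(2 / s ^ 2) * Real.log ‖charFun (P.map Y) s‖
  have hw : 0 ≤ w := ge_of_tendsto' hv' fun n => (v n).2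
  refine ⟨w.toNNReal, Measure.ext_of_charFun ?_⟩
  ext r
  refine tendsto_nhds_unique (hlim r) ?_
  rw [charFun_gaussianReal, Real.coe_toNNReal w hw]
  have hc : Continuous fun x : ℝ => Complex.exp (-(x * r ^ 2 / 2 : ℝ)) := by fun_prop
  have := (hc.tendsto w).comp hv'
  convert this using 2
  congr 1
  push_cast
  simp

lemma identDistrib_of_tendsto_ae {X X' : ℕ → Ω → ℝ} {Y Y' : Ω → ℝ}
    (hX : ∀ n, IdentDistrib (X n) (X' n) P P)
    (h : ∀ᵐ ω ∂P, Tendsto (fun n => X n ω) atTop (𝓝 (Y ω)))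
    (h' : ∀ᵐ ω ∂P, Tendsto (fun n => X' n ω) atTop (𝓝 (Y' ω))) : IdentDistrib Y Y' P P := by
  have hY := aemeasurable_of_tendsto_metrizable_ae atTop (fun n => (hX n).aemeasurable_fst) h
  have hY' := aemeasurable_of_tendsto_metrizable_ae atTop (fun n => (hX n).aemeasurable_snd) h'
  have := Measure.isProbabilityMeasure_map hY
  have := Measure.isProbabilityMeasure_map hY'
  refine ⟨hY, hY', Measure.ext_of_charFun ?_⟩
  ext s
  refine tendsto_nhds_unique
    (tendsto_charFun_map_of_tendsto_ae (fun n => (hX n).aemeasurable_fst) h s) ?_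
  simp only [(hX _).map_eq]
  exact tendsto_charFun_map_of_tendsto_ae (fun n => (hX n).aemeasurable_snd) h' s

end GaussianLimits

section LimitFunctionals

/-- The span of the evaluations at the points of `D`. -/
def evalSpan (D : Set Plane) : Submodule ℝ ((Plane → ℝ) → ℝ) :=
  Submodule.span ℝ (range fun (x : D) (u : Plane → ℝ) => u x)

/-- The linear functionals on `C³(D)` obtained from finite linear combinations of evaluations at
points of `D` by iterated pointwise sequential limits. Derivatives are such functionals; on
a Gaussian field their values are jointly Gaussian and determined by the law of the field. -/
inductive IsLimitFunctional (D : Set Plane) : ((Plane → ℝ) → ℝ) → Prop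
  | base {L : (Plane → ℝ) → ℝ} (h : L ∈ evalSpan D) : IsLimitFunctional D L
  | lim {L : (Plane → ℝ) → ℝ} (Ls : ℕ → (Plane → ℝ) → ℝ) (h : ∀ n, IsLimitFunctional D (Ls n))
      (hL : ∀ u, ContDiffOn ℝ 3 u D → Tendsto (fun n => Ls n u) atTop (𝓝 (L u))) :
      IsLimitFunctional D L

namespace IsLimitFunctional

variable {D : Set Plane} {L M : (Plane → ℝ) → ℝ}

lemma eval {x : Plane} (hx : x ∈ D) : IsLimitFunctional D (fun u => u x) :=
  base (Submodule.subset_span ⟨⟨x, hx⟩, rfl⟩)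

lemma smul (c : ℝ) (hL : IsLimitFunctional D L) : IsLimitFunctional D (fun u => c * L u) := by
  induction hL with
  | base h => exact base ((evalSpan D).smul_mem c h)
  | lim Ls _ hL ih => exact lim _ ih fun u hu => (hL u hu).const_mul c

lemma add (hL : IsLimitFunctional D L) (hM : IsLimitFunctional D M) :
    IsLimitFunctional D (fun u => L u + M u) := by
  induction hL generalizing M with
  | base h =>
    induction hM with
    | base h' => exact base ((evalSpan D).add_mem h h')
    | lim Ms _ hM ih => exact lim _ ih fun u hu => (hM u hu).const_add _
  | lim Ls _ hL ih => exact lim _ (fun n => ih n hM) fun u hu => (hL u hu).add_const _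

lemma zero : IsLimitFunctional D (fun _ => 0) := base (evalSpan D).zero_mem

lemma sum {ι : Type*} (s : Finset ι) (Ls : ι → (Plane → ℝ) → ℝ)
    (h : ∀ i, IsLimitFunctional D (Ls i)) : IsLimitFunctional D (fun u => ∑ i ∈ s, Ls i u) := by
  classical
  induction s using Finset.induction_on with
  | empty => simpa using zero
  | insert i s hi ih => simpa [Finset.sum_insert hi] using (h i).add ih

variable {Ω : Type*} [MeasurableSpace Ω] {P : Measure Ω} [IsProbabilityMeasure P]
  {f f' : Ω → Plane → ℝ}

lemma exists_finsupp_of_mem_evalSpan (h : L ∈ evalSpan D) :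
    ∃ c : D →₀ ℝ, ∀ u, L u = ∑ x ∈ c.support, c x * u x := by
  obtain ⟨c, rfl⟩ := Finsupp.mem_span_range_iff_exists_finsupp.1 h
  refine ⟨c, fun u => ?_⟩
  rw [Finsupp.sum, Finset.sum_apply]
  rfl

/-- The value of a limit functional on a centred Gaussian field is a centred Gaussian variable. -/
lemma gaussian (hL : IsLimitFunctional D L)
    (hf : IsGaussianProcess (fun (x : D) ω => f ω x) P) (hc : ∀ x ∈ D, ∫ ω, f ω x ∂P = 0)
    (hs : ∀ᵐ ω ∂P, ContDiffOn ℝ 3 (f ω) D) :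
    AEMeasurable (fun ω => L (f ω)) P ∧ ∃ v, P.map (fun ω => L (f ω)) = gaussianReal 0 v := by
  induction hL with
  | @base L h =>
    obtain ⟨c, hL⟩ := exists_finsupp_of_mem_evalSpan h
    simp only [hL]
    have h1 := (hf.smul c).hasGaussianLaw_fun_sum (I := c.support)
    simp only [smul_eq_mul] at h1
    have hm : ∀ x : D, AEMeasurable (fun ω => f ω x) P := hf.aemeasurable
    have h2 : AEMeasurable (fun ω => ∑ x ∈ c.support, c x * f ω x) P :=
      Finset.aemeasurable_fun_sum _ fun x _ => (hm x).const_mul _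
    have h3 : ∫ x, id x ∂(P.map fun ω => ∑ x ∈ c.support, c x * f ω x) = 0 := by
      rw [integral_map h2 (by fun_prop)]
      simp only [id]
      rw [integral_finsetSum]
      · simp [integral_const_mul, hc]
      · intro x _
        refine Integrable.const_mul ?_ _
        exact (hf.hasGaussianLaw_eval x).integrable
    have h4 := IsGaussian.eq_gaussianReal _ h1.isGaussian_map
    rw [h3] at h4
    exact ⟨h2, _, h4⟩
  | lim Ls _ hL ih =>
    have hl := hs.mono fun ω hω => hL (f ω) hω
    exact ⟨aemeasurable_of_tendsto_metrizable_ae atTop (fun n => (ih n).1) hl,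
      exists_map_eq_gaussianReal_of_tendsto_ae (fun n => (ih n).1) (fun n => (ih n).2) hl⟩

/-- The law of the value of a limit functional depends only on the law of the field. -/
lemma identDistrib (hL : IsLimitFunctional D L)
    (hff : IdentDistrib (fun ω (x : D) => f ω x) (fun ω (x : D) => f' ω x) P P)
    (hs : ∀ᵐ ω ∂P, ContDiffOn ℝ 3 (f ω) D) (hs' : ∀ᵐ ω ∂P, ContDiffOn ℝ 3 (f' ω) D) :
    IdentDistrib (fun ω => L (f ω)) (fun ω => L (f' ω)) P P := by
  induction hL with
  | @base L h =>
    obtain ⟨c, hL⟩ := exists_finsupp_of_mem_evalSpan h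
    simp only [hL]
    exact hff.comp (u := fun p : D → ℝ => ∑ x ∈ c.support, c x * p x) (by fun_prop)
  | lim Ls _ hL ih =>
    exact identDistrib_of_tendsto_ae ih (hs.mono fun ω hω => hL _ hω)
      (hs'.mono fun ω hω => hL _ hω)

end IsLimitFunctional

end LimitFunctionals

/-! ### Bulinskaya's lemma -/

section SmallBall

lemma gaussianReal_zero_one_le_volume : gaussianReal 0 1 ≤ (volume : Measure ℝ) := by
  rw [gaussianReal_of_var_ne_zero 0 one_ne_zero]
  refine (withDensity_mono (ae_of_all _ fun x => ?_)).trans (withDensity_one (μ := volume)).le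
  rw [gaussianPDF, Pi.one_apply, ENNReal.ofReal_le_one, gaussianPDFReal]
  have h1 : (1 : ℝ) ≤ √(2 * Real.pi * (1 : NNReal)) := by
    rw [Real.one_le_sqrt]
    push_cast
    nlinarith [Real.pi_gt_three]
  have h2 : Real.exp (-(x - 0) ^ 2 / (2 * (1 : NNReal))) ≤ 1 := by
    rw [Real.exp_le_one_iff]
    push_cast
    nlinarith [sq_nonneg (x - 0)]
  calc _ ≤ 1 * (1 : ℝ) := by
        gcongr
        exact inv_le_one_of_one_le₀ h1
    _ = 1 := one_mul 1

lemma Measure.pi_mono' {ι : Type*} [Fintype ι] {μ ν : ι → Measure ℝ} [∀ i, SigmaFinite (μ i)]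
    [∀ i, SigmaFinite (ν i)]
    (h : ∀ i, μ i ≤ ν i) : Measure.pi μ ≤ Measure.pi ν := by
  have h1 : (Measure.pi μ).toOuterMeasure ≤ OuterMeasure.pi fun i => (ν i).toOuterMeasure := by
    rw [OuterMeasure.le_pi]
    intro s _
    rw [Measure.coe_toOuterMeasure, Measure.pi_pi]
    exact Finset.prod_le_prod' fun i _ => h i (s i)
  refine Measure.le_iff.2 fun s hs => (h1 s).trans ?_
  rw [Measure.pi_def, toMeasure_apply _ _ hs]

variable {Ω : Type*} [MeasurableSpace Ω] {P : Measure Ω}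

open scoped RealInnerProductSpace MatrixOrder Matrix in
/-- A non-degenerate centred Gaussian vector has a bounded density, so its probability of being
in a small cube is at most a multiple of the volume of the cube. -/
theorem exists_small_ball_bound [IsProbabilityMeasure P] {ι : Type*} [Fintype ι] (X : Ω → ι → ℝ)
    (hX : ∀ c : ι → ℝ, AEMeasurable (fun ω => ∑ i, c i * X ω i) P)
    (hg : ∀ c : ι → ℝ, ∃ v, P.map (fun ω => ∑ i, c i * X ω i) = gaussianReal 0 v)
    (hv : ∀ c : ι → ℝ, c ≠ 0 → 0 < Var[fun ω => ∑ i, c i * X ω i; P]) :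
    ∃ C : ℝ, 0 ≤ C ∧ ∀ r : ℝ, 0 ≤ r →
      P {ω | ∀ i, |X ω i| ≤ r} ≤ ENNReal.ofReal (C * r ^ Fintype.card ι) := by
  classical
  let Y : Ω → (EuclideanSpace ℝ ι) := fun ω => WithLp.toLp 2 (X ω)
  have hYi : ∀ i, AEMeasurable (fun ω => X ω i) P := fun i => by
    simpa [Pi.single_apply] using hX (Pi.single i 1)
  have hY : AEMeasurable Y P :=
    (WithLp.measurable_toLp 2 (ι → ℝ)).comp_aemeasurable (aemeasurable_pi_lambda _ hYi)
  set ν := P.map Y with hν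
  have : IsProbabilityMeasure ν := Measure.isProbabilityMeasure_map hY
  have hinner : ∀ c : (EuclideanSpace ℝ ι), (fun ω => ⟪c, Y ω⟫) = fun ω => ∑ i, c i * X ω i := by
    intro c
    ext ω
    simp only [Y, PiLp.inner_apply]
    simp [mul_comm]
  have hG : IsGaussian ν := by
    refine isGaussian_of_map_eq_gaussianReal fun L => ?_
    obtain ⟨c, rfl⟩ := (InnerProductSpace.toDual ℝ (EuclideanSpace ℝ ι)).surjective L
    obtain ⟨v, hv⟩ := hg c
    refine ⟨0, v, ?_⟩
    rw [hν, AEMeasurable.map_map_of_aemeasurable (by fun_prop) hY, ← hv, ← hinner]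
    rfl
  have hvar : ∀ c : (EuclideanSpace ℝ ι),
      covarianceBilin ν c c = Var[fun ω => ∑ i, c i * X ω i; P] := by
    intro c
    rw [covarianceBilin_self IsGaussian.memLp_two_id, ← hinner, hν, variance_map (by fun_prop) hY]
    rfl
  let S : Matrix ι ι ℝ := fun i j =>
    covarianceBilin ν (EuclideanSpace.basisFun ι ℝ i) (EuclideanSpace.basisFun ι ℝ j)
  have hS : ∀ c : (EuclideanSpace ℝ ι), c.ofLp ⬝ᵥ S *ᵥ c.ofLp = covarianceBilin ν c c := by
    intro c
    conv_rhs => rw [← (EuclideanSpace.basisFun ι ℝ).sum_repr c]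
    simp only [map_sum, map_smul, _root_.sum_apply, _root_.smul_apply]
    simp [dotProduct, Matrix.mulVec, S, Finset.mul_sum]
    refine Finset.sum_congr rfl fun i _ => Finset.sum_congr rfl fun j _ => ?_
    rw [covarianceBilin_comm]
    ring
  have hpd : S.PosDef := by
    refine Matrix.PosDef.of_dotProduct_mulVec_pos ?_ fun x hx => ?_
    · ext i j
      exact covarianceBilin_comm _ _
    · have := hS (WithLp.toLp 2 x)
      simp only [star_trivial]
      rw [this, hvar]
      exact hv x hx
  have hνS : ν = multivariateGaussian 0 S := by
    refine Measure.ext_of_charFun ?_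
    ext t
    rw [charFun_multivariateGaussian hpd.posSemidef, IsGaussian.charFun_eq, hS, hvar]
    obtain ⟨v, hv⟩ := hg t
    have h1 : ∫ x, ⟪t, x⟫ ∂ν = 0 := by
      rw [hν, integral_map hY (by fun_prop), hinner]
      have h2 := integral_map (hX t) (f := id) (by fun_prop)
      rw [hv] at h2
      simpa using h2.symm
    have h2 : Var[fun x => ⟪t, x⟫; ν] = Var[fun ω => ∑ i, t i * X ω i; P] := by
      rw [← hinner, hν, variance_map (by fun_prop) hY]
      rfl
    rw [integral_complex_ofReal, h1, h2]
    simp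
  -- The law is the image under `A = √S` of the standard Gaussian law, whose density is at most `1`.
  let A := Matrix.toEuclideanCLM (𝕜 := ℝ) (CFC.sqrt S)
  have hdet : LinearMap.det (A : (EuclideanSpace ℝ ι) →ₗ[ℝ] (EuclideanSpace ℝ ι)) ≠ 0 := by
    have h1 : IsUnit (CFC.sqrt S) := by
      rw [CFC.isUnit_sqrt_iff S hpd.posSemidef.nonneg]
      exact hpd.isUnit
    have h2 := ((h1.map (Matrix.toEuclideanCLM (𝕜 := ℝ) (n := ι))).map
      (ContinuousLinearMap.toLinearMapRingHom (R₁ := ℝ) (M₁ := EuclideanSpace ℝ ι))).map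
      (LinearMap.det (M := EuclideanSpace ℝ ι) (A := ℝ))
    exact h2.ne_zero
  have hle : stdGaussian (EuclideanSpace ℝ ι) ≤ volume := by
    rw [← map_pi_eq_stdGaussian, ← (PiLp.volume_preserving_toLp ι).map_eq, volume_pi]
    exact Measure.map_mono (Measure.pi_mono' fun _ => gaussianReal_zero_one_le_volume)
      (WithLp.measurable_toLp 2 (ι → ℝ))
  refine ⟨|(LinearMap.det (A : (EuclideanSpace ℝ ι) →ₗ[ℝ] (EuclideanSpace ℝ ι)))⁻¹| *
    2 ^ Fintype.card ι, by positivity, fun r hr => ?_⟩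
  let B : Set (EuclideanSpace ℝ ι) := {x | ∀ i, |x i| ≤ r}
  have hB : MeasurableSet B := by
    have : B = ⋂ i, {x : (EuclideanSpace ℝ ι) | |x i| ≤ r} := by ext; simp [B]
    rw [this]
    exact MeasurableSet.iInter fun i => measurableSet_le (by fun_prop) measurable_const
  have hvol : volume B = ENNReal.ofReal ((2 * r) ^ Fintype.card ι) := by
    rw [← (PiLp.volume_preserving_toLp ι).measure_preimage hB.nullMeasurableSet]
    have : (WithLp.toLp 2) ⁻¹' B = Set.Icc (fun _ : ι => -r) (fun _ => r) := by
      ext x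
      simp only [B, abs_le, mem_preimage, mem_ofPred_eq, mem_Icc, Pi.le_def, forall_and]
    rw [this, Real.volume_Icc_pi]
    simp
    rw [ENNReal.ofReal_pow (by positivity)]
    congr 2
    ring
  calc P {ω | ∀ i, |X ω i| ≤ r} = ν B := by
        rw [hν, Measure.map_apply_of_aemeasurable hY hB]
        rfl
    _ = stdGaussian (EuclideanSpace ℝ ι) (A ⁻¹' B) := by
        rw [hνS, multivariateGaussian, Measure.map_apply (by fun_prop) hB]
        congr 1
        ext x
        simp [A]
    _ ≤ volume ((A : (EuclideanSpace ℝ ι) →ₗ[ℝ] (EuclideanSpace ℝ ι)) ⁻¹' B) := hle _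
    _ = _ := by
        rw [Measure.addHaar_preimage_linearMap _ hdet, hvol, ← ENNReal.ofReal_mul (abs_nonneg _)]
        congr 1
        ring

end SmallBall

section Bulinskaya

variable {Ω : Type*} [MeasurableSpace Ω] {P : Measure Ω}

open scoped ENNReal in
/-- **Bulinskaya's lemma**: a random field with values in a space of dimension larger than that of
the parameter set, with locally bounded densities and pointwise Lipschitz at its zeros, has almost
surely no zeros. No uniformity in the bounds on the densities is needed. -/
theorem ae_forall_exists_ne_zero {V ι : Type*} [NormedAddCommGroup V] [NormedSpace ℝ V]
    [FiniteDimensional ℝ V] [Fintype ι] (hdim : Module.finrank ℝ V < Fintype.card ι)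
    (T : Set V) (X : Ω → V → ι → ℝ)
    (hsmall : ∀ t ∈ T, ∃ C : ℝ, 0 ≤ C ∧ ∀ r : ℝ, 0 ≤ r →
      P {ω | ∀ i, |X ω t i| ≤ r} ≤ ENNReal.ofReal (C * r ^ Fintype.card ι))
    (hdiff : ∀ᵐ ω ∂P, ∀ t ∈ T, (∀ i, X ω t i = 0) → ∃ K : ℝ, ∃ δ > 0, ∀ s ∈ T, dist s t < δ →
      ∀ i, |X ω s i| ≤ K * dist s t) :
    ∀ᵐ ω ∂P, ∀ t ∈ T, ∃ i, X ω t i ≠ 0 := by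
  borelize V
  set m := Fintype.card ι
  -- Countably many cases: a common constant `N` for the density at the zero `t`, for the Lipschitz
  -- bound at `t`, and for the inverse of the radius on which it holds.
  let TN : ℕ → Set V := fun N => {t ∈ T | ∀ r : ℝ, 0 ≤ r →
      P {ω | ∀ i, |X ω t i| ≤ r} ≤ ENNReal.ofReal (N * r ^ m)}
  let bad : ℕ → Set Ω := fun N => {ω | ∃ t ∈ TN N, ∀ s ∈ T, dist s t < 1 / (N + 1) →
      ∀ i, |X ω s i| ≤ N * dist s t}
  have hbad : ∀ N, P (bad N) = 0 := by
    intro N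
    have hm : 0 < m := by omega
    -- As `T` has dimension less than `m`, it has covers with an arbitrarily small sum of `diam ^ m`.
    have hH : Measure.hausdorffMeasure (m : ℝ) (TN N) = 0 := by
      rw [Real.hausdorffMeasure_of_finrank_lt (by exact_mod_cast hdim)]
      rfl
    rw [Measure.hausdorffMeasure_apply] at hH
    have hr : (0 : ℝ≥0∞) < ENNReal.ofReal (1 / (2 * (N + 1))) := by
      rw [ENNReal.ofReal_pos]
      positivity
    have h0 := ENNReal.iSup_eq_zero.1 (ENNReal.iSup_eq_zero.1 hH _) hr
    have key : ∀ ε : ℝ≥0∞, 0 < ε → P (bad N) ≤ ENNReal.ofReal (N * N ^ m) * ε := by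
      intro ε hε
      rw [← h0] at hε
      simp only [iInf_lt_iff] at hε
      obtain ⟨t, hcov, hd, hsum⟩ := hε
      have hfin : ∀ n, Metric.ediam (t n) ≠ ∞ := fun n =>
        ((hd n).trans_lt ENNReal.ofReal_lt_top).ne
      have hn : ∀ n, ∃ B : Set Ω, P B ≤ ENNReal.ofReal (N * N ^ m) *
          (⨆ _ : (t n).Nonempty, Metric.ediam (t n) ^ (m : ℝ)) ∧
          {ω | ∃ x ∈ TN N ∩ t n, ∀ s ∈ T, dist s x < 1 / (N + 1) →
            ∀ i, |X ω s i| ≤ N * dist s x} ⊆ B := by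
        intro n
        rcases (TN N ∩ t n).eq_empty_or_nonempty with h | ⟨y, hyT, hyt⟩
        · refine ⟨∅, by simp, ?_⟩
          rintro ω ⟨x, hx, -⟩
          rw [h] at hx
          exact hx.elim
        refine ⟨{ω | ∀ i, |X ω y i| ≤ N * (Metric.diam (t n))}, ?_, ?_⟩
        · refine (hyT.2 _ (by positivity)).trans ?_
          rw [iSup_pos ⟨y, hyt⟩, ENNReal.rpow_natCast, ← ENNReal.ofReal_toReal (hfin n),
            ← ENNReal.ofReal_pow ENNReal.toReal_nonneg, ← ENNReal.ofReal_mul (by positivity)]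
          refine le_of_eq ?_
          congr 1
          rw [Metric.diam]
          ring
        · rintro ω ⟨x, ⟨hxT, hxt⟩, hx⟩ i
          have h1 : dist y x ≤ Metric.diam (t n) := Metric.dist_le_diam_of_mem' (hfin n) hyt hxt
          have h2 : Metric.diam (t n) ≤ 1 / (2 * (N + 1)) := by
            refine ENNReal.toReal_le_of_le_ofReal (by positivity) (hd n)
          have h3 : (1 : ℝ) / (2 * (N + 1)) < 1 / (N + 1) := by
            apply one_div_lt_one_div_of_lt <;> linarith [(Nat.cast_nonneg N : (0 : ℝ) ≤ N)]
          refine (hx y hyT.1 (by linarith) i).trans ?_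
          gcongr
      choose B hB1 hB2 using hn
      calc P (bad N) ≤ P (⋃ n, B n) := by
            refine measure_mono ?_
            rintro ω ⟨x, hx, hxs⟩
            obtain ⟨n, hn⟩ := mem_iUnion.1 (hcov hx)
            exact mem_iUnion.2 ⟨n, hB2 n ⟨x, ⟨hx, hn⟩, hxs⟩⟩
        _ ≤ ∑' n, P (B n) := measure_iUnion_le _
        _ ≤ ∑' n, _ := ENNReal.tsum_le_tsum hB1
        _ = _ := ENNReal.tsum_mul_left
        _ ≤ _ := by gcongr
    refine le_antisymm ?_ bot_le
    have ht : Tendsto (fun ε => ENNReal.ofReal (N * N ^ m) * ε) (𝓝[>] 0) (𝓝 0) := by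
      have := ENNReal.Tendsto.const_mul (a := ENNReal.ofReal (N * N ^ m))
        (tendsto_id (x := 𝓝[>] (0 : ℝ≥0∞)) |>.mono_right nhdsWithin_le_nhds)
        (Or.inr ENNReal.ofReal_ne_top)
      simpa using this
    exact ge_of_tendsto ht (eventually_mem_nhdsWithin.mono fun ε hε => key ε hε)
  have hall : ∀ᵐ ω ∂P, ∀ N, ω ∉ bad N := by
    rw [ae_all_iff]
    intro N
    exact measure_eq_zero_iff_ae_notMem.1 (hbad N)
  filter_upwards [hall, hdiff] with ω h1 h2 t ht
  by_contra! hcon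
  obtain ⟨K, δ, hδ, hK⟩ := h2 t ht hcon
  obtain ⟨C, hC, hCs⟩ := hsmall t ht
  obtain ⟨N, hN⟩ := exists_nat_ge (max (max K C) (1 / δ))
  have hN1 : K ≤ N := (le_max_left _ _).trans ((le_max_left _ _).trans hN)
  have hN2 : C ≤ N := (le_max_right _ _).trans ((le_max_left _ _).trans hN)
  have hN3 : 1 / δ ≤ N := (le_max_right _ _).trans hN
  refine h1 N ⟨t, ⟨ht, fun r hr => (hCs r hr).trans ?_⟩, fun s hs hst i => (hK s hs ?_ i).trans ?_⟩
  · gcongr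
  · refine hst.trans_le ?_
    rw [div_le_iff₀ hδ] at hN3
    rw [div_le_iff₀ (by positivity)]
    linarith
  · gcongr

end Bulinskaya

/-! ### Inward frames and regular stratifications -/

section InwardFrame

/-- From each point of `D`, one can move inside `D` along two independent directions. This makes
derivatives within `D` unique, and limits of difference quotients of values in `D`. -/
def HasInwardFrame (D : Set Plane) : Prop :=
  ∀ x ∈ D, ∃ w : Fin 2 → Plane, LinearIndependent ℝ w ∧ ∃ s₀ : ℝ, 0 < s₀ ∧
    ∀ i, ∀ s ∈ Icc 0 s₀, x + s • w i ∈ D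

lemma span_range_eq_top_of_linearIndependent {w : Fin 2 → Plane} (hw : LinearIndependent ℝ w) :
    Submodule.span ℝ (range w) = ⊤ :=
  hw.span_eq_top_of_card_eq_finrank (by simp)

variable {D : Set Plane}

lemma HasInwardFrame.tangentSpaceAt_eq_top (hD : HasInwardFrame D) {x : Plane} (hx : x ∈ D) :
    tangentSpaceAt D x = ⊤ := by
  obtain ⟨w, hw, s₀, hs₀, hs⟩ := hD x hx
  rw [tangentSpaceAt, eq_top_iff, ← span_range_eq_top_of_linearIndependent hw,
    Submodule.span_le]
  rintro _ ⟨i, rfl⟩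
  have h1 : (x + s₀ • w i) - x ∈ tangentConeAt ℝ D x := by
    refine mem_tangentConeAt_of_segment_subset ?_
    rw [segment_eq_image']
    rintro _ ⟨θ, hθ, rfl⟩
    have := hs i (θ * s₀) ⟨by have := hθ.1; positivity, by nlinarith [hθ.2]⟩
    simpa [mul_smul] using this
  rw [add_sub_cancel_left] at h1
  have h2 := (Submodule.span ℝ (tangentConeAt ℝ D x)).smul_mem s₀⁻¹ (Submodule.subset_span h1)
  rwa [smul_smul, inv_mul_cancel₀ hs₀.ne', one_smul] at h2

lemma HasInwardFrame.uniqueDiffOn (hD : HasInwardFrame D) : UniqueDiffOn ℝ D := by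
  intro x hx
  refine ⟨?_, subset_closure hx⟩
  have := hD.tangentSpaceAt_eq_top hx
  rw [tangentSpaceAt] at this
  rw [this]
  exact dense_univ

/-- The derivatives of a family of limit functionals are limit functionals. -/
lemma HasInwardFrame.isLimitFunctional_fderivWithin (hD : HasInwardFrame D)
    {m : (Plane → ℝ) → Plane → ℝ} (hm : ∀ x ∈ D, IsLimitFunctional D (fun u => m u x))
    (hd : ∀ u, ContDiffOn ℝ 3 u D → DifferentiableOn ℝ (m u) D) {x : Plane} (hx : x ∈ D)
    (v : Plane) : IsLimitFunctional D (fun u => fderivWithin ℝ (m u) D x v) := by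
  obtain ⟨w, hw, s₀, hs₀, hs⟩ := hD x hx
  have key : ∀ i, IsLimitFunctional D (fun u => fderivWithin ℝ (m u) D x (w i)) := by
    intro i
    let d : ℕ → Plane := fun n => (s₀ / (n + 1)) • w i
    have hdD : ∀ n, x + d n ∈ D := fun n => hs i _ ⟨by positivity,
      div_le_self hs₀.le (by linarith [(Nat.cast_nonneg n : (0 : ℝ) ≤ n)])⟩
    refine .lim (fun n u => ((n + 1) / s₀) * (m u (x + d n) + (-1) * m u x)) (fun n => ?_) ?_
    · exact ((hm _ (hdD n)).add ((hm x hx).smul _)).smul _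
    · intro u hu
      have h1 := ((hd u hu) x hx).hasFDerivWithinAt
      refine (h1.lim (l := atTop) (c := fun n : ℕ => (n + 1) / s₀) (d := d) (v := w i)
        ?_ (.of_forall hdD) ?_).congr fun n => ?_
      · have h2 : Tendsto (fun n : ℕ => s₀ / ((n : ℝ) + 1)) atTop (𝓝 0) :=
          tendsto_const_nhds.div_atTop
            (tendsto_atTop_add_const_right _ _ tendsto_natCast_atTop_atTop)
        simpa [d] using h2.smul_const (w i)
      · refine tendsto_const_nhds.congr fun n => ?_
        rw [smul_smul, div_mul_div_comm, mul_comm s₀, div_self (by positivity), one_smul]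
      · rw [smul_eq_mul]
        ring
  have hv : v ∈ Submodule.span ℝ (range w) := by
    rw [span_range_eq_top_of_linearIndependent hw]
    trivial
  obtain ⟨c, rfl⟩ := (Submodule.mem_span_range_iff_exists_fun ℝ).1 hv
  simp only [map_sum, map_smul, smul_eq_mul]
  exact .sum _ _ fun i => (key i).smul (c i)

end InwardFrame

section Faces

/-- `γ` parametrizes the one-dimensional face `F` over the open set `I`. It need not be injective, so
that a circle is parametrized by the whole line. -/
structure IsCurveFace (F : Set Plane) (γ : ℝ → Plane) (I : Set ℝ) : Prop where
  smooth : ContDiff ℝ (⊤ : ℕ∞) γ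
  isOpen : IsOpen I
  image_eq : γ '' I = F
  deriv_ne_zero : ∀ s, deriv γ s ≠ 0
  map_nhds : ∀ s ∈ I, Filter.map γ (𝓝 s) = 𝓝[F] (γ s)
  tangentSpace_le : ∀ s ∈ I, tangentSpaceAt F (γ s) ≤ Submodule.span ℝ {deriv γ s}

lemma IsCurveFace.deriv_mem {F : Set Plane} {γ : ℝ → Plane} {I : Set ℝ} (h : IsCurveFace F γ I)
    {s : ℝ} (hs : s ∈ I) : deriv γ s ∈ tangentSpaceAt F (γ s) := by
  have h1 : HasFDerivWithinAt γ (fderiv ℝ γ s) I s :=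
    ((h.smooth.differentiable (by simp)) s).hasFDerivAt.hasFDerivWithinAt
  have h3 : (1 : ℝ) ∈ tangentConeAt ℝ I s := by
    rw [tangentConeAt_of_mem_nhds (h.isOpen.mem_nhds hs)]
    trivial
  have h2 := h1.mapsTo_tangent_cone h3
  rw [h.image_eq] at h2
  exact Submodule.subset_span h2

/-- The properties of a stratification into finitely many faces which the generic regularity of
Gaussian fields depends on. -/
structure IsRegularStratification (D : Set Plane) (faces : Set (Set Plane)) : Prop where
  isCompact : IsCompact D
  frame : HasInwardFrame D
  subset_closure_interior : D ⊆ closure (interior D)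
  finite : faces.Finite
  cover : ⋃₀ faces = D
  disjoint : faces.PairwiseDisjoint id
  face_cases : ∀ F ∈ faces, F = interior D ∨ (∃ p, F = {p}) ∨ ∃ γ I, IsCurveFace F γ I
  /-- A face other than the interior adds finitely many points to its closure, and the limiting
  tangent space of the face at each of them is not zero. -/
  closure_cases : ∀ F ∈ faces, F ≠ interior D → ∃ Z : Set (Plane × Plane), Z.Finite ∧
    (∀ z ∈ Z, z.1 ∈ D ∧ z.2 ≠ 0 ∧ z.2 ∈ tangentSpaceAt F z.1) ∧ closure F \ F ⊆ Prod.fst '' Z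

lemma tangentSpaceAt_closure (F : Set Plane) (x : Plane) :
    tangentSpaceAt (closure F) x = tangentSpaceAt F x := by
  rw [tangentSpaceAt, tangentSpaceAt, tangentConeAt_closure]

lemma tangentSpaceAt_isOpen {F : Set Plane} (hF : IsOpen F) {x : Plane} (hx : x ∈ F) :
    tangentSpaceAt F x = ⊤ := by
  rw [tangentSpaceAt, tangentConeAt_of_mem_nhds (hF.mem_nhds hx), Submodule.span_univ]

lemma tangentSpaceAt_singleton (p x : Plane) : tangentSpaceAt {p} x = ⊥ := by
  rw [tangentSpaceAt, Submodule.span_eq_bot]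
  intro y hy
  by_cases hx : x = p
  · subst hx
    have h1 : HasFDerivWithinAt (fun z : Plane => z) (ContinuousLinearMap.id ℝ Plane) {x} x :=
      hasFDerivWithinAt_id x _
    have h2 : HasFDerivWithinAt (fun z : Plane => z) (0 : Plane →L[ℝ] Plane) {x} x := by
      simp
    simpa using h1.unique_on h2 hy
  · exact absurd (mem_closure_of_nonempty_tangentConeAt ⟨y, hy⟩) (by simpa using hx)

/-- A function with constant value on `F` has a vanishing derivative along `F`. -/
lemma apply_eq_zero_of_mem_tangentSpaceAt {F : Set Plane} {x v : Plane} {g : Plane → ℝ}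
    {g' : Plane →L[ℝ] ℝ} (hg : HasFDerivAt g g' x) (hF : ∀ y ∈ F, g y = g x)
    (hv : v ∈ tangentSpaceAt F x) : g' v = 0 := by
  have h1 : HasFDerivWithinAt g (0 : Plane →L[ℝ] ℝ) F x :=
    (hasFDerivWithinAt_const (g x) x F).congr (fun y hy => hF y hy) rfl
  have h2 : tangentSpaceAt F x ≤ LinearMap.ker (g' : Plane →ₗ[ℝ] ℝ) := by
    rw [tangentSpaceAt, Submodule.span_le]
    intro y hy
    exact hg.hasFDerivWithinAt.unique_on h1 hy
  exact h2 hv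

end Faces

/-! ### The stratification of a rectangle -/

lemma mem_span_singleton_of_cross_eq_zero {v w : Plane} (hw : w ≠ 0)
    (h : v 0 * w 1 - v 1 * w 0 = 0) : v ∈ Submodule.span ℝ {w} := by
  rw [Submodule.mem_span_singleton]
  by_cases h0 : w 0 = 0
  · have h1 : w 1 ≠ 0 := by
      intro h1
      apply hw
      ext i
      fin_cases i <;> simp [h0, h1]
    refine ⟨v 1 / w 1, ?_⟩
    have h2 : v 0 = 0 := by
      rw [h0] at h
      simpa [h1] using h
    ext i
    fin_cases i
    · simp [h0, h2]
    · simp [h1]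
  · refine ⟨v 0 / w 0, ?_⟩
    ext i
    fin_cases i
    · simp [h0]
    · simp
      field_simp
      linarith

section Segments

/-- The tangent cone of the segment is contained in its direction because an affine function is constant
on it. -/
lemma isCurveFace_openSegment {p q : Plane} (hpq : p ≠ q) :
    IsCurveFace (openSegment ℝ p q) (fun s => p + s • (q - p)) (Ioo 0 1) := by
  have hw : q - p ≠ 0 := sub_ne_zero.2 hpq.symm
  have hder : ∀ s : ℝ, HasDerivAt (fun s : ℝ => p + s • (q - p)) (q - p) s := fun s => by
    simpa using ((hasDerivAt_id s).smul_const (q - p)).const_add p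
  have him : (fun s : ℝ => p + s • (q - p)) '' Ioo 0 1 = openSegment ℝ p q := by
    rw [openSegment_eq_image']
  refine ⟨by fun_prop, isOpen_Ioo, him, fun s => ?_, fun s hs => ?_, fun s hs v hv => ?_⟩
  · rw [(hder s).deriv]
    exact hw
  · have hemb : IsEmbedding (fun s : ℝ => p + s • (q - p)) :=
      (Homeomorph.addLeft p).isEmbedding.comp (isClosedEmbedding_smul_left hw).isEmbedding
    rw [← him, ← hemb.map_nhdsWithin_eq, nhdsWithin_eq_nhds.2 (isOpen_Ioo.mem_nhds hs)]
  · rw [(hder s).deriv]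
    refine mem_span_singleton_of_cross_eq_zero hw ?_
    let g : Plane →L[ℝ] ℝ := (q - p) 1 • EuclideanSpace.proj 0 - (q - p) 0 • EuclideanSpace.proj 1
    have h := apply_eq_zero_of_mem_tangentSpaceAt (g := g) g.hasFDerivAt ?_ hv
    · have h' : (q - p) 1 * v 0 - (q - p) 0 * v 1 = 0 := h
      linarith
    · rw [← him]
      rintro _ ⟨t, -, rfl⟩
      simp [g]
      ring

lemma closure_openSegment_diff (p q : Plane) :
    closure (openSegment ℝ p q) \ openSegment ℝ p q ⊆ {p, q} := by
  rw [closure_openSegment]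
  rintro x ⟨hx, hx'⟩
  have := insert_endpoints_openSegment ℝ p q
  rw [← this] at hx
  simp only [mem_insert_iff] at hx ⊢
  tauto

lemma sub_mem_tangentSpaceAt_left (p q : Plane) : q - p ∈ tangentSpaceAt (openSegment ℝ p q) p :=
  Submodule.subset_span (mem_tangentConeAt_of_openSegment_subset subset_rfl)

lemma sub_mem_tangentSpaceAt_right (p q : Plane) : q - p ∈ tangentSpaceAt (openSegment ℝ p q) q := by
  rw [← neg_sub, neg_mem_iff, openSegment_symm]
  exact sub_mem_tangentSpaceAt_left q p

end Segments

namespace RectangleData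

variable (R : RectangleData)

/-- The side lengths of the rectangle. -/
def sides : Fin 2 → ℝ := ![R.width, R.height]

/-- The coordinates of a point in the frame of the rectangle. -/
def coord (x : Plane) : Plane := R.φ.symm x

/-- The linear part of the change of coordinates. -/
def lin : Plane ≃ₗᵢ[ℝ] Plane := R.φ.symm.linearIsometryEquiv

/-- The unit vectors parallel to the sides of the rectangle. -/
def unitVec (i : Fin 2) : Plane := R.lin.symm (EuclideanSpace.single i 1)

lemma sides_pos (i : Fin 2) : 0 < R.sides i := by
  fin_cases i
  · exact R.width_pos
  · exact R.height_pos

lemma coord_add (x v : Plane) : R.coord (x + v) = R.coord x + R.lin v := by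
  have := R.φ.symm.map_vadd x v
  simp only [vadd_eq_add] at this
  rw [coord, add_comm x v, this, add_comm]
  rfl

lemma lin_unitVec (i : Fin 2) : R.lin (R.unitVec i) = EuclideanSpace.single i 1 := by
  simp [unitVec]

lemma continuous_coord : Continuous R.coord := R.φ.symm.continuous

/-- The set underlying the crossing domain. -/
abbrev D : Set Plane := R.φ '' stdRectangle R.width R.height

lemma mem_image_iff (S : Set Plane) (x : Plane) : x ∈ R.φ '' S ↔ R.coord x ∈ S := by
  constructor
  · rintro ⟨y, hy, rfl⟩
    simpa [coord] using hy
  · intro h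
    exact ⟨_, h, by simp [coord]⟩

lemma mem_D_iff {x : Plane} : x ∈ R.D ↔ ∀ i, 0 ≤ R.coord x i ∧ R.coord x i ≤ R.sides i := by
  rw [D, mem_image_iff, Fin.forall_fin_two]
  rfl

lemma mem_corners_iff {x : Plane} : x ∈ R.φ '' stdCorners R.width R.height ↔
    ∀ i, R.coord x i = 0 ∨ R.coord x i = R.sides i := by
  rw [mem_image_iff, Fin.forall_fin_two]
  rfl

lemma continuous_coord_apply (i : Fin 2) : Continuous fun x => R.coord x i :=
  (EuclideanSpace.proj i).continuous.comp R.continuous_coord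

lemma isClosed_D : IsClosed R.D := by
  have : R.D = ⋂ i, {x | 0 ≤ R.coord x i} ∩ {x | R.coord x i ≤ R.sides i} := by
    ext x
    rw [mem_D_iff]
    simp
  rw [this]
  exact isClosed_iInter fun i => (isClosed_le continuous_const (R.continuous_coord_apply i)).inter
    (isClosed_le (R.continuous_coord_apply i) continuous_const)

lemma mem_interior_iff {x : Plane} :
    x ∈ interior R.D ↔ ∀ i, 0 < R.coord x i ∧ R.coord x i < R.sides i := by
  constructor
  · intro hx i
    have hc : Continuous fun s : ℝ => x + s • R.unitVec i := by fun_prop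
    have hev : ∀ᶠ s in 𝓝 (0 : ℝ), x + s • R.unitVec i ∈ R.D :=
      hc.continuousAt (by simpa using mem_interior_iff_mem_nhds.1 hx)
    obtain ⟨ε, hε, h⟩ := Metric.eventually_nhds_iff.1 hev
    have h1 := (R.mem_D_iff.1 (h (y := ε / 2) (by
      rw [Real.dist_eq, sub_zero, abs_of_pos (by positivity)]; linarith)) i).2
    have h2 := (R.mem_D_iff.1 (h (y := -(ε / 2)) (by
      rw [Real.dist_eq, sub_zero, abs_neg, abs_of_pos (by positivity)]; linarith)) i).1
    simp only [coord_add, map_smul, lin_unitVec, PiLp.add_apply, PiLp.smul_apply,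
      PiLp.single_apply, if_true, smul_eq_mul, mul_one] at h1 h2
    constructor <;> linarith
  · intro h
    have ho : IsOpen {x | ∀ i, 0 < R.coord x i ∧ R.coord x i < R.sides i} := by
      simp only [ofPred_forall, ofPred_and]
      exact isOpen_iInter_of_finite fun i =>
        (isOpen_lt continuous_const (R.continuous_coord_apply i)).inter
        (isOpen_lt (R.continuous_coord_apply i) continuous_const)
    exact interior_maximal (fun y hy => R.mem_D_iff.2 fun i => ⟨(hy i).1.le, (hy i).2.le⟩) ho h

lemma isCompact_D : IsCompact R.D := by
  refine Metric.isCompact_of_isClosed_isBounded R.isClosed_D ?_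
  refine (Metric.isBounded_iff_subset_closedBall (R.φ 0)).2 ⟨R.width + R.height, ?_⟩
  rintro _ ⟨y, ⟨h0, h1⟩, rfl⟩
  rw [Metric.mem_closedBall, R.φ.dist_map, dist_zero_right, EuclideanSpace.norm_eq]
  refine Real.sqrt_le_iff.2 ⟨by have := R.width_pos; have := R.height_pos; positivity, ?_⟩
  simp only [Fin.sum_univ_two, Real.norm_eq_abs, sq_abs]
  nlinarith [R.width_pos, R.height_pos]

lemma hasInwardFrame : HasInwardFrame R.D := by
  intro x hx
  rw [mem_D_iff] at hx
  -- Along each axis, move away from the nearest of the two sides.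
  let σ : Fin 2 → ℝ := fun i => if R.coord x i ≤ R.sides i / 2 then 1 else -1
  have hσ : ∀ i, σ i ≠ 0 := fun i => by
    simp only [σ]
    split_ifs <;> norm_num
  refine ⟨fun i => σ i • R.unitVec i, ?_, min (R.sides 0) (R.sides 1) / 2, ?_, ?_⟩
  · have h1 : LinearIndependent ℝ (R.lin.symm ∘ EuclideanSpace.basisFun (Fin 2) ℝ) :=
      ((EuclideanSpace.basisFun (Fin 2) ℝ).orthonormal.comp_linearIsometryEquiv
        R.lin.symm).linearIndependent
    convert h1.units_smul fun i => Units.mk0 (σ i) (hσ i) using 2 with i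
    simp [unitVec, Units.smul_def]
  · have := R.sides_pos 0
    have := R.sides_pos 1
    positivity
  · intro i s hs
    rw [mem_D_iff]
    intro j
    simp only [coord_add, map_smul, lin_unitVec, PiLp.add_apply, PiLp.smul_apply,
      PiLp.single_apply, smul_eq_mul]
    have hm : s ≤ R.sides j / 2 := by
      refine hs.2.trans ?_
      gcongr
      fin_cases j
      · exact min_le_left _ _
      · exact min_le_right _ _
    have h0 := hs.1
    have := hx j
    by_cases hji : j = i
    · subst hji
      simp only [σ, if_true]
      split_ifs with h
      · constructor <;> linarith
      · push Not at h
        constructor <;> linarith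
    · simpa [hji] using this

lemma convex_D : Convex ℝ R.D := by
  refine Convex.affine_image (R.φ.toAffineEquiv : Plane →ᵃ[ℝ] Plane) ?_
  have : stdRectangle R.width R.height = (⋂ i, {x : Plane | 0 ≤ x i}) ∩
      ⋂ i, {x : Plane | x i ≤ R.sides i} := by
    ext x
    simp [stdRectangle, sides]
    tauto
  rw [this]
  exact (convex_iInter fun i =>
    convex_halfSpace_ge (EuclideanSpace.proj (𝕜 := ℝ) i).isLinear 0).inter
    (convex_iInter fun i => convex_halfSpace_le (EuclideanSpace.proj (𝕜 := ℝ) i).isLinear _)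

lemma subset_closure_interior : R.D ⊆ closure (interior R.D) := by
  have hne : (interior R.D).Nonempty := by
    refine ⟨R.φ (WithLp.toLp 2 fun i => R.sides i / 2), R.mem_interior_iff.2 fun i => ?_⟩
    have := R.sides_pos i
    simp only [coord, AffineIsometryEquiv.symm_apply_apply]
    constructor <;> linarith
  rw [R.convex_D.closure_interior_eq_closure_of_nonempty_interior hne]
  exact subset_closure

/-- A face which is a segment lies on one of the four sides: at each of its points exactly one
coordinate is extremal, and this coordinate is constant along the segment. -/
lemma segment_face {p q : Plane}
    (hF : openSegment ℝ p q ⊆ frontier R.D \ R.φ '' stdCorners R.width R.height) {x : Plane}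
    (hx : x ∈ openSegment ℝ p q) :
    ∃ i, (R.coord x i = 0 ∨ R.coord x i = R.sides i) ∧
      (∀ j ≠ i, 0 < R.coord x j ∧ R.coord x j < R.sides j) ∧ R.lin (q - p) i = 0 := by
  have hsub : openSegment ℝ p q ⊆ R.D := fun y hy => R.isClosed_D.frontier_subset (hF hy).1
  obtain ⟨hxf, hxc⟩ := hF hx
  rw [mem_corners_iff] at hxc
  push Not at hxc
  obtain ⟨j, hj0, hj1⟩ := hxc
  have hxD := R.mem_D_iff.1 (hsub hx)
  have hxi : x ∉ interior R.D := hxf.2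
  rw [mem_interior_iff] at hxi
  push Not at hxi
  obtain ⟨i, hi⟩ := hxi
  have hjlt : 0 < R.coord x j ∧ R.coord x j < R.sides j :=
    ⟨lt_of_le_of_ne (hxD j).1 hj0.symm, lt_of_le_of_ne (hxD j).2 hj1⟩
  have hii : R.coord x i = 0 ∨ R.coord x i = R.sides i := by
    by_cases h : 0 < R.coord x i
    · exact Or.inr (le_antisymm (hxD i).2 (hi h))
    · exact Or.inl (le_antisymm (not_lt.1 h) (hxD i).1)
  have hij : j ≠ i := by
    rintro rfl
    rcases hii with h | h
    · exact hj0 h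
    · exact hj1 h
  refine ⟨i, hii, fun k hk => ?_, ?_⟩
  · have : k = j := by
      fin_cases i <;> fin_cases j <;> fin_cases k <;> simp_all
    rwa [this]
  · -- Moving both ways along the segment stays on one side of the line containing that side.
    have hev : ∀ᶠ s in 𝓝 (0 : ℝ), x + s • (q - p) ∈ openSegment ℝ p q := by
      rw [openSegment_eq_image'] at hx ⊢
      obtain ⟨θ, hθ, rfl⟩ := hx
      have h1 : ∀ᶠ s in 𝓝 (0 : ℝ), θ + s ∈ Ioo (0 : ℝ) 1 :=
        (show Continuous fun s : ℝ => θ + s by fun_prop).continuousAt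
          (by simpa using isOpen_Ioo.mem_nhds hθ)
      filter_upwards [h1] with s hs
      exact ⟨θ + s, hs, by simp [add_smul, add_assoc]⟩
    obtain ⟨ε, hε, h⟩ := Metric.eventually_nhds_iff.1 hev
    have h1 := R.mem_D_iff.1 (hsub (h (y := ε / 2) (by
      rw [Real.dist_eq, sub_zero, abs_of_pos (by positivity)]; linarith))) i
    have h2 := R.mem_D_iff.1 (hsub (h (y := -(ε / 2)) (by
      rw [Real.dist_eq, sub_zero, abs_neg, abs_of_pos (by positivity)]; linarith))) i
    simp only [coord_add, map_smul, PiLp.add_apply, PiLp.smul_apply, smul_eq_mul] at h1 h2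
    rcases hii with h3 | h3 <;> rw [h3] at h1 h2
    · have : 0 ≤ R.lin (q - p) i := by
        by_contra! hneg
        nlinarith
      by_contra hne
      have : 0 < R.lin (q - p) i := lt_of_le_of_ne this (Ne.symm hne)
      nlinarith
    · rcases lt_trichotomy (R.lin (q - p) i) 0 with h4 | h4 | h4
      · nlinarith
      · exact h4
      · nlinarith

lemma isRegularStratification :
    IsRegularStratification (CrossingDomain.rectangle R).D (CrossingDomain.rectangle R).faces where
  isCompact := R.isCompact_D
  frame := R.hasInwardFrame
  subset_closure_interior := R.subset_closure_interior
  finite := R.finite_faces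
  cover := R.cover_faces
  disjoint := R.disjoint_faces
  face_cases F hF := by
    by_cases h : F = interior R.D
    · exact Or.inl h
    · rcases R.face_cases F hF h with ⟨p, -, rfl⟩ | ⟨p, q, hpq, rfl, -⟩
      · exact Or.inr (Or.inl ⟨p, rfl⟩)
      · exact Or.inr (Or.inr ⟨_, _, isCurveFace_openSegment hpq⟩)
  closure_cases F hF h := by
    rcases R.face_cases F hF h with ⟨p, -, rfl⟩ | ⟨p, q, hpq, rfl, hF'⟩
    · exact ⟨∅, finite_empty, by simp, by simp⟩
    · refine ⟨{(p, q - p), (q, q - p)}, by simp, ?_, ?_⟩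
      · have hcl : closure (openSegment ℝ p q) ⊆ R.D :=
          closure_minimal (fun y hy => R.isClosed_D.frontier_subset (hF' hy).1) R.isClosed_D
        rw [closure_openSegment] at hcl
        rintro z (rfl | rfl)
        · exact ⟨hcl (left_mem_segment ℝ p q), sub_ne_zero.2 hpq.symm,
            sub_mem_tangentSpaceAt_left p q⟩
        · exact ⟨hcl (right_mem_segment ℝ p q), sub_ne_zero.2 hpq.symm,
            sub_mem_tangentSpaceAt_right p q⟩
      · refine (closure_openSegment_diff p q).trans ?_
        rintro x (rfl | rfl) <;> simp

end RectangleData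

/-! ### The stratification of an annulus -/

/-- Rotation of the plane by a right angle. -/
def rot90 : Plane →L[ℝ] Plane :=
  LinearMap.toContinuousLinearMap
    { toFun := fun x => !₂[-x 1, x 0]
      map_add' := fun x y => by
        ext i
        fin_cases i <;> simp [add_comm]
      map_smul' := fun c x => by
        ext i
        fin_cases i <;> simp }

@[simp] lemma rot90_apply_zero (x : Plane) : rot90 x 0 = -x 1 := rfl

@[simp] lemma rot90_apply_one (x : Plane) : rot90 x 1 = x 0 := rfl

lemma Plane.norm_sq (x : Plane) : ‖x‖ ^ 2 = x 0 ^ 2 + x 1 ^ 2 := by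
  rw [EuclideanSpace.norm_sq_eq]
  simp

lemma norm_smul_add_smul_rot90_sq (a b : ℝ) (x : Plane) :
    ‖a • x + b • rot90 x‖ ^ 2 = (a ^ 2 + b ^ 2) * ‖x‖ ^ 2 := by
  simp only [Plane.norm_sq, PiLp.add_apply, PiLp.smul_apply, smul_eq_mul, rot90_apply_zero,
    rot90_apply_one]
  ring

lemma norm_rot90 (x : Plane) : ‖rot90 x‖ = ‖x‖ := by
  have := norm_smul_add_smul_rot90_sq 0 1 x
  simpa using this

lemma Plane.hasDerivAt {γ : ℝ → Plane} {v : Plane} {s : ℝ}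
    (h : ∀ i, HasDerivAt (fun t => γ t i) (v i) s) : HasDerivAt γ v s := by
  rw [hasDerivAt_iff_hasFDerivAt, ← hasFDerivWithinAt_univ, hasFDerivWithinAt_euclidean]
  intro i
  have := (h i).hasFDerivAt.hasFDerivWithinAt (s := univ)
  refine this.congr_fderiv ?_
  ext
  simp

section Circles

/-- The parametrization of the circle of radius `r` by the angle. -/
def circleCurve (r s : ℝ) : Plane := !₂[r * Real.cos s, r * Real.sin s]

lemma hasDerivAt_circleCurve (r s : ℝ) :
    HasDerivAt (circleCurve r) (rot90 (circleCurve r s)) s := by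
  refine Plane.hasDerivAt fun i => ?_
  fin_cases i
  · simpa [circleCurve] using (Real.hasDerivAt_cos s).const_mul r
  · simpa [circleCurve] using (Real.hasDerivAt_sin s).const_mul r

lemma isCurveFace_sphere {r : ℝ} (hr : 0 < r) :
    IsCurveFace (Metric.sphere 0 r) (circleCurve r) univ := by
  have hder := hasDerivAt_circleCurve r
  have hnorm : ∀ s, ‖circleCurve r s‖ = r := fun s => by
    have h : ‖circleCurve r s‖ ^ 2 = r ^ 2 := by
      rw [Plane.norm_sq]
      simp only [circleCurve, PiLp.toLp_apply, Matrix.cons_val_zero, Matrix.cons_val_one]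
      nlinarith [Real.sin_sq_add_cos_sq s]
    exact (pow_left_inj₀ (norm_nonneg _) hr.le two_ne_zero).1 h
  -- Factor through the unit circle, whose exponential parametrization is a local homeomorphism.
  let c : Circle → Plane := fun z => !₂[r * (z : ℂ).re, r * (z : ℂ).im]
  have hc : IsClosedEmbedding c := by
    refine Continuous.isClosedEmbedding ?_ ?_
    · refine (PiLp.continuous_toLp 2 _).comp (continuous_pi fun i => ?_)
      fin_cases i
      · exact continuous_const.mul (Complex.continuous_re.comp continuous_subtype_val)
      · exact continuous_const.mul (Complex.continuous_im.comp continuous_subtype_val)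
    · intro z w h
      have h0 := congrArg (fun x : Plane => x 0) h
      have h1 := congrArg (fun x : Plane => x 1) h
      simp only [c, Matrix.cons_val_zero, Matrix.cons_val_one,
        mul_eq_mul_left_iff, hr.ne',
        or_false] at h0 h1
      exact Circle.ext (Complex.ext h0 h1)
  have hcexp : c ∘ Circle.exp = circleCurve r := by
    ext s i
    fin_cases i <;> simp [c, circleCurve, Complex.exp_ofReal_mul_I_re, Complex.exp_ofReal_mul_I_im]
  have hrange : range c = Metric.sphere 0 r := by
    ext x
    constructor
    · rintro ⟨z, rfl⟩
      obtain ⟨s, rfl⟩ := Circle.exp_surjective z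
      have := congrFun hcexp s
      simp only [Function.comp_apply] at this
      rw [this, mem_sphere_zero_iff_norm, hnorm]
    · intro hx
      rw [mem_sphere_zero_iff_norm] at hx
      have h : x 0 ^ 2 + x 1 ^ 2 = r ^ 2 := by rw [← Plane.norm_sq, hx]
      refine ⟨⟨⟨x 0 / r, x 1 / r⟩, ?_⟩, ?_⟩
      · change _ ∈ Metric.sphere (0 : ℂ) 1
        rw [mem_sphere_zero_iff_norm, ← sq_eq_sq₀ (norm_nonneg _) zero_le_one, Complex.sq_norm,
          Complex.normSq_mk]
        field_simp
        linarith
      · ext i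
        fin_cases i
        · simp [c]
          field_simp
        · simp [c]
          field_simp
  refine ⟨?_, isOpen_univ, ?_, fun s => ?_, fun s _ => ?_, fun s hs v hv => ?_⟩
  · rw [contDiff_euclidean]
    intro i
    fin_cases i
    · exact contDiff_const.mul Real.contDiff_cos
    · exact contDiff_const.mul Real.contDiff_sin
  · rw [image_univ, ← hcexp, Circle.exp_surjective.range_comp, hrange]
  · rw [(hder s).deriv, ← norm_ne_zero_iff, norm_rot90, hnorm]
    exact hr.ne'
  · rw [← hcexp, ← hrange, ← Filter.map_map, isLocalHomeomorph_circleExp.map_nhds_eq,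
      hc.isEmbedding.map_nhds_eq]
    rfl
  · rw [(hder s).deriv]
    refine mem_span_singleton_of_cross_eq_zero ?_ ?_
    · rw [← norm_ne_zero_iff, norm_rot90, hnorm]
      exact hr.ne'
    · have h := apply_eq_zero_of_mem_tangentSpaceAt (g := fun y => ‖y‖ ^ 2)
        (hasStrictFDerivAt_norm_sq (circleCurve r s)).hasFDerivAt
        (fun y hy => by rw [mem_sphere_zero_iff_norm.1 hy, hnorm]) hv
      simp only [_root_.smul_apply, innerSL_apply_apply, PiLp.inner_apply, Fin.sum_univ_two] at h
      simp at h
      simp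
      linarith

end Circles

namespace AnnulusData

variable (N : AnnulusData)

/-- The closed annulus. -/
abbrev D : Set Plane := {x | N.inner ≤ ‖x‖ ∧ ‖x‖ ≤ N.outer}

lemma outer_pos : 0 < N.outer := N.inner_pos.trans N.inner_lt_outer

lemma isClosed_D : IsClosed N.D :=
  (isClosed_le continuous_const continuous_norm).inter
    (isClosed_le continuous_norm continuous_const)

lemma isCompact_D : IsCompact N.D := by
  refine Metric.isCompact_of_isClosed_isBounded N.isClosed_D ?_
  refine (Metric.isBounded_iff_subset_closedBall 0).2 ⟨N.outer, fun x hx => ?_⟩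
  rw [mem_closedBall_zero_iff]
  exact hx.2

lemma mem_interior_iff {x : Plane} : x ∈ interior N.D ↔ N.inner < ‖x‖ ∧ ‖x‖ < N.outer := by
  constructor
  · intro hx
    have hx0 : 0 < ‖x‖ := N.inner_pos.trans_le (interior_subset hx).1
    have hc : Continuous fun s : ℝ => (1 + s) • x := by fun_prop
    have hev : ∀ᶠ s in 𝓝 (0 : ℝ), (1 + s) • x ∈ N.D :=
      hc.continuousAt (by simpa using mem_interior_iff_mem_nhds.1 hx)
    obtain ⟨ε, hε, h⟩ := Metric.eventually_nhds_iff.1 hev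
    set δ := min ε 1 / 2
    have hδ : 0 < δ := by positivity
    have hδε : δ < ε := by have := min_le_left ε 1; simp only [δ]; linarith
    have hδ1 : δ < 1 := by have := min_le_right ε 1; simp only [δ]; linarith
    have h1 := (h (y := δ) (by rwa [Real.dist_eq, sub_zero, abs_of_pos hδ])).2
    have h2 := (h (y := -δ) (by rwa [Real.dist_eq, sub_zero, abs_neg, abs_of_pos hδ])).1
    rw [norm_smul, Real.norm_eq_abs, abs_of_pos (by linarith)] at h1 h2
    constructor <;> nlinarith
  · intro h
    have ho : IsOpen {x : Plane | N.inner < ‖x‖ ∧ ‖x‖ < N.outer} :=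
      (isOpen_lt continuous_const continuous_norm).inter
        (isOpen_lt continuous_norm continuous_const)
    have hsub : {x : Plane | N.inner < ‖x‖ ∧ ‖x‖ < N.outer} ⊆ N.D :=
      fun y hy => And.intro hy.1.le hy.2.le
    exact interior_maximal hsub ho h

lemma hasInwardFrame : HasInwardFrame N.D := by
  intro x hx
  have hx0 : 0 < ‖x‖ := N.inner_pos.trans_le hx.1
  -- Two diagonal directions, pointing outwards (`σ = 1`) away from the outer circle, and inwards
  -- (`σ = -1`) on it.
  have hind : ∀ σ : ℝ, σ ^ 2 = 1 → LinearIndependent ℝ ![σ • x + rot90 x, σ • x - rot90 x] := by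
    intro σ hσ
    rw [LinearIndependent.pair_iff]
    intro s t hst
    have h1 : ((s + t) * σ) • x + (s - t) • rot90 x = 0 := by
      rw [← hst]
      module
    have h2 := norm_smul_add_smul_rot90_sq ((s + t) * σ) (s - t) x
    rw [h1, mul_pow, hσ] at h2
    have h3 : 0 < ‖x‖ ^ 2 := by positivity
    have h4 : (s + t) ^ 2 * 1 + (s - t) ^ 2 = 0 := by
      have : ((s + t) ^ 2 * 1 + (s - t) ^ 2) * ‖x‖ ^ 2 = 0 := by rw [← h2]; simp
      exact (mul_eq_zero.1 this).resolve_right h3.ne'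
    constructor <;> nlinarith [sq_nonneg s, sq_nonneg t]
  have hsq : ∀ (σ : ℝ) (i : Fin 2) (s : ℝ), σ ^ 2 = 1 →
      ‖x + s • (![σ • x + rot90 x, σ • x - rot90 x] : Fin 2 → Plane) i‖ ^ 2 =
        ((1 + s * σ) ^ 2 + s ^ 2) * ‖x‖ ^ 2 := by
    intro σ i s hσ
    fin_cases i
    · rw [← norm_smul_add_smul_rot90_sq (1 + s * σ) s x]
      congr 2
      simp
      module
    · rw [← neg_sq s, ← norm_smul_add_smul_rot90_sq (1 + s * σ) (-s) x]
      congr 2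
      simp
      module
  have hmem : ∀ y : Plane, N.inner ^ 2 ≤ ‖y‖ ^ 2 → ‖y‖ ^ 2 ≤ N.outer ^ 2 → y ∈ N.D :=
    fun y h1 h2 =>
      ⟨(sq_le_sq₀ N.inner_pos.le (norm_nonneg _)).1 h1,
        (sq_le_sq₀ (norm_nonneg _) N.outer_pos.le).1 h2⟩
  have hin := pow_le_pow_left₀ N.inner_pos.le hx.1 2
  have hout := pow_le_pow_left₀ (norm_nonneg _) hx.2 2
  by_cases hb : ‖x‖ < N.outer
  · refine ⟨_, hind 1 (by norm_num), ?_⟩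
    have hb2 : ‖x‖ ^ 2 < N.outer ^ 2 := pow_lt_pow_left₀ hb (norm_nonneg _) two_ne_zero
    have hev : ∀ᶠ s in 𝓝 (0 : ℝ), ((1 + s * 1) ^ 2 + s ^ 2) * ‖x‖ ^ 2 < N.outer ^ 2 :=
      (show Continuous fun s : ℝ => ((1 + s * 1) ^ 2 + s ^ 2) * ‖x‖ ^ 2 by
        fun_prop).continuousAt.eventually_lt continuousAt_const (by simpa using hb2)
    obtain ⟨ε, hε, h⟩ := Metric.eventually_nhds_iff.1 hev
    refine ⟨ε / 2, by positivity, fun i s hs => hmem _ ?_ ?_⟩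
    · rw [hsq 1 i s (by norm_num)]
      have := hs.1
      nlinarith [sq_nonneg s, sq_nonneg ‖x‖]
    · rw [hsq 1 i s (by norm_num)]
      refine (h ?_).le
      rw [Real.dist_eq, sub_zero, abs_of_nonneg hs.1]
      linarith [hs.2]
  · refine ⟨_, hind (-1) (by norm_num), ?_⟩
    have hxb : ‖x‖ = N.outer := le_antisymm hx.2 (not_lt.1 hb)
    have hb2 : N.inner ^ 2 < ‖x‖ ^ 2 :=
      pow_lt_pow_left₀ (hxb ▸ N.inner_lt_outer) N.inner_pos.le two_ne_zero
    have hev : ∀ᶠ s in 𝓝 (0 : ℝ), N.inner ^ 2 < ((1 + s * -1) ^ 2 + s ^ 2) * ‖x‖ ^ 2 :=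
      continuousAt_const.eventually_lt (show Continuous fun s : ℝ =>
        ((1 + s * -1) ^ 2 + s ^ 2) * ‖x‖ ^ 2 by fun_prop).continuousAt (by simpa using hb2)
    obtain ⟨ε, hε, h⟩ := Metric.eventually_nhds_iff.1 hev
    refine ⟨min (ε / 2) 1, by positivity, fun i s hs => hmem _ ?_ ?_⟩
    · rw [hsq (-1) i s (by norm_num)]
      refine (h ?_).le
      rw [Real.dist_eq, sub_zero, abs_of_nonneg hs.1]
      linarith [hs.2.trans (min_le_left _ _)]
    · rw [hsq (-1) i s (by norm_num)]
      have h1 := hs.2.trans (min_le_right _ _)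
      have h0 := hs.1
      have h2 : (1 + s * -1) ^ 2 + s ^ 2 ≤ 1 := by nlinarith
      nlinarith [sq_nonneg ‖x‖]

lemma subset_closure_interior : N.D ⊆ closure (interior N.D) := by
  intro x hx
  have hx0 : 0 < ‖x‖ := N.inner_pos.trans_le hx.1
  have hlt := N.inner_lt_outer
  set m := (N.inner + N.outer) / 2
  -- Move radially towards the circle half way between the two boundary circles.
  have hc : Tendsto (fun s : ℝ => (1 + s * (m / ‖x‖ - 1)) • x) (𝓝[>] 0) (𝓝 x) := by
    have : Continuous fun s : ℝ => (1 + s * (m / ‖x‖ - 1)) • x := by fun_prop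
    simpa using (this.tendsto 0).mono_left nhdsWithin_le_nhds
  refine mem_closure_of_tendsto hc ?_
  filter_upwards [Ioo_mem_nhdsGT (zero_lt_one (α := ℝ))] with s hs
  rw [mem_interior_iff, norm_smul]
  have h1 : (1 + s * (m / ‖x‖ - 1)) * ‖x‖ = (1 - s) * ‖x‖ + s * m := by
    field_simp
    ring
  have hm : N.inner < m ∧ m < N.outer := by
    simp only [m]
    constructor <;> linarith
  have hmpos : 0 < m := N.inner_pos.trans hm.1
  have h2 : 0 ≤ 1 + s * (m / ‖x‖ - 1) := by
    have : 0 < m / ‖x‖ := by positivity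
    nlinarith [hs.1, hs.2, mul_pos hs.1 this]
  rw [Real.norm_eq_abs, abs_of_nonneg h2, h1]
  obtain ⟨hs0, hs1⟩ := hs
  constructor <;> nlinarith [hx.1, hx.2, hm.1, hm.2]

lemma isRegularStratification :
    IsRegularStratification (CrossingDomain.annulus N).D (CrossingDomain.annulus N).faces where
  isCompact := N.isCompact_D
  frame := N.hasInwardFrame
  subset_closure_interior := N.subset_closure_interior
  finite := by simp [CrossingDomain.faces]
  cover := by
    have hlt := N.inner_lt_outer
    simp only [CrossingDomain.faces, CrossingDomain.D, sUnion_insert, sUnion_singleton]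
    ext x
    simp only [mem_union, N.mem_interior_iff, mem_sphere_zero_iff_norm, mem_ofPred_eq]
    constructor
    · rintro (h | h | h)
      · exact ⟨h.1.le, h.2.le⟩
      · exact ⟨h.ge, h.trans_le hlt.le⟩
      · exact ⟨hlt.le.trans h.ge, h.le⟩
    · rintro ⟨h1, h2⟩
      rcases h1.eq_or_lt with h | h
      · exact Or.inr (Or.inl h.symm)
      · rcases h2.eq_or_lt with h' | h'
        · exact Or.inr (Or.inr h')
        · exact Or.inl ⟨h, h'⟩
  disjoint := by
    have hlt := N.inner_lt_outer
    have h1 : Disjoint (interior N.D) (Metric.sphere 0 N.inner) := by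
      rw [Set.disjoint_left]
      intro x hx hx'
      rw [mem_sphere_zero_iff_norm] at hx'
      exact absurd (N.mem_interior_iff.1 hx).1 (by linarith)
    have h2 : Disjoint (interior N.D) (Metric.sphere 0 N.outer) := by
      rw [Set.disjoint_left]
      intro x hx hx'
      rw [mem_sphere_zero_iff_norm] at hx'
      exact absurd (N.mem_interior_iff.1 hx).2 (by linarith)
    have h3 : Disjoint (Metric.sphere (0 : Plane) N.inner) (Metric.sphere 0 N.outer) := by
      rw [Set.disjoint_left]
      intro x hx hx'
      rw [mem_sphere_zero_iff_norm] at hx hx'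
      linarith
    rintro F (rfl | rfl | rfl) F' (rfl | rfl | rfl) hne
    · exact absurd rfl hne
    · exact h1
    · exact h2
    · exact h1.symm
    · exact absurd rfl hne
    · exact h3
    · exact h2.symm
    · exact h3.symm
    · exact absurd rfl hne
  face_cases F hF := by
    rcases hF with rfl | rfl | rfl
    · exact Or.inl rfl
    · exact Or.inr (Or.inr ⟨_, _, isCurveFace_sphere N.inner_pos⟩)
    · exact Or.inr (Or.inr ⟨_, _, isCurveFace_sphere N.outer_pos⟩)
  closure_cases F hF h := by
    refine ⟨∅, finite_empty, by simp, ?_⟩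
    rcases hF with rfl | rfl | rfl
    · exact absurd rfl h
    · simp [Metric.isClosed_sphere.closure_eq]
    · simp [Metric.isClosed_sphere.closure_eq]

end AnnulusData

lemma CrossingDomain.isRegularStratification (𝔇 : CrossingDomain) :
    IsRegularStratification 𝔇.D 𝔇.faces := by
  cases 𝔇 with
  | rectangle R => exact R.isRegularStratification
  | annulus N => exact N.isRegularStratification

/-! ### Jets of a Gaussian field -/

section Jets

variable {D : Set Plane}

lemma plane_eq_sum (v : Plane) :
    v = v 0 • EuclideanSpace.single 0 1 + v 1 • EuclideanSpace.single 1 1 := by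
  ext i
  fin_cases i <;> simp

lemma fderivWithin_apply_eq (u : Plane → ℝ) (x v : Plane) :
    fderivWithin ℝ u D x v = v 0 * partialWithin D 0 u x + v 1 * partialWithin D 1 u x := by
  conv_lhs => rw [plane_eq_sum v]
  simp [partialWithin]

lemma contDiffOn_fderivWithin (hD : UniqueDiffOn ℝ D) {u : Plane → ℝ} (hu : ContDiffOn ℝ 3 u D) :
    ContDiffOn ℝ 2 (fderivWithin ℝ u D) D :=
  hu.fderivWithin hD (by norm_num)

lemma contDiffOn_partialWithin (hD : UniqueDiffOn ℝ D) {u : Plane → ℝ} (hu : ContDiffOn ℝ 3 u D)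
    (i : Fin 2) : ContDiffOn ℝ 2 (partialWithin D i u) D :=
  (contDiffOn_fderivWithin hD hu).clm_apply contDiffOn_const

lemma differentiableOn_partialWithin_partialWithin (hD : UniqueDiffOn ℝ D) {u : Plane → ℝ}
    (hu : ContDiffOn ℝ 3 u D) (i j : Fin 2) :
    DifferentiableOn ℝ (partialWithin D i (partialWithin D j u)) D := by
  have h : ContDiffOn ℝ 1 (fderivWithin ℝ (partialWithin D j u) D) D :=
    (contDiffOn_partialWithin hD hu j).fderivWithin hD (by norm_num)
  exact (h.clm_apply contDiffOn_const).differentiableOn (by norm_num)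

lemma hasFDerivWithinAt_fderivWithin (hD : UniqueDiffOn ℝ D) {u : Plane → ℝ}
    (hu : ContDiffOn ℝ 3 u D) {x : Plane} (hx : x ∈ D) :
    HasFDerivWithinAt (fderivWithin ℝ u D) (fderivWithin ℝ (fderivWithin ℝ u D) D x) D x :=
  ((contDiffOn_fderivWithin hD hu).differentiableOn (by norm_num) x hx).hasFDerivWithinAt

lemma partialWithin_partialWithin (hD : UniqueDiffOn ℝ D) {u : Plane → ℝ}
    (hu : ContDiffOn ℝ 3 u D) {x : Plane} (hx : x ∈ D) (i j : Fin 2) :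
    partialWithin D i (partialWithin D j u) x =
      fderivWithin ℝ (fderivWithin ℝ u D) D x (EuclideanSpace.single i 1)
        (EuclideanSpace.single j 1) := by
  have h := (hasFDerivWithinAt_fderivWithin hD hu hx).clm_apply
    (hasFDerivWithinAt_const (EuclideanSpace.single j (1 : ℝ)) x D)
  have h2 : fderivWithin ℝ (partialWithin D j u) D x = _ := h.fderivWithin (hD x hx)
  rw [partialWithin, h2]
  simp

lemma partialWithin_comm (hD : UniqueDiffOn ℝ D) (hD' : D ⊆ closure (interior D)) {u : Plane → ℝ}
    (hu : ContDiffOn ℝ 3 u D) {x : Plane} (hx : x ∈ D) :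
    partialWithin D 1 (partialWithin D 0 u) x = partialWithin D 0 (partialWithin D 1 u) x := by
  rw [partialWithin_partialWithin hD hu hx, partialWithin_partialWithin hD hu hx]
  have := (hu x hx).isSymmSndFDerivWithinAt (by simp; norm_num) hD (hD' hx) hx
  exact this _ _

/-- The second derivative in terms of the entries of `derivativeJet`. -/
lemma fderivWithin_fderivWithin_apply (hD : UniqueDiffOn ℝ D) (hD' : D ⊆ closure (interior D))
    {u : Plane → ℝ} (hu : ContDiffOn ℝ 3 u D) {x : Plane} (hx : x ∈ D) (v w : Plane) :
    fderivWithin ℝ (fderivWithin ℝ u D) D x v w =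
      v 0 * w 0 * partialWithin D 0 (partialWithin D 0 u) x +
      (v 0 * w 1 + v 1 * w 0) * partialWithin D 0 (partialWithin D 1 u) x +
      v 1 * w 1 * partialWithin D 1 (partialWithin D 1 u) x := by
  have h := partialWithin_comm hD hD' hu hx
  rw [partialWithin_partialWithin hD hu hx, partialWithin_partialWithin hD hu hx] at h
  rw [partialWithin_partialWithin hD hu hx, partialWithin_partialWithin hD hu hx,
    partialWithin_partialWithin hD hu hx]
  conv_lhs => rw [plane_eq_sum v, plane_eq_sum w]
  simp only [map_add, map_smul, _root_.add_apply, _root_.smul_apply, smul_eq_mul]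
  rw [h]
  ring

namespace HasInwardFrame

variable (hD : HasInwardFrame D)
include hD

lemma isLimitFunctional_fderivWithin_apply {x : Plane} (hx : x ∈ D) (v : Plane) :
    IsLimitFunctional D (fun u => fderivWithin ℝ u D x v) :=
  hD.isLimitFunctional_fderivWithin (m := fun u => u) (fun _ hx => .eval hx)
    (fun _ hu => hu.differentiableOn (by norm_num)) hx v

lemma isLimitFunctional_partialWithin {x : Plane} (hx : x ∈ D) (i : Fin 2) :
    IsLimitFunctional D (fun u => partialWithin D i u x) :=
  hD.isLimitFunctional_fderivWithin_apply hx _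

lemma isLimitFunctional_partialWithin_partialWithin {x : Plane} (hx : x ∈ D) (i j : Fin 2) :
    IsLimitFunctional D (fun u => partialWithin D i (partialWithin D j u) x) :=
  hD.isLimitFunctional_fderivWithin (m := fun u => partialWithin D j u)
    (fun _ hx => hD.isLimitFunctional_partialWithin hx j)
    (fun _ hu => (contDiffOn_partialWithin hD.uniqueDiffOn hu j).differentiableOn (by norm_num)) hx _

lemma isLimitFunctional_twoPointJet {x y : Plane} (hx : x ∈ D) (hy : y ∈ D) (i : Fin 6) :
    IsLimitFunctional D (fun u => twoPointJet D u x y i) := by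
  fin_cases i
  · exact .eval hx
  · exact .eval hy
  · exact hD.isLimitFunctional_partialWithin hx 0
  · exact hD.isLimitFunctional_partialWithin hx 1
  · exact hD.isLimitFunctional_partialWithin hy 0
  · exact hD.isLimitFunctional_partialWithin hy 1

lemma isLimitFunctional_derivativeJet {x : Plane} (hx : x ∈ D) (i : Fin 5) :
    IsLimitFunctional D (fun u => derivativeJet D u x i) := by
  fin_cases i
  · exact hD.isLimitFunctional_partialWithin hx 0
  · exact hD.isLimitFunctional_partialWithin hx 1
  · exact hD.isLimitFunctional_partialWithin_partialWithin hx 0 0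
  · exact hD.isLimitFunctional_partialWithin_partialWithin hx 0 1
  · exact hD.isLimitFunctional_partialWithin_partialWithin hx 1 1

end HasInwardFrame

end Jets

section Bulinskaya

variable {Ω : Type*} [MeasurableSpace Ω] {P : Measure Ω} {D : Set Plane} {f : Ω → Plane → ℝ}

/-- Bulinskaya's lemma for a family of limit functionals of a Gaussian field. -/
theorem ae_forall_exists_functional_ne_zero [IsProbabilityMeasure P]
    (hf : IsNondegenerateGaussianField D P f)
    {V ι : Type*} [NormedAddCommGroup V] [NormedSpace ℝ V] [FiniteDimensional ℝ V] [Fintype ι]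
    (hdim : Module.finrank ℝ V < Fintype.card ι) (T : Set V) (Λ : V → ι → (Plane → ℝ) → ℝ)
    (hΛ : ∀ t ∈ T, ∀ i, IsLimitFunctional D (Λ t i))
    (hnd : ∀ t ∈ T, ∀ c : ι → ℝ, c ≠ 0 → 0 < Var[fun ω => ∑ i, c i * Λ t i (f ω); P])
    (hdiff : ∀ u, ContDiffOn ℝ 3 u D → ∀ t ∈ T, ∀ i,
      DifferentiableWithinAt ℝ (fun s => Λ s i u) T t) :
    ∀ᵐ ω ∂P, ∀ t ∈ T, ∃ i, Λ t i (f ω) ≠ 0 := by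
  refine ae_forall_exists_ne_zero hdim T (fun ω t i => Λ t i (f ω)) (fun t ht => ?_) ?_
  · have hL : ∀ c : ι → ℝ, IsLimitFunctional D (fun u => ∑ i, c i * Λ t i u) := fun c =>
      .sum _ _ fun i => (hΛ t ht i).smul (c i)
    exact exists_small_ball_bound (fun ω i => Λ t i (f ω))
      (fun c => ((hL c).gaussian hf.gaussian hf.centred hf.smooth).1)
      (fun c => ((hL c).gaussian hf.gaussian hf.centred hf.smooth).2) (hnd t ht)
  · filter_upwards [hf.smooth] with ω hω t ht h0
    have hO : ∀ i, ∃ K : ℝ, ∀ᶠ s in 𝓝[T] t, |Λ s i (f ω)| ≤ K * dist s t := by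
      intro i
      obtain ⟨K, hK⟩ := (hdiff (f ω) hω t ht i).isBigO_sub.bound
      refine ⟨K, hK.mono fun s hs => ?_⟩
      simpa [h0 i, dist_eq_norm] using hs
    choose K hK using hO
    obtain ⟨δ, hδ, h⟩ := Metric.mem_nhdsWithin_iff.1 (eventually_all.2 hK)
    refine ⟨∑ i, |K i|, δ, hδ, fun s hs hst i => (h ⟨hst, hs⟩ i).trans ?_⟩
    gcongr
    exact (le_abs_self _).trans (Finset.single_le_sum (f := fun i => |K i|)
      (fun i _ => abs_nonneg _) (Finset.mem_univ i))

/-- Non-degeneracy of `(f x - f y, ∇f x, ∇f y)`. -/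
lemma IsNondegenerateGaussianField.variance_pos_pair (hf : IsNondegenerateGaussianField D P f)
    {x y : Plane} (hx : x ∈ D) (hy : y ∈ D) (hxy : x ≠ y) {a : ℝ} {v w : Plane}
    (h : a ≠ 0 ∨ v ≠ 0 ∨ w ≠ 0) :
    0 < Var[fun ω => a * (f ω x - f ω y) + fderivWithin ℝ (f ω) D x v +
      fderivWithin ℝ (f ω) D y w; P] := by
  have := hf.nondegenerate_pair x hx y hy hxy ![a, -a, v 0, v 1, w 0, w 1] ?_
  · convert this using 3 with ω
    simp only [twoPointJet, Fin.sum_univ_succ, fderivWithin_apply_eq]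
    simp
    ring
  · intro h0
    have e0 := congrFun h0 0
    have e2 := congrFun h0 2
    have e3 := congrFun h0 3
    have e4 := congrFun h0 4
    have e5 := congrFun h0 5
    simp at e0 e2 e3 e4 e5
    rcases h with h | h | h
    · exact h e0
    · apply h
      ext i
      fin_cases i
      · exact e2
      · exact e3
    · apply h
      ext i
      fin_cases i
      · exact e4
      · exact e5

/-- Non-degeneracy of `(∇f x, ∇²f x)`, in terms of the differential of `f`. -/
lemma IsNondegenerateGaussianField.variance_pos_jet (hf : IsNondegenerateGaussianField D P f)
    {x : Plane} (hx : x ∈ D) {v : Plane} {a b c : ℝ}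
    (h : v ≠ 0 ∨ a ≠ 0 ∨ b ≠ 0 ∨ c ≠ 0) :
    0 < Var[fun ω => fderivWithin ℝ (f ω) D x v +
      (a * partialWithin D 0 (partialWithin D 0 (f ω)) x +
       b * partialWithin D 0 (partialWithin D 1 (f ω)) x +
       c * partialWithin D 1 (partialWithin D 1 (f ω)) x); P] := by
  have := hf.nondegenerate_jet x hx ![v 0, v 1, a, b, c] ?_
  · convert this using 3 with ω
    simp only [derivativeJet, Fin.sum_univ_succ, fderivWithin_apply_eq]
    simp
    ring
  · intro h0
    have e0 := congrFun h0 0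
    have e1 := congrFun h0 1
    have e2 := congrFun h0 2
    have e3 := congrFun h0 3
    have e4 := congrFun h0 4
    simp at e0 e1 e2 e3 e4
    rcases h with h | h | h | h
    · apply h
      ext i
      fin_cases i
      · exact e0
      · exact e1
    · exact h e2
    · exact h e3
    · exact h e4

end Bulinskaya

/-! ### Critical points of a Gaussian field -/

section Generic

variable {Ω : Type*} [MeasurableSpace Ω] {P : Measure Ω} [IsProbabilityMeasure P]
  {D : Set Plane} {faces : Set (Set Plane)} {f : Ω → Plane → ℝ}

/-- Each face has a parametrization by a subset of a vector space of the same dimension, with a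
frame of tangent vectors. -/
lemma IsRegularStratification.exists_chart (h : IsRegularStratification D faces) {F : Set Plane}
    (hF : F ∈ faces) : ∃ (k : ℕ) (γ : (Fin k → ℝ) → Plane) (e : Fin k → (Fin k → ℝ) → Plane)
      (S : Set (Fin k → ℝ)), Differentiable ℝ γ ∧ (∀ i, Differentiable ℝ (e i)) ∧ γ '' S = F ∧
      ∀ s ∈ S, LinearIndependent ℝ (fun i => e i s) ∧ ∀ i, e i s ∈ tangentSpaceAt F (γ s) := by
  rcases h.face_cases F hF with rfl | ⟨p, rfl⟩ | ⟨γ, I, hγ⟩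
  · refine ⟨2, WithLp.toLp 2, fun i _ => EuclideanSpace.basisFun (Fin 2) ℝ i,
      (WithLp.toLp 2) ⁻¹' interior D,
      (PiLp.continuousLinearEquiv 2 ℝ (fun _ : Fin 2 => ℝ)).symm.differentiable,
      fun i => by fun_prop, ?_, fun s hs => ⟨?_, fun i => ?_⟩⟩
    · exact image_preimage_eq _ (WithLp.toLp_surjective 2)
    · exact (EuclideanSpace.basisFun (Fin 2) ℝ).orthonormal.linearIndependent
    · rw [tangentSpaceAt_isOpen isOpen_interior hs]
      trivial
  · exact ⟨0, fun _ => p, fun i _ => i.elim0, univ, by fun_prop, fun i => i.elim0, by simp,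
      fun s _ => ⟨linearIndependent_empty_type, fun i => i.elim0⟩⟩
  · have hd : Differentiable ℝ (deriv γ) :=
      ((contDiff_infty_iff_deriv.1 hγ.smooth).2).differentiable (by simp)
    refine ⟨1, fun s => γ (s 0), fun _ s => deriv γ (s 0), {s | s 0 ∈ I},
      (hγ.smooth.differentiable (by simp)).comp (by fun_prop), fun i => hd.comp (by fun_prop), ?_,
      fun s hs => ⟨?_, fun i => hγ.deriv_mem hs⟩⟩
    · rw [← hγ.image_eq]
      ext x
      constructor
      · rintro ⟨s, hs, rfl⟩
        exact ⟨s 0, hs, rfl⟩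
      · rintro ⟨s, hs, rfl⟩
        exact ⟨fun _ => s, hs, rfl⟩
    · exact LinearIndependent.of_subsingleton 0 (hγ.deriv_ne_zero _)

lemma IsRegularStratification.face_subset (h : IsRegularStratification D faces) {F : Set Plane}
    (hF : F ∈ faces) : F ⊆ D := by
  rw [← h.cover]
  exact subset_sUnion_of_mem hF

/-- Almost surely, no two critical points on two given faces have the same value: on faces of
dimensions `k` and `k'`, these are `1 + k + k'` equations in `k + k'` parameters. -/
lemma ae_critical_values_ne (h : IsRegularStratification D faces)
    (hf : IsNondegenerateGaussianField D P f) {F F' : Set Plane} (hF : F ∈ faces)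
    (hF' : F' ∈ faces) : ∀ᵐ ω ∂P, ∀ x y, IsCriticalOn D F (f ω) x → IsCriticalOn D F' (f ω) y →
      x ≠ y → f ω x ≠ f ω y := by
  obtain ⟨k, γ, e, S, hγ, he, hS, hfr⟩ := h.exists_chart hF
  obtain ⟨k', γ', e', S', hγ', he', hS', hfr'⟩ := h.exists_chart hF'
  have hmem : ∀ s ∈ S, γ s ∈ D := fun s hs => h.face_subset hF (hS ▸ mem_image_of_mem γ hs)
  have hmem' : ∀ s ∈ S', γ' s ∈ D := fun s hs => h.face_subset hF' (hS' ▸ mem_image_of_mem γ' hs)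
  let T : Set ((Fin k → ℝ) × (Fin k' → ℝ)) := {t | t.1 ∈ S ∧ t.2 ∈ S' ∧ γ t.1 ≠ γ' t.2}
  let Λ : ((Fin k → ℝ) × (Fin k' → ℝ)) → (Unit ⊕ (Fin k ⊕ Fin k')) → (Plane → ℝ) → ℝ := fun t =>
    Sum.elim (fun _ u => u (γ t.1) + (-1) * u (γ' t.2))
      (Sum.elim (fun i u => fderivWithin ℝ u D (γ t.1) (e i t.1))
        (fun i u => fderivWithin ℝ u D (γ' t.2) (e' i t.2)))
  have key := ae_forall_exists_functional_ne_zero hf (V := (Fin k → ℝ) × (Fin k' → ℝ))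
    (ι := Unit ⊕ (Fin k ⊕ Fin k')) (by simp) T Λ ?_ ?_ ?_
  · filter_upwards [key] with ω hω x y hx hy hxy heq
    obtain ⟨s, hs, rfl⟩ := hS.symm ▸ hx.1
    obtain ⟨s', hs', rfl⟩ := hS'.symm ▸ hy.1
    obtain ⟨i | i | i, hi⟩ := hω (s, s') ⟨hs, hs', hxy⟩
    · apply hi
      simp [Λ, heq]
    · exact hi (hx.2 _ ((hfr s hs).2 i))
    · exact hi (hy.2 _ ((hfr' s' hs').2 i))
  · rintro ⟨s, s'⟩ ⟨hs, hs', hne⟩ (i | i | i)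
    · exact (IsLimitFunctional.eval (hmem s hs)).add ((IsLimitFunctional.eval (hmem' s' hs')).smul _)
    · exact h.frame.isLimitFunctional_fderivWithin_apply (hmem s hs) _
    · exact h.frame.isLimitFunctional_fderivWithin_apply (hmem' s' hs') _
  · rintro ⟨s, s'⟩ ⟨hs, hs', hne⟩ c hc
    have := hf.variance_pos_pair (hmem s hs) (hmem' s' hs') hne (a := c (Sum.inl ()))
      (v := ∑ i, c (Sum.inr (Sum.inl i)) • e i s) (w := ∑ i, c (Sum.inr (Sum.inr i)) • e' i s') ?_
    · convert this using 3 with ω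
      simp [Λ, Fintype.sum_sum_type]
      ring
    · by_contra! h0
      apply hc
      obtain ⟨h1, h2, h3⟩ := h0
      have h2' := Fintype.linearIndependent_iff.1 (hfr s hs).1 _ h2
      have h3' := Fintype.linearIndependent_iff.1 (hfr' s' hs').1 _ h3
      ext (i | i | i)
      · exact h1
      · exact h2' i
      · exact h3' i
  · rintro u hu ⟨s, s'⟩ ⟨hs, hs', hne⟩ i
    have hG := (contDiffOn_fderivWithin h.frame.uniqueDiffOn hu).differentiableOn
      (by norm_num)
    have hu1 : DifferentiableOn ℝ u D := hu.differentiableOn (by norm_num)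
    have m1 : MapsTo (fun t : (Fin k → ℝ) × (Fin k' → ℝ) => γ t.1) T D := fun t ht => hmem _ ht.1
    have m2 : MapsTo (fun t : (Fin k → ℝ) × (Fin k' → ℝ) => γ' t.2) T D :=
      fun t ht => hmem' _ ht.2.1
    have d1 : DifferentiableWithinAt ℝ (fun t : (Fin k → ℝ) × (Fin k' → ℝ) => γ t.1) T (s, s') :=
      ((hγ.comp differentiable_fst) _).differentiableWithinAt
    have d2 : DifferentiableWithinAt ℝ (fun t : (Fin k → ℝ) × (Fin k' → ℝ) => γ' t.2) T (s, s') :=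
      ((hγ'.comp differentiable_snd) _).differentiableWithinAt
    have u1 := (hu1 _ (hmem s hs)).comp (s, s') d1 m1
    have u2 := (hu1 _ (hmem' s' hs')).comp (s, s') d2 m2
    have G1 := (hG _ (hmem s hs)).comp (s, s') d1 m1
    have G2 := (hG _ (hmem' s' hs')).comp (s, s') d2 m2
    rcases i with i | i | i
    · exact u1.add (u2.const_mul (-1))
    · exact G1.clm_apply (((he i).comp differentiable_fst) (s, s')).differentiableWithinAt
    · exact G2.clm_apply (((he' i).comp differentiable_snd) (s, s')).differentiableWithinAt

/-- Almost surely, no critical point on `D` (for the two-dimensional derivative) is degenerate: the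
gradient and a direction in the kernel of the Hessian give four equations in three parameters. -/
lemma ae_hessian_nondegenerate (h : IsRegularStratification D faces)
    (hf : IsNondegenerateGaussianField D P f) : ∀ᵐ ω ∂P, ∀ x ∈ D, fderivWithin ℝ (f ω) D x = 0 →
      ∀ v, (∀ w, fderivWithin ℝ (fderivWithin ℝ (f ω) D) D x v w = 0) → v = 0 := by
  have hD := h.frame.uniqueDiffOn
  -- The parameter is a point together with the direction of a vector of the kernel of the Hessian.
  let Λ : (Plane × ℝ) → Fin 4 → (Plane → ℝ) → ℝ := fun t => ![
    fun u => partialWithin D 0 u t.1, fun u => partialWithin D 1 u t.1,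
    fun u => Real.cos t.2 * partialWithin D 0 (partialWithin D 0 u) t.1 +
      Real.sin t.2 * partialWithin D 0 (partialWithin D 1 u) t.1,
    fun u => Real.cos t.2 * partialWithin D 0 (partialWithin D 1 u) t.1 +
      Real.sin t.2 * partialWithin D 1 (partialWithin D 1 u) t.1]
  have key := ae_forall_exists_functional_ne_zero hf (V := Plane × ℝ) (ι := Fin 4) (by simp)
    (D ×ˢ univ) Λ ?_ ?_ ?_
  · filter_upwards [key, hf.smooth] with ω hω hs x hx h0 v hv
    by_contra hne
    have hn : 0 < ‖v‖ := norm_pos_iff.2 hne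
    let z : ℂ := ⟨v 0, v 1⟩
    have hz : ‖z‖ = ‖v‖ := by
      rw [← sq_eq_sq₀ (norm_nonneg _) (norm_nonneg _), Complex.sq_norm, Complex.normSq_mk,
        Plane.norm_sq]
      ring
    have hv0 : v 0 = ‖v‖ * Real.cos z.arg := by rw [← hz, Complex.norm_mul_cos_arg]
    have hv1 : v 1 = ‖v‖ * Real.sin z.arg := by rw [← hz, Complex.norm_mul_sin_arg]
    have e0 := hv (EuclideanSpace.single 0 1)
    have e1 := hv (EuclideanSpace.single 1 1)
    rw [fderivWithin_fderivWithin_apply hD h.subset_closure_interior hs hx] at e0 e1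
    simp [hv0, hv1] at e0 e1
    obtain ⟨i, hi⟩ := hω (x, z.arg) ⟨hx, trivial⟩
    apply hi
    fin_cases i
    · simp [Λ, partialWithin, h0]
    · simp [Λ, partialWithin, h0]
    · simp only [Λ]
      simp
      refine (mul_eq_zero.1 (?_ : ‖v‖ * _ = 0)).resolve_left hn.ne'
      linarith
    · simp only [Λ]
      simp
      refine (mul_eq_zero.1 (?_ : ‖v‖ * _ = 0)).resolve_left hn.ne'
      linarith
  · rintro ⟨x, θ⟩ ⟨hx, -⟩ i
    have h2 := fun i j => h.frame.isLimitFunctional_partialWithin_partialWithin hx i j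
    fin_cases i
    · exact h.frame.isLimitFunctional_partialWithin hx 0
    · exact h.frame.isLimitFunctional_partialWithin hx 1
    · exact ((h2 0 0).smul _).add ((h2 0 1).smul _)
    · exact ((h2 0 1).smul _).add ((h2 1 1).smul _)
  · rintro ⟨x, θ⟩ ⟨hx, -⟩ c hc
    have := hf.variance_pos_jet hx (v := !₂[c 0, c 1]) (a := c 2 * Real.cos θ)
      (b := c 2 * Real.sin θ + c 3 * Real.cos θ) (c := c 3 * Real.sin θ) ?_
    · convert this using 3 with ω
      rw [fderivWithin_apply_eq]
      simp [Λ, Fin.sum_univ_succ]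
      ring
    · by_contra! h0
      obtain ⟨h1, h2, h3, h4⟩ := h0
      have h10 := congrArg (fun v : Plane => v 0) h1
      have h11 := congrArg (fun v : Plane => v 1) h1
      simp at h10 h11
      have hcs := Real.sin_sq_add_cos_sq θ
      have h5 : c 2 = 0 ∧ c 3 = 0 := by
        rcases mul_eq_zero.1 h2 with h2 | h2
        · rw [h2, zero_mul, zero_add] at h3
          refine ⟨h2, ?_⟩
          linear_combination Real.sin θ * h4 + Real.cos θ * h3 - c 3 * hcs
        · rw [h2, mul_zero, add_zero] at h3
          rw [h2] at hcs
          constructor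
          · linear_combination Real.sin θ * h3 - c 2 * hcs
          · linear_combination Real.sin θ * h4 - c 3 * hcs
      apply hc
      ext i
      fin_cases i
      · exact h10
      · exact h11
      · exact h5.1
      · exact h5.2
  · rintro u hu ⟨x, θ⟩ ⟨hx, -⟩ i
    have m1 : MapsTo (fun t : Plane × ℝ => t.1) (D ×ˢ univ) D := fun t ht => ht.1
    have d1 : DifferentiableWithinAt ℝ (fun t : Plane × ℝ => t.1) (D ×ˢ univ) (x, θ) :=
      differentiableWithinAt_fst
    have p1 : ∀ i, DifferentiableWithinAt ℝ (fun t : Plane × ℝ => partialWithin D i u t.1)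
        (D ×ˢ univ) (x, θ) := fun i =>
      DifferentiableWithinAt.comp (g := partialWithin D i u) (f := fun t : Plane × ℝ => t.1) (x, θ)
        ((contDiffOn_partialWithin hD hu i).differentiableOn (by norm_num) x hx) d1 m1
    have p2 : ∀ i j, DifferentiableWithinAt ℝ
        (fun t : Plane × ℝ => partialWithin D i (partialWithin D j u) t.1) (D ×ˢ univ) (x, θ) :=
      fun i j => DifferentiableWithinAt.comp (g := partialWithin D i (partialWithin D j u))
        (f := fun t : Plane × ℝ => t.1) (x, θ)
        (differentiableOn_partialWithin_partialWithin hD hu i j x hx) d1 m1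
    have c1 : DifferentiableWithinAt ℝ (fun t : Plane × ℝ => Real.cos t.2) (D ×ˢ univ) (x, θ) :=
      (Real.differentiable_cos.comp differentiable_snd _).differentiableWithinAt
    have s1 : DifferentiableWithinAt ℝ (fun t : Plane × ℝ => Real.sin t.2) (D ×ˢ univ) (x, θ) :=
      (Real.differentiable_sin.comp differentiable_snd _).differentiableWithinAt
    match i with
    | 0 => exact p1 0
    | 1 => exact p1 1
    | 2 => exact (c1.fun_mul (p2 0 0)).fun_add (s1.fun_mul (p2 0 1))
    | 3 => exact (c1.fun_mul (p2 0 1)).fun_add (s1.fun_mul (p2 1 1))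

/-- Almost surely, the second derivative of the field along a curve does not vanish at the critical
points of its restriction to the curve. -/
lemma ae_curve_nondegenerate (h : IsRegularStratification D faces)
    (hf : IsNondegenerateGaussianField D P f) {F : Set Plane} (hF : F ∈ faces) {γ : ℝ → Plane}
    {I : Set ℝ} (hγ : IsCurveFace F γ I) : ∀ᵐ ω ∂P, ∀ s ∈ I,
      fderivWithin ℝ (f ω) D (γ s) (deriv γ s) = 0 →
      fderivWithin ℝ (fderivWithin ℝ (f ω) D) D (γ s) (deriv γ s) (deriv γ s) +
        fderivWithin ℝ (f ω) D (γ s) (deriv (deriv γ) s) ≠ 0 := by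
  have hD := h.frame.uniqueDiffOn
  have hmem : ∀ s ∈ I, γ s ∈ D := fun s hs =>
    h.face_subset hF (hγ.image_eq ▸ mem_image_of_mem γ hs)
  have hd0 : Differentiable ℝ γ := hγ.smooth.differentiable (by simp)
  have hs1 := (contDiff_infty_iff_deriv.1 hγ.smooth).2
  have hd1 : Differentiable ℝ (deriv γ) := hs1.differentiable (by simp)
  have hd2 : Differentiable ℝ (deriv (deriv γ)) :=
    (contDiff_infty_iff_deriv.1 hs1).2.differentiable (by simp)
  have hdi : ∀ i, Differentiable ℝ (fun s => deriv γ s i) := fun i =>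
    (EuclideanSpace.proj (𝕜 := ℝ) i).differentiable.comp hd1
  let Λ : ℝ → Fin 2 → (Plane → ℝ) → ℝ := fun s => ![
    fun u => fderivWithin ℝ u D (γ s) (deriv γ s),
    fun u => deriv γ s 0 * deriv γ s 0 * partialWithin D 0 (partialWithin D 0 u) (γ s) +
      (deriv γ s 0 * deriv γ s 1 + deriv γ s 1 * deriv γ s 0) *
        partialWithin D 0 (partialWithin D 1 u) (γ s) +
      deriv γ s 1 * deriv γ s 1 * partialWithin D 1 (partialWithin D 1 u) (γ s) +
      fderivWithin ℝ u D (γ s) (deriv (deriv γ) s)]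
  have key := ae_forall_exists_functional_ne_zero hf (V := ℝ) (ι := Fin 2) (by simp) I Λ ?_ ?_ ?_
  · filter_upwards [key, hf.smooth] with ω hω hu s hs h0 h1
    rw [fderivWithin_fderivWithin_apply hD h.subset_closure_interior hu (hmem s hs)] at h1
    obtain ⟨i, hi⟩ := hω s hs
    apply hi
    fin_cases i
    · exact h0
    · exact h1
  · intro s hs i
    have h2 := fun i j => h.frame.isLimitFunctional_partialWithin_partialWithin (hmem s hs) i j
    have h1 := fun v => h.frame.isLimitFunctional_fderivWithin_apply (hmem s hs) v
    fin_cases i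
    · exact h1 _
    · exact ((((h2 0 0).smul _).add ((h2 0 1).smul _)).add ((h2 1 1).smul _)).add (h1 _)
  · intro s hs c hc
    have := hf.variance_pos_jet (hmem s hs) (v := c 0 • deriv γ s + c 1 • deriv (deriv γ) s)
      (a := c 1 * (deriv γ s 0 * deriv γ s 0))
      (b := c 1 * (deriv γ s 0 * deriv γ s 1 + deriv γ s 1 * deriv γ s 0))
      (c := c 1 * (deriv γ s 1 * deriv γ s 1)) ?_
    · convert this using 3 with ω
      simp [Λ, Fin.sum_univ_succ]
      ring
    · by_contra! h0
      obtain ⟨h1, h2, -, h4⟩ := h0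
      have hc1 : c 1 = 0 := by
        by_contra hne
        apply hγ.deriv_ne_zero s
        ext i
        fin_cases i
        · simpa [hne] using h2
        · simpa [hne] using h4
      rw [hc1, zero_smul, add_zero, smul_eq_zero] at h1
      apply hc
      ext i
      fin_cases i
      · exact h1.resolve_right (hγ.deriv_ne_zero s)
      · exact hc1
  · intro u hu s hs i
    have m1 : MapsTo γ I D := hmem
    have d1 : DifferentiableWithinAt ℝ γ I s := (hd0 s).differentiableWithinAt
    have G1 := ((contDiffOn_fderivWithin hD hu).differentiableOn (by norm_num)
      _ (hmem s hs)).comp s d1 m1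
    have p2 : ∀ i j, DifferentiableWithinAt ℝ
        (fun t => partialWithin D i (partialWithin D j u) (γ t)) I s := fun i j =>
      (differentiableOn_partialWithin_partialWithin hD hu i j _ (hmem s hs)).comp s d1 m1
    have di : ∀ i, DifferentiableWithinAt ℝ (fun t => deriv γ t i) I s := fun i =>
      (hdi i s).differentiableWithinAt
    match i with
    | 0 => exact G1.clm_apply (hd1 s).differentiableWithinAt
    | 1 =>
      have h3 := ((di 0).fun_mul (di 0)).fun_mul (p2 0 0)
      have h4 := (((di 0).fun_mul (di 1)).fun_add ((di 1).fun_mul (di 0))).fun_mul (p2 0 1)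
      have h5 := ((di 1).fun_mul (di 1)).fun_mul (p2 1 1)
      exact ((h3.fun_add h4).fun_add h5).fun_add (G1.clm_apply (hd2 s).differentiableWithinAt)

/-- Almost surely, a given directional derivative at a given point does not vanish. -/
lemma ae_fderivWithin_apply_ne_zero (h : IsRegularStratification D faces)
    (hf : IsNondegenerateGaussianField D P f) {x v : Plane} (hx : x ∈ D) (hv : v ≠ 0) :
    ∀ᵐ ω ∂P, fderivWithin ℝ (f ω) D x v ≠ 0 := by
  have key := ae_forall_exists_functional_ne_zero hf (V := Fin 0 → ℝ) (ι := Unit) (by simp) univ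
    (fun _ _ u => fderivWithin ℝ u D x v)
    (fun _ _ _ => h.frame.isLimitFunctional_fderivWithin_apply hx v) ?_
    (fun u _ t _ i => differentiableWithinAt_const _)
  · filter_upwards [key] with ω hω
    obtain ⟨_, hi⟩ := hω 0 trivial
    exact hi
  · intro t _ c hc
    have := hf.variance_pos_jet hx (v := c () • v) (a := 0) (b := 0) (c := 0) (Or.inl ?_)
    · simpa using this
    · refine smul_ne_zero ?_ hv
      intro h0
      exact hc (by ext; exact h0)

/-- Almost surely, the gradient does not vanish on a given face of the boundary. -/
lemma ae_gradient_ne_zero (h : IsRegularStratification D faces)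
    (hf : IsNondegenerateGaussianField D P f) {F : Set Plane} (hF : F ∈ faces)
    (hne : F ≠ interior D) : ∀ᵐ ω ∂P, ∀ x ∈ F, fderivWithin ℝ (f ω) D x ≠ 0 := by
  rcases h.face_cases F hF with h1 | ⟨p, rfl⟩ | ⟨γ, I, hγ⟩
  · exact absurd h1 hne
  · have hv : (EuclideanSpace.single 0 1 : Plane) ≠ 0 := by simp
    filter_upwards [ae_fderivWithin_apply_ne_zero h hf (h.face_subset hF rfl) hv] with ω hω x hx h0
    rw [mem_singleton_iff] at hx
    subst hx
    rw [h0] at hω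
    exact hω rfl
  · have hmem : ∀ s ∈ I, γ s ∈ D := fun s hs =>
      h.face_subset hF (hγ.image_eq ▸ mem_image_of_mem γ hs)
    have key := ae_forall_exists_functional_ne_zero hf (V := ℝ) (ι := Fin 2) (by simp) I
      (fun s i u => partialWithin D i u (γ s))
      (fun s hs i => h.frame.isLimitFunctional_partialWithin (hmem s hs) i) ?_ ?_
    · filter_upwards [key] with ω hω x hx h0
      rw [← hγ.image_eq] at hx
      obtain ⟨s, hs, rfl⟩ := hx
      obtain ⟨i, hi⟩ := hω s hs
      apply hi
      simp [partialWithin, h0]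
    · intro s hs c hc
      have := hf.variance_pos_jet (hmem s hs) (v := WithLp.toLp 2 c) (a := 0) (b := 0) (c := 0)
        (Or.inl (by simpa using hc))
      simpa [fderivWithin_apply_eq] using this
    · intro u hu s hs i
      exact ((contDiffOn_partialWithin h.frame.uniqueDiffOn hu i).differentiableOn (by norm_num)
        _ (hmem s hs)).comp s (hγ.smooth.differentiable (by simp) s).differentiableWithinAt hmem

end Generic

/-! ### The perfect Morse property -/

section Hessian

variable {D : Set Plane} {u : Plane → ℝ}

lemma hasInvertibleHessianOn_singleton (p : Plane) : HasInvertibleHessianOn {p} u p := by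
  refine ⟨0, fun _ => p, ⟨contDiffAt_const, rfl, ?_, ?_⟩, fun v _ => Subsingleton.elim _ _⟩
  · exact Function.injective_of_subsingleton _
  · rw [nhdsWithin_singleton, Filter.map_const]

lemma hasInvertibleHessianOn_interior {x : Plane}
    (hx : x ∈ interior D)
    (h : ∀ v, (∀ w, fderivWithin ℝ (fderivWithin ℝ u D) D x v w = 0) → v = 0) :
    HasInvertibleHessianOn (interior D) u x := by
  have hψ : Filter.map (fun v : Plane => x + v) (𝓝 0) = 𝓝 x := by
    have h := (Homeomorph.addLeft x).map_nhds_eq 0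
    simp only [Homeomorph.coe_addLeft, add_zero] at h
    exact h
  have hfd : fderiv ℝ (fun v : Plane => x + v) 0 = ContinuousLinearMap.id ℝ Plane := by
    rw [fderiv_const_add, fderiv_fun_id]
  refine ⟨2, fun v => x + v, ⟨by fun_prop, by simp, ?_, ?_⟩, fun v hv => h v fun w => ?_⟩
  · rw [hfd]
    exact fun a b hab => hab
  · rw [hψ, isOpen_interior.nhdsWithin_eq hx]
  · have h1 : fderiv ℝ (u ∘ fun v : Plane => x + v) = fun v => fderiv ℝ u (x + v) := by
      ext1 v
      exact fderiv_comp_add_left x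
    have h2 := hv w
    rw [h1, fderiv_comp_add_left (f := fderiv ℝ u), add_zero] at h2
    have h3 : fderiv ℝ u =ᶠ[𝓝 x] fderivWithin ℝ u D := by
      filter_upwards [isOpen_interior.mem_nhds hx] with y hy
      rw [fderivWithin_of_mem_nhds (mem_interior_iff_mem_nhds.1 hy)]
    rwa [h3.fderiv_eq, ← fderivWithin_of_mem_nhds (mem_interior_iff_mem_nhds.1 hx)] at h2

/-- The second derivative of a function along a curve in a closed domain. -/
lemma hasDerivAt_comp_curve (hD : UniqueDiffOn ℝ D) (hu : ContDiffOn ℝ 3 u D) {γ : ℝ → Plane}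
    (hγ : ContDiff ℝ (⊤ : ℕ∞) γ) {I : Set ℝ} (hI : IsOpen I) (hm : MapsTo γ I D) {s : ℝ}
    (hs : s ∈ I) :
    HasDerivAt (u ∘ γ) (fderivWithin ℝ u D (γ s) (deriv γ s)) s ∧
    HasDerivAt (deriv (u ∘ γ))
      (fderivWithin ℝ (fderivWithin ℝ u D) D (γ s) (deriv γ s) (deriv γ s) +
        fderivWithin ℝ u D (γ s) (deriv (deriv γ) s)) s := by
  have hd0 : ∀ t, HasDerivAt γ (deriv γ t) t := fun t =>
    (hγ.differentiable (by simp) t).hasDerivAt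
  have hd1 : ∀ t, HasDerivAt (deriv γ) (deriv (deriv γ) t) t := fun t =>
    ((contDiff_infty_iff_deriv.1 hγ).2.differentiable (by simp) t).hasDerivAt
  have h1 : ∀ t ∈ I, HasDerivAt (u ∘ γ) (fderivWithin ℝ u D (γ t) (deriv γ t)) t := by
    intro t ht
    have h := (hu.differentiableOn (by norm_num) _ (hm ht)).hasFDerivWithinAt.comp_hasDerivWithinAt
      t (hd0 t).hasDerivWithinAt hm
    exact h.hasDerivAt (hI.mem_nhds ht)
  refine ⟨h1 s hs, ?_⟩
  have h2 : deriv (u ∘ γ) =ᶠ[𝓝 s] fun t => fderivWithin ℝ u D (γ t) (deriv γ t) := by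
    filter_upwards [hI.mem_nhds hs] with t ht
    exact (h1 t ht).deriv
  refine HasDerivAt.congr_of_eventuallyEq ?_ h2
  have h3 := (hasFDerivWithinAt_fderivWithin hD hu (hm hs)).comp_hasDerivWithinAt
      s (hd0 s).hasDerivWithinAt hm
  exact (h3.hasDerivAt (hI.mem_nhds hs)).clm_apply (hd1 s)

lemma hasInvertibleHessianOn_curve (hD : UniqueDiffOn ℝ D) (hu : ContDiffOn ℝ 3 u D)
    {F : Set Plane} {γ : ℝ → Plane} {I : Set ℝ} (hγ : IsCurveFace F γ I) (hF : F ⊆ D) {s : ℝ}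
    (hs : s ∈ I)
    (h : fderivWithin ℝ (fderivWithin ℝ u D) D (γ s) (deriv γ s) (deriv γ s) +
        fderivWithin ℝ u D (γ s) (deriv (deriv γ) s) ≠ 0) : HasInvertibleHessianOn F u (γ s) := by
  have hm : MapsTo γ I D := fun t ht => hF (hγ.image_eq ▸ mem_image_of_mem γ ht)
  have hder := fun t (ht : t ∈ I) => hasDerivAt_comp_curve hD hu hγ.smooth hγ.isOpen hm ht
  let ℓ : EuclideanSpace ℝ (Fin 1) → ℝ := fun v => s + v 0
  let pr : EuclideanSpace ℝ (Fin 1) →L[ℝ] ℝ := EuclideanSpace.proj 0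
  have hℓ : ∀ v, HasFDerivAt ℓ pr v := fun v => pr.hasFDerivAt.const_add s
  have hℓm : Filter.map ℓ (𝓝 0) = 𝓝 s := by
    have := (((PiLp.homeomorph 2 (fun _ : Fin 1 => ℝ)).trans
      (Homeomorph.funUnique (Fin 1) ℝ)).trans (Homeomorph.addLeft s)).map_nhds_eq 0
    exact this.trans (congrArg 𝓝 (add_zero s))
  have hψ : ∀ v, HasFDerivAt (γ ∘ ℓ) (pr.smulRight (deriv γ (ℓ v))) v := fun v => by
    have h1 := ((hγ.smooth.differentiable (by simp)) (ℓ v)).hasDerivAt.hasFDerivAt.comp v (hℓ v)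
    refine h1.congr_fderiv ?_
    ext w
    simp
  refine ⟨1, γ ∘ ℓ, ⟨?_, by simp [ℓ], ?_, ?_⟩, fun v hv => ?_⟩
  · refine (hγ.smooth.comp ?_).contDiffAt
    exact contDiff_const.add pr.contDiff
  · rw [(hψ 0).fderiv]
    intro v w hvw
    have h1 : (v 0 - w 0) • deriv γ (ℓ 0) = 0 := by
      rw [sub_smul, sub_eq_zero]
      exact hvw
    have h2 := (smul_eq_zero.1 h1).resolve_right (hγ.deriv_ne_zero _)
    ext i
    rw [Subsingleton.elim i 0]
    linarith
  · rw [← Filter.map_map, hℓm, hγ.map_nhds s hs]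
  · have hcomp : u ∘ (γ ∘ ℓ) = (u ∘ γ) ∘ ℓ := rfl
    have hev : ∀ᶠ v in 𝓝 (0 : EuclideanSpace ℝ (Fin 1)), ℓ v ∈ I :=
      (hℓm.le.trans (le_refl _) : Tendsto ℓ (𝓝 0) (𝓝 s)) (hγ.isOpen.mem_nhds hs)
    have h1 : fderiv ℝ ((u ∘ γ) ∘ ℓ) =ᶠ[𝓝 0] fun v => deriv (u ∘ γ) (ℓ v) • pr := by
      filter_upwards [hev] with v hv
      rw [((hder _ hv).1.comp_hasFDerivAt v (hℓ v)).fderiv, (hder _ hv).1.deriv]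
    have hℓ0 : ℓ 0 = s := by simp [ℓ]
    have h2 : HasFDerivAt (fun v => deriv (u ∘ γ) (ℓ v) • pr) _ 0 :=
      ((hℓ0.symm ▸ (hder s hs).2 : HasDerivAt (deriv (u ∘ γ)) _ (ℓ 0)).comp_hasFDerivAt 0
        (hℓ 0)).smul_const pr
    have h3 := hv (EuclideanSpace.single 0 1)
    rw [hcomp, h1.fderiv_eq, h2.fderiv] at h3
    simp [pr] at h3
    ext i
    rw [Subsingleton.elim i 0]
    exact h3.resolve_left (hℓ0.symm ▸ h)

end Hessian

section PerfectMorse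

variable {Ω : Type*} [MeasurableSpace Ω] {P : Measure Ω} [IsProbabilityMeasure P]
  {f : Ω → Plane → ℝ}

/-- A non-degenerate Gaussian field is almost surely a perfect Morse function. -/
theorem ae_isPerfectMorse (𝔇 : CrossingDomain) (hf : IsNondegenerateGaussianField 𝔇.D P f) :
    ∀ᵐ ω ∂P, 𝔇.IsPerfectMorse (f ω) := by
  have h := 𝔇.isRegularStratification
  have hD := h.frame.uniqueDiffOn
  have := h.finite.countable.to_subtype
  have A1 : ∀ᵐ ω ∂P, ∀ F F' : 𝔇.faces, ∀ x y, IsCriticalOn 𝔇.D F (f ω) x →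
      IsCriticalOn 𝔇.D F' (f ω) y → x ≠ y → f ω x ≠ f ω y := by
    simp only [ae_all_iff (ι := 𝔇.faces)]
    exact fun F F' => ae_critical_values_ne h hf F.2 F'.2
  have A2 := ae_hessian_nondegenerate h hf
  have A3 : ∀ᵐ ω ∂P, ∀ F : 𝔇.faces, ∀ x, IsCriticalOn 𝔇.D F (f ω) x →
      HasInvertibleHessianOn F (f ω) x := by
    rw [ae_all_iff]
    rintro ⟨F, hF⟩
    rcases h.face_cases F hF with rfl | ⟨p, rfl⟩ | ⟨γ, I, hγ⟩
    · filter_upwards [A2] with ω hω x hx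
      refine hasInvertibleHessianOn_interior hx.1 (hω x (interior_subset hx.1) ?_)
      ext v
      refine hx.2 v ?_
      rw [tangentSpaceAt_isOpen isOpen_interior hx.1]
      trivial
    · refine ae_of_all _ fun ω x hx => ?_
      have := hx.1
      rw [mem_singleton_iff] at this
      subst this
      exact hasInvertibleHessianOn_singleton x
    · filter_upwards [ae_curve_nondegenerate h hf hF hγ, hf.smooth] with ω hω hu x hx
      obtain ⟨s, hs, rfl⟩ := hγ.image_eq.symm ▸ hx.1
      exact hasInvertibleHessianOn_curve hD hu hγ (h.face_subset hF) hs
        (hω s hs (hx.2 _ (hγ.deriv_mem hs)))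
  have A4 : ∀ᵐ ω ∂P, ∀ F : 𝔇.faces, F.1 ≠ interior 𝔇.D → ∀ x ∈ F.1,
      fderivWithin ℝ (f ω) 𝔇.D x ≠ 0 := by
    rw [ae_all_iff]
    intro F
    by_cases hF : F.1 = interior 𝔇.D
    · exact ae_of_all _ fun ω h => absurd hF h
    · filter_upwards [ae_gradient_ne_zero h hf F.2 hF] with ω hω _ using hω
  have A5 : ∀ᵐ ω ∂P, ∀ F : 𝔇.faces, F.1 ≠ interior 𝔇.D → ∀ x ∈ closure F.1 \ F.1,
      ∃ v ∈ tangentSpaceAt F.1 x, fderivWithin ℝ (f ω) 𝔇.D x v ≠ 0 := by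
    rw [ae_all_iff]
    intro F
    by_cases hF : F.1 = interior 𝔇.D
    · exact ae_of_all _ fun ω h => absurd hF h
    · obtain ⟨Z, hZ, hZ1, hZ2⟩ := h.closure_cases F.1 F.2 hF
      have := (ae_ball_iff hZ.countable).2 fun z hz =>
        ae_fderivWithin_apply_ne_zero h hf (hZ1 z hz).1 (hZ1 z hz).2.1
      filter_upwards [this] with ω hω _ x hx
      obtain ⟨z, hz, rfl⟩ := hZ2 hx
      exact ⟨z.2, (hZ1 z hz).2.2, hω z hz⟩
  filter_upwards [A1, A3, A4, A5, hf.smooth] with ω h1 h3 h4 h5 hu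
  refine ⟨hu.of_le (by norm_num), ?_, fun F hF => h3 ⟨F, hF⟩, ?_⟩
  · rintro x y ⟨F, hF, hx⟩ ⟨F', hF', hy⟩ hxy
    exact h1 ⟨F, hF⟩ ⟨F', hF'⟩ x y hx hy hxy
  · intro F hF F' hF' hne hsub x hx
    have hx' : x ∉ F' := disjoint_left.1 (h.disjoint hF hF' hne) hx
    by_cases hi : F' = interior 𝔇.D
    · have hg := h4 ⟨F, hF⟩ (hi ▸ hne) x hx
      subst hi
      by_contra! hcon
      apply hg
      ext v
      refine hcon v ?_
      have hcl : closure (interior 𝔇.D) = 𝔇.D :=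
        Subset.antisymm (closure_minimal interior_subset h.isCompact.isClosed)
          h.subset_closure_interior
      rw [hcl, h.frame.tangentSpaceAt_eq_top (h.face_subset hF hx)]
      trivial
    · obtain ⟨v, hv, hv'⟩ := h5 ⟨F', hF'⟩ hi x ⟨hsub hx, hx'⟩
      exact ⟨v, by rwa [tangentSpaceAt_closure], hv'⟩

end PerfectMorse

/-! ### Rotations of pairs of independent copies -/

section Interpolation

variable {Ω : Type*} [MeasurableSpace Ω] {P : Measure Ω} [IsProbabilityMeasure P]
  {D : Set Plane} {f g : Ω → Plane → ℝ}

/-- The law of a process is determined by its finite-dimensional marginals. -/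
lemma identDistrib_of_forall_finset {T E : Type*} [MeasurableSpace E] {X Y : Ω → T → E}
    (hX : AEMeasurable X P) (hY : AEMeasurable Y P)
    (h : ∀ I : Finset T, P.map (fun ω => I.restrict (X ω)) = P.map (fun ω => I.restrict (Y ω))) :
    IdentDistrib X Y P P := by
  refine ⟨hX, hY, ?_⟩
  have := Measure.isProbabilityMeasure_map hX
  have := Measure.isProbabilityMeasure_map hY
  refine IsProjectiveLimit.unique (P := fun I : Finset T => P.map (fun ω => I.restrict (X ω))) ?_ ?_
  · intro I
    rw [AEMeasurable.map_map_of_aemeasurable (by fun_prop) hX]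
    rfl
  · intro I
    rw [AEMeasurable.map_map_of_aemeasurable (by fun_prop) hY]
    exact (h I).symm

/-- The law of a pair of independent copies of a centred Gaussian field is invariant under
rotations. -/
lemma identDistrib_rotation (hf : IsNondegenerateGaussianField D P f)
    (hg : IsIndependentCopy D P f g) (θ : ℝ) :
    IdentDistrib (fun ω => ((fun x : D => f ω x), fun x : D => g ω x))
      (fun ω => ((fun x : D => Real.cos θ * f ω x + Real.sin θ * g ω x),
        fun x : D => -Real.sin θ * f ω x + Real.cos θ * g ω x)) P P := by
  have hfm := hg.identDistrib.aemeasurable_fst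
  have hgm := hg.identDistrib.aemeasurable_snd
  let pair : (D → ℝ) × (D → ℝ) → D → ℝ × ℝ := fun z x => (z.1 x, z.2 x)
  have hpair : Measurable pair := by fun_prop
  let rot : (D → ℝ) × (D → ℝ) → (D → ℝ) × (D → ℝ) := fun z =>
    (fun x => Real.cos θ * z.1 x + Real.sin θ * z.2 x,
      fun x => -Real.sin θ * z.1 x + Real.cos θ * z.2 x)
  have hrot : Measurable rot := by fun_prop
  have key : IdentDistrib (fun ω => pair ((fun x : D => f ω x), fun x : D => g ω x))
      (fun ω => pair (rot ((fun x : D => f ω x), fun x : D => g ω x))) P P := by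
    refine identDistrib_of_forall_finset (hpair.comp_aemeasurable (hfm.prodMk hgm))
      ((hpair.comp hrot).comp_aemeasurable (hfm.prodMk hgm)) fun I => ?_
    let X : Ω → I → ℝ := fun ω => I.restrict (fun x : D => f ω x)
    let Y : Ω → I → ℝ := fun ω => I.restrict (fun x : D => g ω x)
    have hX : AEMeasurable X P := (Finset.measurable_restrict I).comp_aemeasurable hfm
    have hY : AEMeasurable Y P := (Finset.measurable_restrict I).comp_aemeasurable hgm
    have hG : IsGaussian (P.map X) := (hf.gaussian.hasGaussianLaw I).isGaussian_map
    have hXY : P.map X = P.map Y :=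
      (hg.identDistrib.comp (Finset.measurable_restrict I)).map_eq
    have hind : IndepFun X Y P :=
      hg.indep.comp (Finset.measurable_restrict I) (Finset.measurable_restrict I)
    have hprod : P.map (fun ω => (X ω, Y ω)) = (P.map X).prod (P.map X) := by
      rw [(indepFun_iff_map_prod_eq_prod_map_map hX hY).1 hind, hXY]
    have hmean : (P.map X)[id] = 0 := by
      ext x
      have h1 : Integrable id (P.map X) := IsGaussian.integrable_id
      rw [eval_integral (fun i => (integrable_pi_iff.1 h1 i))]
      simp only [id]
      rw [integral_map hX (measurable_pi_apply x).aestronglyMeasurable]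
      exact hf.centred _ x.1.2
    have hinv := IsGaussian.map_rotation_eq_self hmean θ
    let m : (I → ℝ) × (I → ℝ) → I → ℝ × ℝ := fun z x => (z.1 x, z.2 x)
    have hm : Measurable m := by fun_prop
    rw [← hprod, AEMeasurable.map_map_of_aemeasurable (by fun_prop) (hX.prodMk hY)] at hinv
    have h2 := congrArg (fun μ => μ.map m) hinv
    rw [AEMeasurable.map_map_of_aemeasurable hm.aemeasurable (by
        have : Measurable (ContinuousLinearMap.rotation θ :
          (I → ℝ) × (I → ℝ) →L[ℝ] (I → ℝ) × (I → ℝ)) := by fun_prop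
        exact this.comp_aemeasurable (hX.prodMk hY)),
      AEMeasurable.map_map_of_aemeasurable hm.aemeasurable (hX.prodMk hY)] at h2
    exact h2.symm
  exact key.comp (u := fun (w : D → ℝ × ℝ) => ((fun x => (w x).1), fun x => (w x).2))
    (by fun_prop)

lemma identDistrib_cos_sin (hf : IsNondegenerateGaussianField D P f)
    (hg : IsIndependentCopy D P f g) (θ : ℝ) :
    IdentDistrib (fun ω (x : D) => f ω x)
      (fun ω (x : D) => Real.cos θ * f ω x + Real.sin θ * g ω x) P P :=
  (identDistrib_rotation hf hg θ).comp measurable_fst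

/-- The hypotheses on the field depend only on its law, beyond the regularity of its paths. -/
lemma IsNondegenerateGaussianField.of_identDistrib (h : HasInwardFrame D)
    (hf : IsNondegenerateGaussianField D P f) {f' : Ω → Plane → ℝ}
    (hs : ∀ᵐ ω ∂P, ContDiffOn ℝ 3 (f' ω) D)
    (hid : IdentDistrib (fun ω (x : D) => f ω x) (fun ω (x : D) => f' ω x) P P) :
    IsNondegenerateGaussianField D P f' where
  gaussian := ⟨fun I => ⟨by
    have := (hid.comp (Finset.measurable_restrict I)).map_eq
    have h1 := (hf.gaussian.hasGaussianLaw I).isGaussian_map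
    rw [show (fun ω => I.restrict fun x : D => f ω x) =
      I.restrict ∘ (fun ω (x : D) => f ω x) from rfl, this] at h1
    exact h1⟩⟩
  centred x hx := by
    rw [← hf.centred x hx]
    exact ((hid.comp (measurable_pi_apply (⟨x, hx⟩ : D))).integral_eq).symm
  smooth := hs
  nondegenerate_pair x hx y hy hxy c hc := by
    have hL : IsLimitFunctional D (fun u => ∑ i, c i * twoPointJet D u x y i) :=
      .sum _ _ fun i => (h.isLimitFunctional_twoPointJet hx hy i).smul _
    rw [← (hL.identDistrib hid hf.smooth hs).variance_eq]
    exact hf.nondegenerate_pair x hx y hy hxy c hc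
  nondegenerate_jet x hx c hc := by
    have hL : IsLimitFunctional D (fun u => ∑ i, c i * derivativeJet D u x i) :=
      .sum _ _ fun i => (h.isLimitFunctional_derivativeJet hx i).smul _
    rw [← (hL.identDistrib hid hf.smooth hs).variance_eq]
    exact hf.nondegenerate_jet x hx c hc

lemma exp_neg_eq_cos {t : ℝ} (ht : 0 ≤ t) :
    Real.exp (-t) = Real.cos (Real.arccos (Real.exp (-t))) ∧
    √(1 - Real.exp (-2 * t)) = Real.sin (Real.arccos (Real.exp (-t))) := by
  constructor
  · rw [Real.cos_arccos (by linarith [Real.exp_pos (-t)]) (Real.exp_le_one_iff.2 (by linarith))]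
  · rw [Real.sin_arccos, ← Real.exp_nat_mul]
    congr 3
    push_cast
    ring

lemma IsNondegenerateGaussianField.interpolate (h : HasInwardFrame D)
    (hf : IsNondegenerateGaussianField D P f) (hg : IsIndependentCopy D P f g) {t : ℝ}
    (ht : 0 ≤ t) : IsNondegenerateGaussianField D P (interpolate f g t) := by
  refine hf.of_identDistrib h ?_ ?_
  · filter_upwards [hf.smooth, hg.smooth] with ω h1 h2
    exact (contDiffOn_const.mul h1).add (contDiffOn_const.mul h2)
  · have := identDistrib_cos_sin hf hg (Real.arccos (Real.exp (-t)))
    rw [← (exp_neg_eq_cos ht).1, ← (exp_neg_eq_cos ht).2] at this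
    exact this

end Interpolation

/-! ### The threshold height -/

namespace CrossingDomain

variable (𝔇 : CrossingDomain)

/-- A map `Φ` which transports crossings to crossings, in the form used below: a function which is
nonnegative on the image under `Φ` of the nonnegative set of a function with a crossing has
a crossing. -/
def IsAdmissible (Φ : Plane → Plane) : Prop :=
  ∀ w ∈ 𝔇.A, ∀ w' : Plane → ℝ, ContinuousOn w' 𝔇.D → (∀ x ∈ 𝔇.D, 0 ≤ w x → 0 ≤ w' (Φ x)) →
    w' ∈ 𝔇.A

lemma isCompact_D : IsCompact 𝔇.D := 𝔇.isRegularStratification.isCompact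

variable {𝔇}

lemma isAdmissible_rectangle {R : RectangleData} {Φ : Plane → Plane} (hc : ContinuousOn Φ R.D)
    (hD : MapsTo Φ R.D R.D) (h₀ : MapsTo Φ (closure R.S₀) (closure R.S₀))
    (h₂ : MapsTo Φ (closure R.S₂) (closure R.S₂)) : (rectangle R).IsAdmissible Φ := by
  rintro w ⟨-, x, hx, y, hy, hxy⟩ w' hw' h
  refine ⟨hw', Φ x, h₀ hx, Φ y, h₂ hy, ?_⟩
  obtain ⟨γ, hγ⟩ := hxy
  refine ⟨γ.map' (hc.mono ?_), fun t => ⟨hD (hγ t).1, h _ (hγ t).1 (hγ t).2⟩⟩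
  rintro _ ⟨t, rfl⟩
  exact (hγ t).1

/-- A homeomorphism of the whole plane which fixes the centre maps the component of the centre in the
complement of a circuit to the analogous component for the image of the circuit. -/
lemma isAdmissible_annulus {N : AnnulusData} (Φ : Plane ≃ₜ Plane) (h0 : Φ 0 = 0)
    (hD : MapsTo Φ N.D N.D) : (annulus N).IsAdmissible Φ := by
  rintro w ⟨-, p, γ, hγ, hb⟩ w' hw' h
  refine ⟨hw', Φ p, γ.map Φ.continuous, ?_, ?_⟩
  · rintro _ ⟨t, rfl⟩
    have := hγ (mem_range_self t)
    exact ⟨hD this.1, h _ this.1 this.2⟩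
  · have h1 : (range (γ.map Φ.continuous))ᶜ = Φ '' (range γ)ᶜ := by
      rw [image_compl_eq Φ.bijective, ← range_comp]
      rfl
    have h2 : (0 : Plane) ∈ (range γ)ᶜ := by
      intro h
      have := (hγ h).1.1
      rw [norm_zero] at this
      exact absurd N.inner_pos this.not_gt
    have h3 := Φ.image_connectedComponentIn h2
    rw [h0] at h3
    rw [h1, ← h3]
    exact ((hb.isCompact_closure.image Φ.continuous).isBounded).subset
      (image_mono subset_closure)

lemma isAdmissible_id : 𝔇.IsAdmissible id := by
  cases 𝔇 with
  | rectangle R =>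
    exact isAdmissible_rectangle continuousOn_id (mapsTo_id _) (mapsTo_id _) (mapsTo_id _)
  | annulus N => exact isAdmissible_annulus (Homeomorph.refl _) rfl (mapsTo_id _)

lemma mem_A_mono {u v : Plane → ℝ} (hu : u ∈ 𝔇.A) (hv : ContinuousOn v 𝔇.D)
    (h : ∀ x ∈ 𝔇.D, u x ≤ v x) : v ∈ 𝔇.A :=
  isAdmissible_id u hu v hv fun x hx hux => hux.trans (h x hx)

lemma mem_A_congr {u v : Plane → ℝ} (h : EqOn u v 𝔇.D) : u ∈ 𝔇.A ↔ v ∈ 𝔇.A := by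
  have key : ∀ {u v : Plane → ℝ}, EqOn u v 𝔇.D → u ∈ 𝔇.A → v ∈ 𝔇.A := by
    intro u v h hu
    have hc : ContinuousOn u 𝔇.D := by
      cases 𝔇 with
      | rectangle R => exact hu.1
      | annulus N => exact hu.1
    exact mem_A_mono hu (hc.congr h.symm) fun x hx => (h hx).le
  exact ⟨key h, key h.symm⟩

/-- A nonnegative function has a crossing: a segment in the convex rectangle, or the inner boundary
circle of the annulus. -/
lemma mem_A_of_nonneg {u : Plane → ℝ} (hu : ContinuousOn u 𝔇.D) (h : ∀ x ∈ 𝔇.D, 0 ≤ u x) :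
    u ∈ 𝔇.A := by
  cases 𝔇 with
  | rectangle R =>
    have hne : ∀ S : Set Plane, Nonempty (S ≃ₜ Ioo (0 : ℝ) 1) → S.Nonempty := by
      rintro S ⟨e⟩
      exact ⟨_, (e.symm ⟨1 / 2, by norm_num, by norm_num⟩).2⟩
    obtain ⟨x, hx⟩ := hne _ R.S₀_homeo
    obtain ⟨y, hy⟩ := hne _ R.S₂_homeo
    refine ⟨hu, x, subset_closure hx, y, subset_closure hy, ?_⟩
    have : R.D ∩ {z | 0 ≤ u z} = R.D := inter_eq_left.2 h
    rw [show (rectangle R).D = R.D from rfl, this]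
    exact JoinedIn.of_segment_subset (R.convex_D.segment_subset
      (R.isClosed_D.frontier_subset (R.S₀_subset hx)) (R.isClosed_D.frontier_subset (R.S₂_subset hy)))
  | annulus N =>
    have hper : circleCurve N.inner 0 = circleCurve N.inner (2 * Real.pi) := by
      simp [circleCurve]
    have hcont := (isCurveFace_sphere N.inner_pos).smooth.continuous
    have himg := (isCurveFace_sphere N.inner_pos).image_eq
    let γ : Path (circleCurve N.inner 0) (circleCurve N.inner 0) :=
      { toFun := fun t => circleCurve N.inner (2 * Real.pi * t)
        continuous_toFun := by fun_prop
        source' := by simp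
        target' := by simp [hper] }
    have hr : range γ = Metric.sphere 0 N.inner := by
      apply Subset.antisymm
      · rintro _ ⟨t, rfl⟩
        rw [← himg]
        exact mem_image_of_mem _ (mem_univ _)
      · intro x hx
        rw [← himg] at hx
        obtain ⟨s, -, rfl⟩ := hx
        have hs := Int.fract_nonneg (s / (2 * Real.pi))
        have hs1 := Int.fract_lt_one (s / (2 * Real.pi))
        refine ⟨⟨Int.fract (s / (2 * Real.pi)), hs, hs1.le⟩, ?_⟩
        change circleCurve N.inner (2 * Real.pi * Int.fract (s / (2 * Real.pi))) = _
        have h1 : 2 * Real.pi * Int.fract (s / (2 * Real.pi)) =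
            s - ⌊s / (2 * Real.pi)⌋ * (2 * Real.pi) := by
          rw [← Int.self_sub_floor]
          field_simp
        rw [h1]
        simp [circleCurve, Real.cos_sub_int_mul_two_pi, Real.sin_sub_int_mul_two_pi]
    refine ⟨hu, _, γ, ?_, ?_⟩
    · rw [hr]
      intro x hx
      rw [mem_sphere_zero_iff_norm] at hx
      have hxD : x ∈ N.D := ⟨hx.ge, hx.le.trans N.inner_lt_outer.le⟩
      exact ⟨hxD, h x hxD⟩
    · rw [hr]
      refine Metric.isBounded_ball (x := (0 : Plane)) (r := N.inner) |>.subset ?_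
      -- The open disc is both open and closed in the complement of the circle.
      have hpre := isPreconnected_connectedComponentIn
        (x := (0 : Plane)) (F := (Metric.sphere (0 : Plane) N.inner)ᶜ)
      have hsub := connectedComponentIn_subset (Metric.sphere (0 : Plane) N.inner)ᶜ 0
      have h0 : (0 : Plane) ∈ (Metric.sphere (0 : Plane) N.inner)ᶜ := by
        simpa using N.inner_pos.ne
      refine hpre.subset_left_of_subset_union Metric.isOpen_ball
        (Metric.isClosed_closedBall (x := (0 : Plane)) (ε := N.inner)).isOpen_compl ?_ ?_
        ⟨0, mem_connectedComponentIn h0, by simpa using N.inner_pos⟩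
      · exact disjoint_compl_right.mono_left Metric.ball_subset_closedBall
      · intro x hx
        have hx' := hsub hx
        simp only [mem_compl_iff, mem_sphere_zero_iff_norm] at hx'
        rcases lt_or_gt_of_ne hx' with h | h
        · left; simpa using h
        · right; simpa using h

lemma exists_nonneg_of_mem_A {u : Plane → ℝ} (hu : u ∈ 𝔇.A) : ∃ x ∈ 𝔇.D, 0 ≤ u x := by
  cases 𝔇 with
  | rectangle R =>
    obtain ⟨-, x, -, y, -, γ, hγ⟩ := hu
    exact ⟨γ 0, hγ 0⟩
  | annulus N =>
    obtain ⟨-, p, γ, hγ, -⟩ := hu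
    exact ⟨γ 0, hγ (mem_range_self 0)⟩

section Threshold

variable {u v : Plane → ℝ}

lemma add_mem_A_of_le (hu : ContinuousOn u 𝔇.D) {M ℓ : ℝ} (hM : ∀ x ∈ 𝔇.D, -M ≤ u x)
    (h : M ≤ ℓ) : (fun x => u x + ℓ) ∈ 𝔇.A :=
  mem_A_of_nonneg (hu.add continuousOn_const) fun x hx => by linarith [hM x hx]

lemma le_of_add_mem_A {M ℓ : ℝ} (hM : ∀ x ∈ 𝔇.D, u x ≤ M)
    (h : (fun x => u x + ℓ) ∈ 𝔇.A) : -M ≤ ℓ := by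
  obtain ⟨x, hx, h'⟩ := exists_nonneg_of_mem_A h
  linarith [hM x hx]

lemma exists_abs_le (hu : ContinuousOn u 𝔇.D) : ∃ M, 0 < M ∧ ∀ x ∈ 𝔇.D, |u x| ≤ M := by
  obtain ⟨M, hM⟩ := 𝔇.isCompact_D.exists_bound_of_continuousOn hu
  exact ⟨max M 1, by positivity, fun x hx => (hM x hx).trans (le_max_left _ _)⟩

lemma bddBelow_levels (hu : ContinuousOn u 𝔇.D) :
    BddBelow {ℓ : ℝ | (fun x => u x + ℓ) ∈ 𝔇.A} := by
  obtain ⟨M, -, hM⟩ := exists_abs_le hu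
  exact ⟨-M, fun ℓ hℓ => le_of_add_mem_A (fun x hx => (abs_le.1 (hM x hx)).2) hℓ⟩

lemma nonempty_levels (hu : ContinuousOn u 𝔇.D) :
    {ℓ : ℝ | (fun x => u x + ℓ) ∈ 𝔇.A}.Nonempty := by
  obtain ⟨M, -, hM⟩ := exists_abs_le hu
  exact ⟨M, add_mem_A_of_le hu (fun x hx => (abs_le.1 (hM x hx)).1) le_rfl⟩

lemma T_le_of_mem (hu : ContinuousOn u 𝔇.D) {ℓ : ℝ} (h : (fun x => u x + ℓ) ∈ 𝔇.A) :
    𝔇.T u ≤ ℓ := csInf_le (bddBelow_levels hu) h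

lemma add_mem_A_of_T_lt (hu : ContinuousOn u 𝔇.D) {ℓ : ℝ} (h : 𝔇.T u < ℓ) :
    (fun x => u x + ℓ) ∈ 𝔇.A := by
  obtain ⟨ℓ', h1, h2⟩ := (csInf_lt_iff (bddBelow_levels hu) (nonempty_levels hu)).1 h
  exact mem_A_mono h1 (hu.add continuousOn_const) fun x _ => by linarith

lemma T_congr (h : EqOn u v 𝔇.D) : 𝔇.T u = 𝔇.T v := by
  simp only [T]
  congr 1
  ext ℓ
  exact mem_A_congr fun x hx => by simp [h hx]

/-- The threshold height is antitone, and nonexpansive for the uniform norm. -/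
lemma T_le_add (hu : ContinuousOn u 𝔇.D) (hv : ContinuousOn v 𝔇.D) {ε : ℝ}
    (h : ∀ x ∈ 𝔇.D, u x ≤ v x + ε) : 𝔇.T v ≤ 𝔇.T u + ε := by
  refine le_of_forall_pos_le_add fun δ hδ => T_le_of_mem hv ?_
  refine mem_A_mono (add_mem_A_of_T_lt hu (lt_add_of_pos_right (𝔇.T u) hδ))
    (hv.add continuousOn_const) fun x hx => ?_
  linarith [h x hx]

lemma abs_T_sub_le (hu : ContinuousOn u 𝔇.D) (hv : ContinuousOn v 𝔇.D) {ε : ℝ}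
    (h : ∀ x ∈ 𝔇.D, |u x - v x| ≤ ε) : |𝔇.T u - 𝔇.T v| ≤ ε := by
  rw [abs_le]
  constructor
  · linarith [T_le_add hu hv (ε := ε) fun x hx => by linarith [(abs_le.1 (h x hx)).2]]
  · linarith [T_le_add hv hu (ε := ε) fun x hx => by linarith [(abs_le.1 (h x hx)).1]]

lemma T_add_const (hu : ContinuousOn u 𝔇.D) (c : ℝ) : 𝔇.T (fun x => u x + c) = 𝔇.T u - c := by
  have hc : ContinuousOn (fun x => u x + c) 𝔇.D := hu.add continuousOn_const
  apply le_antisymm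
  · exact T_le_add hu hc fun x _ => by linarith
  · linarith [T_le_add hc hu (ε := c) fun x _ => by linarith]

lemma T_zero : 𝔇.T (fun _ => 0) = 0 := by
  apply le_antisymm
  · exact T_le_of_mem continuousOn_const (mem_A_of_nonneg (by fun_prop) fun x _ => by simp)
  · refine le_csInf (nonempty_levels continuousOn_const) fun ℓ hℓ => ?_
    simpa using le_of_add_mem_A (M := 0) (fun x _ => le_rfl) hℓ

end Threshold

end CrossingDomain

/-! ### Ascending deformations -/

/-- If `q` is positive on the zero set of `d` in a compact set, then `q` is bounded below where `d`
is small. -/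
lemma IsCompact.exists_pos_forall_le {X : Type*} [TopologicalSpace X] {K : Set X}
    (hK : IsCompact K) {q d : X → ℝ} (hq : ContinuousOn q K) (hd : ContinuousOn d K)
    (hd0 : ∀ z ∈ K, 0 ≤ d z) (h : ∀ z ∈ K, d z = 0 → 0 < q z) :
    ∃ ε > 0, ∀ z ∈ K, d z ≤ ε → ε ≤ q z := by
  rcases K.eq_empty_or_nonempty with rfl | hne
  · exact ⟨1, one_pos, by simp⟩
  obtain ⟨z₀, hz₀, hmin⟩ := hK.exists_isMinOn hne (f := fun z => max (q z) (d z))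
    (ContinuousOn.sup hq hd)
  have hm : 0 < max (q z₀) (d z₀) := by
    rcases (hd0 z₀ hz₀).eq_or_lt with h0 | h0
    · exact lt_max_of_lt_left (h z₀ hz₀ h0.symm)
    · exact lt_max_of_lt_right h0
  refine ⟨max (q z₀) (d z₀) / 2, half_pos hm, fun z hz hdz => ?_⟩
  have h1 : max (q z₀) (d z₀) ≤ max (q z) (d z) := hmin hz
  rcases le_max_iff.1 h1 with h2 | h2 <;> linarith

namespace CrossingDomain

variable {𝔇 : CrossingDomain}

lemma IsAdmissible.congr {Φ Φ' : Plane → Plane} (h : 𝔇.IsAdmissible Φ) (h' : EqOn Φ Φ' 𝔇.D) :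
    𝔇.IsAdmissible Φ' :=
  fun w hw w' hw' hx => h w hw w' hw' fun x hxD hwx => by rw [h' hxD]; exact hx x hxD hwx

/-- A family `Ψ s`, for `0 ≤ s ≤ s₀`, of deformations of the domain which starts from the identity
with velocities `V`, such that the deformation by a small multiple of any cutoff function
transports crossings to crossings. -/
structure IsDeformation (𝔇 : CrossingDomain) (Ψ V : ℝ → Plane → Plane) (s₀ : ℝ) : Prop where
  pos : 0 < s₀
  zero : ∀ x ∈ 𝔇.D, Ψ 0 x = x
  mapsTo : ∀ s ∈ Icc 0 s₀, ∀ x ∈ 𝔇.D, Ψ s x ∈ 𝔇.D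
  continuousOn : ContinuousOn (fun z : ℝ × Plane => Ψ z.1 z.2) (Icc 0 s₀ ×ˢ 𝔇.D)
  continuousOn_velocity : ContinuousOn (fun z : ℝ × Plane => V z.1 z.2) (Icc 0 s₀ ×ˢ 𝔇.D)
  hasDerivWithinAt : ∀ x ∈ 𝔇.D, ∀ s ∈ Icc 0 s₀,
    HasDerivWithinAt (fun s => Ψ s x) (V s x) (Icc 0 s₀) s
  admissible : ∀ χ : Plane → ℝ, ContDiff ℝ 1 χ → (∀ x, χ x ∈ Icc (0 : ℝ) 1) →
    ∀ᶠ τ in 𝓝[≥] (0 : ℝ), 𝔇.IsAdmissible (fun x => Ψ (τ * χ x) x)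

variable {u : Plane → ℝ}

/-- If a deformation increases `u` at the points at level `c` away from `x₀`, then cutting it off near
`x₀` gives small admissible maps which increase the values of `u` near `c` at a linear rate away from
`x₀`, without decreasing those near `x₀`. -/
theorem exists_push_of_deformation (hu : ContDiffOn ℝ 1 u 𝔇.D) {c : ℝ} {x₀ : Plane} {r : ℝ}
    (hr : 0 < r) {Ψ V : ℝ → Plane → Plane} {s₀ : ℝ} (h : 𝔇.IsDeformation Ψ V s₀)
    (hV : ∀ x ∈ 𝔇.D, u x = c → r / 2 ≤ dist x x₀ → 0 < fderivWithin ℝ u 𝔇.D x (V 0 x)) :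
    ∃ κ > 0, ∃ ε₀ > 0, ∀ ρ > 0, ∀ᶠ τ in 𝓝[≥] (0 : ℝ), ∃ Φ, 𝔇.IsAdmissible Φ ∧
      ∀ x ∈ 𝔇.D, Φ x ∈ 𝔇.D ∧ dist (Φ x) x ≤ ρ ∧ (|u x - c| ≤ ε₀ → u x ≤ u (Φ x) ∧
        (r ≤ dist x x₀ → u x + κ * τ ≤ u (Φ x))) := by
  have hD := 𝔇.isRegularStratification.frame.uniqueDiffOn
  let q : ℝ × Plane → ℝ := fun z => fderivWithin ℝ u 𝔇.D (Ψ z.1 z.2) (V z.1 z.2)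
  have hq : ContinuousOn q (Icc 0 s₀ ×ˢ 𝔇.D) := by
    refine ContinuousOn.clm_apply ?_ h.continuousOn_velocity
    exact (hu.continuousOn_fderivWithin hD (by norm_num)).comp h.continuousOn
      fun z hz => h.mapsTo _ hz.1 _ hz.2
  have hK : IsCompact (Icc 0 s₀ ×ˢ 𝔇.D ∩ {z : ℝ × Plane | r / 2 ≤ dist z.2 x₀}) :=
    (isCompact_Icc.prod 𝔇.isCompact_D).inter_right (isClosed_le (by fun_prop) (by fun_prop))
  obtain ⟨κ, hκ, hκq⟩ := hK.exists_pos_forall_le (hq.mono inter_subset_left)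
    (d := fun z => |u z.2 - c| + z.1) (by
      refine ContinuousOn.add (ContinuousOn.abs (ContinuousOn.sub ?_ continuousOn_const))
        continuousOn_fst
      exact hu.continuousOn.comp continuousOn_snd fun z hz => hz.1.2)
    (fun z hz => add_nonneg (abs_nonneg _) hz.1.1.1) (by
      rintro ⟨s, x⟩ ⟨⟨hs, hx⟩, hd⟩ h0
      simp only at h0 hs hx hd
      have h1 : u x - c = 0 := by
        rw [← abs_eq_zero]
        linarith [abs_nonneg (u x - c), hs.1]
      have h2 : s = 0 := by linarith [abs_nonneg (u x - c), hs.1]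
      subst h2
      simp only [q, h.zero x hx]
      exact hV x hx (by linarith) hd)
  set s₁ := min s₀ (κ / 2) with hs₁
  have hs₁0 : 0 < s₁ := lt_min h.pos (half_pos hκ)
  -- The mean value inequality along the deformation.
  have hmv : ∀ x ∈ 𝔇.D, |u x - c| ≤ κ / 2 → r / 2 ≤ dist x x₀ → ∀ s ∈ Icc 0 s₁,
      u x + κ * s ≤ u (Ψ s x) := by
    intro x hx huc hd s hs
    have hsub : Icc 0 s₁ ⊆ Icc 0 s₀ := Icc_subset_Icc_right (min_le_left _ _)
    have hder : ∀ t ∈ Icc 0 s₁, HasDerivWithinAt (fun t => u (Ψ t x)) (q (t, x)) (Icc 0 s₁) t := by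
      intro t ht
      have h1 := ((hu.differentiableOn (by norm_num)) _
        (h.mapsTo t (hsub ht) x hx)).hasFDerivWithinAt
      exact (h1.comp_hasDerivWithinAt t (h.hasDerivWithinAt x hx t (hsub ht))
        (fun t ht => h.mapsTo t ht x hx)).mono hsub
    have hder' : ∀ t ∈ interior (Icc 0 s₁), HasDerivAt (fun t => u (Ψ t x)) (q (t, x)) t :=
      fun t ht => (hder t (interior_subset ht)).hasDerivAt (mem_interior_iff_mem_nhds.1 ht)
    have := (convex_Icc 0 s₁).mul_sub_le_image_sub_of_le_deriv
      (fun t ht => (hder t ht).continuousWithinAt)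
      (fun t ht => (hder' t ht).differentiableAt.differentiableWithinAt) (C := κ)
      (fun t ht => ?_) 0 ⟨le_rfl, hs₁0.le⟩ s hs hs.1
    · simp only [h.zero x hx] at this
      linarith
    · rw [(hder' t ht).deriv]
      refine hκq (t, x) ⟨⟨hsub (interior_subset ht), hx⟩, hd⟩ ?_
      have := (interior_subset ht).2.trans (min_le_right _ _)
      simp only
      linarith
  -- The cutoff switches the deformation off near `x₀`.
  let b : ContDiffBump x₀ := ⟨r / 2, r, half_pos hr, half_lt_self hr⟩
  let χ : Plane → ℝ := fun x => 1 - b x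
  have hχ : ∀ x, χ x ∈ Icc (0 : ℝ) 1 := fun x => by
    have h1 := b.nonneg' x
    have h2 : b x ≤ 1 := b.le_one
    constructor <;> simp only [χ] <;> linarith
  refine ⟨κ, hκ, κ / 2, half_pos hκ, fun ρ hρ => ?_⟩
  obtain ⟨s₂, hs₂, hs₂ρ⟩ := (isCompact_Icc.prod 𝔇.isCompact_D).exists_pos_forall_le
    (q := fun z => ρ - dist (Ψ z.1 z.2) z.2) (d := fun z => z.1)
    (continuousOn_const.sub (continuous_dist.comp_continuousOn
      (h.continuousOn.prodMk continuousOn_snd))) continuousOn_fst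
    (fun z hz => hz.1.1) (by
      rintro ⟨s, x⟩ ⟨hs, hx⟩ h0
      simp only at h0 hx
      simp only [h0, h.zero x hx, dist_self]
      linarith)
  filter_upwards [h.admissible χ (contDiff_const.sub b.contDiff) hχ,
    Icc_mem_nhdsGE (lt_min hs₁0 hs₂)] with τ hτ hτ'
  refine ⟨_, hτ, fun x hx => ?_⟩
  have hs : τ * χ x ∈ Icc 0 s₁ := ⟨mul_nonneg hτ'.1 (hχ x).1,
    (mul_le_of_le_one_right hτ'.1 (hχ x).2).trans (hτ'.2.trans (min_le_left _ _))⟩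
  have hs' : τ * χ x ∈ Icc 0 s₀ := ⟨hs.1, hs.2.trans (min_le_left _ _)⟩
  refine ⟨h.mapsTo _ hs' x hx, ?_, fun huc => ⟨?_, fun hd => ?_⟩⟩
  · have := hs₂ρ (τ * χ x, x) ⟨hs', hx⟩
      ((mul_le_of_le_one_right hτ'.1 (hχ x).2).trans (hτ'.2.trans (min_le_right _ _)))
    simp only at this
    linarith
  · rcases le_total (r / 2) (dist x x₀) with hd | hd
    · have := hmv x hx huc hd _ hs
      have := mul_nonneg hκ.le hs.1
      linarith
    · have : χ x = 0 := by
        simp only [χ]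
        rw [b.one_of_mem_closedBall (Metric.mem_closedBall.2 hd), sub_self]
      rw [this, mul_zero, h.zero x hx]
  · have : χ x = 1 := by
      simp only [χ]
      rw [b.zero_of_le_dist hd, sub_zero]
    rw [this, mul_one] at hs ⊢
    exact hmv x hx huc (by linarith) _ hs

/-- On each compact set without stratified critical points, `u` increases strictly along some
deformation of the domain. The deformation may depend on the compact set. -/
def HasAscendingDeformations (𝔇 : CrossingDomain) (u : Plane → ℝ) : Prop :=
  ∀ N ⊆ 𝔇.D, IsCompact N → (∀ x ∈ N, ¬ 𝔇.IsStratifiedCritical u x) →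
    ∃ Ψ V s₀, 𝔇.IsDeformation Ψ V s₀ ∧ ∀ x ∈ N, 0 < fderivWithin ℝ u 𝔇.D x (V 0 x)

/-- If `x₀` is the only critical point at level `c`, small admissible maps increase the values of `u` near
`c` at a linear rate away from `x₀`, without decreasing those near `x₀`. -/
theorem exists_push (hdef : 𝔇.HasAscendingDeformations u) (hu : ContDiffOn ℝ 1 u 𝔇.D) {c : ℝ}
    {x₀ : Plane} (hx₀ : ∀ x, 𝔇.IsStratifiedCritical u x → u x = c → x = x₀) {r : ℝ}
    (hr : 0 < r) :
    ∃ κ > 0, ∃ ε₀ > 0, ∀ ρ > 0, ∀ᶠ τ in 𝓝[≥] (0 : ℝ), ∃ Φ, 𝔇.IsAdmissible Φ ∧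
      ∀ x ∈ 𝔇.D, Φ x ∈ 𝔇.D ∧ dist (Φ x) x ≤ ρ ∧ (|u x - c| ≤ ε₀ → u x ≤ u (Φ x) ∧
        (r ≤ dist x x₀ → u x + κ * τ ≤ u (Φ x))) := by
  obtain ⟨Ψ, V, s₀, h, hV⟩ := hdef (𝔇.D ∩ u ⁻¹' {c} ∩ {x | r / 2 ≤ dist x x₀})
    (inter_subset_left.trans inter_subset_left)
    ((𝔇.isCompact_D.of_isClosed_subset (hu.continuousOn.preimage_isClosed_of_isClosed
      𝔇.isCompact_D.isClosed isClosed_singleton) inter_subset_left).inter_right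
      (isClosed_le continuous_const (by fun_prop))) (by
      rintro x ⟨⟨-, hxc⟩, hd⟩ hcr
      rw [hx₀ x hcr hxc] at hd
      simp only [mem_ofPred_eq, dist_self] at hd
      linarith)
  exact exists_push_of_deformation hu hr h fun x hx hxc hd => hV x ⟨⟨hx, hxc⟩, hd⟩

/-- The threshold heights of two perturbations of `u`, of size `ε` on the domain and of size `δ` near
the only critical point at the level of the threshold, differ by at most `3 * δ`. -/
theorem T_add_le_of_small_near (hdef : 𝔇.HasAscendingDeformations u)
    (hu : ContDiffOn ℝ 1 u 𝔇.D) {x₀ : Plane}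
    (hx₀ : ∀ x, 𝔇.IsStratifiedCritical u x → u x = -𝔇.T u → x = x₀) {r : ℝ} (hr : 0 < r) :
    ∃ ε₁ > 0, ∀ ε > 0, ε ≤ ε₁ → ∀ δ > 0, δ ≤ ε → ∀ w₁ w₂ : Plane → ℝ, ContinuousOn w₁ 𝔇.D →
      ContinuousOn w₂ 𝔇.D → (∀ x ∈ 𝔇.D, |w₁ x| ≤ ε) → (∀ x ∈ 𝔇.D, |w₂ x| ≤ ε) →
      (∀ x ∈ 𝔇.D, dist x x₀ < 2 * r → |w₁ x| ≤ δ) → (∀ x ∈ 𝔇.D, dist x x₀ < 2 * r → |w₂ x| ≤ δ) →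
      𝔇.T (fun x => u x + w₂ x) ≤ 𝔇.T (fun x => u x + w₁ x) + 3 * δ := by
  obtain ⟨κ, hκ, ε₀, hε₀, hpush⟩ := exists_push hdef hu hx₀ hr
  have huc := hu.continuousOn
  obtain ⟨ρ, hρ, hρu⟩ := Metric.uniformContinuousOn_iff.1
    (𝔇.isCompact_D.uniformContinuousOn_of_continuous huc) (ε₀ / 2) (half_pos hε₀)
  obtain ⟨τ₀, hτ₀, hτ⟩ := (mem_nhdsGE_iff_exists_Icc_subset).1
    (hpush (min (ρ / 2) (r / 2)) (by positivity))
  refine ⟨min (ε₀ / 8) (κ * τ₀ / 2), lt_min (by positivity) (by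
    have : 0 < τ₀ := hτ₀
    positivity), fun ε hε hεε₁ δ hδ hδε w₁ w₂ hw₁ hw₂ h1 h2 h1' h2' => ?_⟩
  have hε8 : ε ≤ ε₀ / 8 := hεε₁.trans (min_le_left _ _)
  -- After the time `2 * ε / κ`, the push gains `2 * ε`, which makes up for `w₁` and `w₂`
  -- away from `x₀`; near `x₀` these are at most `δ`.
  have hετ : 2 * ε / κ ∈ Icc 0 τ₀ := by
    refine ⟨by positivity, ?_⟩
    rw [div_le_iff₀ hκ]
    linarith [hεε₁.trans (min_le_right _ _)]
  obtain ⟨Φ, hΦ, hΦx⟩ := hτ hετ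
  have hc₁ : ContinuousOn (fun x => u x + w₁ x) 𝔇.D := huc.add hw₁
  have hc₂ : ContinuousOn (fun x => u x + w₂ x) 𝔇.D := huc.add hw₂
  have hT := abs_le.1 (abs_T_sub_le hc₁ huc (ε := ε) (fun x hx => by
    simpa using h1 x hx))
  set c := -𝔇.T u with hc
  refine T_le_of_mem hc₂ ?_
  refine hΦ _ (add_mem_A_of_T_lt hc₁ (lt_add_of_pos_right _ hδ)) _
    (hc₂.add continuousOn_const) fun x hx hxℓ => ?_
  obtain ⟨hΦD, hdist, hnear⟩ := hΦx x hx
  have e1 := abs_le.1 (h1 x hx)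
  have e2 := abs_le.1 (h2 _ hΦD)
  have hΦu := abs_lt.1 (hρu _ hΦD _ hx (hdist.trans_lt ((min_le_left _ _).trans_lt
    (half_lt_self hρ))))
  have hκε : κ * (2 * ε / κ) = 2 * ε := by field_simp
  rw [hκε] at hnear
  -- Far above the level `c`, uniform continuity is enough.
  by_cases hhigh : c + ε₀ < u x
  · linarith
  have hux : |u x - c| ≤ ε₀ := by
    rw [abs_le]
    constructor <;> linarith
  obtain ⟨n1, n2⟩ := hnear hux
  rcases le_or_gt r (dist x x₀) with hd | hd
  · have := n2 hd
    linarith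
  · have f1 := abs_le.1 (h1' x hx (by linarith))
    have f2 := abs_le.1 (h2' _ hΦD (by
      linarith [dist_triangle (Φ x) x x₀, hdist.trans (min_le_right _ _)]))
    linarith

end CrossingDomain

/-! ### Ascending deformations of a rectangle -/

namespace RectangleData

variable (R : RectangleData)

/-- The set of the points which are faces. -/
def vertices : Set Plane := {z | {z} ∈ R.faces}

lemma finite_vertices : R.vertices.Finite :=
  R.finite_faces.preimage (f := fun z : Plane => ({z} : Set Plane)) singleton_injective.injOn

lemma nonempty_vertices : R.vertices.Nonempty := by
  refine ⟨R.φ 0, R.corner_mem _ ⟨0, ?_, rfl⟩⟩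
  simp [stdCorners]

lemma infDist_vertices_pos {x : Plane} (hx : x ∉ R.vertices) : 0 < Metric.infDist x R.vertices :=
  (R.finite_vertices.isClosed.notMem_iff_infDist_pos R.nonempty_vertices).1 hx

lemma mem_span_of_lin_eq_zero {v w : Plane} (hw : w ≠ 0) {i : Fin 2} (hvi : R.lin v i = 0)
    (hwi : R.lin w i = 0) : ∃ μ : ℝ, v = μ • w := by
  have hw' : R.lin w ≠ 0 := by simpa using hw
  have h := mem_span_singleton_of_cross_eq_zero (v := R.lin v) hw' (by
    fin_cases i <;> simp_all)
  obtain ⟨μ, hμ⟩ := Submodule.mem_span_singleton.1 h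
  refine ⟨μ, R.lin.injective ?_⟩
  rw [map_smul, hμ]

/-- The end points of the faces which are segments are faces. Otherwise an end point would be in
another segment, parallel to the given one, and the two segments would meet. -/
lemma left_mem_vertices {p q : Plane} (hpq : p ≠ q) (hF : openSegment ℝ p q ∈ R.faces)
    (hsub : openSegment ℝ p q ⊆ frontier R.D \ R.φ '' stdCorners R.width R.height) :
    p ∈ R.vertices := by
  have hy : ∀ t ∈ Ioo (0 : ℝ) 1, p + t • (q - p) ∈ openSegment ℝ p q := fun t ht => by
    rw [openSegment_eq_image']
    exact mem_image_of_mem _ ht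
  have hc : Tendsto (fun t : ℝ => p + t • (q - p)) (𝓝[>] 0) (𝓝 p) := by
    have : Continuous fun t : ℝ => p + t • (q - p) := by fun_prop
    simpa using (this.tendsto 0).mono_left nhdsWithin_le_nhds
  have hev : ∀ᶠ t in 𝓝[>] (0 : ℝ), p + t • (q - p) ∈ openSegment ℝ p q := by
    filter_upwards [Ioo_mem_nhdsGT (one_pos : (0 : ℝ) < 1)] with t ht using hy t ht
  have hpD : p ∈ R.D := R.isClosed_D.mem_of_tendsto hc
    (hev.mono fun t ht => R.isClosed_D.frontier_subset (hsub ht).1)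
  rw [D, ← R.cover_faces] at hpD
  obtain ⟨F', hF', hpF'⟩ := hpD
  by_cases hint : F' = interior R.D
  · subst hint
    obtain ⟨t, ht1, ht2⟩ := (hev.and (hc.eventually (isOpen_interior.mem_nhds hpF'))).exists
    exact absurd ht2 (hsub ht1).1.2
  rcases R.face_cases F' hF' hint with ⟨z, -, rfl⟩ | ⟨p', q', hpq', rfl, hsub'⟩
  · rw [mem_singleton_iff] at hpF'
    subst hpF'
    exact hF'
  · exfalso
    obtain ⟨i, hi, hj, hlin'⟩ := R.segment_face hsub' hpF'
    have hw' : q' - p' ≠ 0 := sub_ne_zero.2 hpq'.symm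
    have hlin : R.lin (q - p) i = 0 := by
      have hevj : ∀ᶠ t in 𝓝[>] (0 : ℝ), ∀ j, j ≠ i → 0 < R.coord (p + t • (q - p)) j ∧
          R.coord (p + t • (q - p)) j < R.sides j := by
        rw [eventually_all]
        intro j
        by_cases hji : j = i
        · exact .of_forall fun t h => absurd hji h
        · have h1 := ((R.continuous_coord_apply j).tendsto p).comp hc
          filter_upwards [h1.eventually (lt_mem_nhds (hj j hji).1),
            h1.eventually (gt_mem_nhds (hj j hji).2)] with t h2 h3 _ using ⟨h2, h3⟩
      obtain ⟨t, ht1, ht2⟩ := (hev.and hevj).exists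
      obtain ⟨k, hk, -, hlin⟩ := R.segment_face hsub ht1
      have : k = i := by
        by_contra hne
        have := ht2 k hne
        rcases hk with hk | hk <;> linarith [this.1, this.2]
      exact this ▸ hlin
    obtain ⟨μ, hμ⟩ := R.mem_span_of_lin_eq_zero hw' hlin hlin'
    rw [openSegment_eq_image'] at hpF'
    obtain ⟨θ, hθ, hp⟩ := hpF'
    simp only at hp
    have hc' : Tendsto (fun t : ℝ => θ + t * μ) (𝓝[>] 0) (𝓝 θ) := by
      have : Continuous fun t : ℝ => θ + t * μ := by fun_prop
      simpa using (this.tendsto 0).mono_left nhdsWithin_le_nhds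
    obtain ⟨t, ht1, ht2⟩ := (hev.and (hc'.eventually (isOpen_Ioo.mem_nhds hθ))).exists
    have h1 : p + t • (q - p) ∈ openSegment ℝ p' q' := by
      rw [openSegment_eq_image']
      refine ⟨_, ht2, ?_⟩
      simp only
      rw [hμ, ← hp, smul_smul, add_smul, add_assoc]
    have h2 : openSegment ℝ p q = openSegment ℝ p' q' := by
      by_contra hne
      exact disjoint_left.1 (R.disjoint_faces hF hF' hne) ht1 h1
    have h3 : p ∈ openSegment ℝ p q := by
      rw [h2, openSegment_eq_image']
      exact ⟨θ, hθ, hp⟩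
    exact hpq (left_mem_openSegment_iff.1 h3)

lemma right_mem_vertices {p q : Plane} (hpq : p ≠ q) (hF : openSegment ℝ p q ∈ R.faces)
    (hsub : openSegment ℝ p q ⊆ frontier R.D \ R.φ '' stdCorners R.width R.height) :
    q ∈ R.vertices := by
  rw [openSegment_symm] at hF hsub
  exact R.left_mem_vertices hpq.symm hF hsub

section Ascent

variable (u : Plane → ℝ)

/-- The gradient in the frame of the rectangle, with each component multiplied by a nonnegative factor
which vanishes on the two sides orthogonal to it, and at the point faces. -/
def ascent (x : Plane) : Plane :=
  ∑ i, (R.coord x i * (R.sides i - R.coord x i) * Metric.infDist x R.vertices *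
    fderivWithin ℝ u R.D x (R.unitVec i)) • R.unitVec i

lemma lin_ascent (x : Plane) (i : Fin 2) : R.lin (R.ascent u x) i =
    R.coord x i * (R.sides i - R.coord x i) * Metric.infDist x R.vertices *
      fderivWithin ℝ u R.D x (R.unitVec i) := by
  rw [ascent, map_sum, Fin.sum_univ_two, map_smul, map_smul, lin_unitVec, lin_unitVec]
  fin_cases i <;> simp

variable {u}

lemma continuousOn_fderivWithin_unitVec (hu : ContDiffOn ℝ 1 u R.D) (i : Fin 2) :
    ContinuousOn (fun x => fderivWithin ℝ u R.D x (R.unitVec i)) R.D :=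
  (hu.continuousOn_fderivWithin R.hasInwardFrame.uniqueDiffOn (by norm_num)).clm_apply
    continuousOn_const

lemma continuousOn_sum_smul_unitVec {a : Fin 2 → Plane → ℝ} {S : Set Plane}
    (ha : ∀ i, ContinuousOn (a i) S) : ContinuousOn (fun x => ∑ i, a i x • R.unitVec i) S :=
  continuousOn_finsetSum _ fun i _ => (ha i).smul continuousOn_const

lemma continuousOn_ascent (hu : ContDiffOn ℝ 1 u R.D) : ContinuousOn (R.ascent u) R.D := by
  refine R.continuousOn_sum_smul_unitVec fun i => ?_
  have h1 := (R.continuous_coord_apply i).continuousOn (s := R.D)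
  have h2 := (Metric.continuous_infDist_pt R.vertices).continuousOn (s := R.D)
  exact ((h1.mul (continuousOn_const.sub h1)).mul h2).mul (R.continuousOn_fderivWithin_unitVec hu i)

lemma fderivWithin_ascent (x : Plane) : fderivWithin ℝ u R.D x (R.ascent u x) =
    ∑ i, R.coord x i * (R.sides i - R.coord x i) * Metric.infDist x R.vertices *
      fderivWithin ℝ u R.D x (R.unitVec i) ^ 2 := by
  rw [ascent, map_sum]
  refine Finset.sum_congr rfl fun i _ => ?_
  rw [map_smul, smul_eq_mul, sq, ← mul_assoc]

lemma span_unitVec (v : Plane) : v = ∑ i, R.lin v i • R.unitVec i := by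
  apply R.lin.injective
  rw [map_sum, Fin.sum_univ_two, map_smul, map_smul, lin_unitVec, lin_unitVec]
  ext i
  fin_cases i <;> simp

/-- The ascent direction is strictly ascending away from the stratified critical points. -/
lemma fderivWithin_ascent_pos {x : Plane} (hx : x ∈ R.D)
    (hcr : ¬ (CrossingDomain.rectangle R).IsStratifiedCritical u x) :
    0 < fderivWithin ℝ u R.D x (R.ascent u x) := by
  have hxv : x ∉ R.vertices := fun h => hcr ⟨{x}, h, rfl, fun v hv => by
    rw [tangentSpaceAt_singleton, Submodule.mem_bot] at hv
    rw [hv, map_zero]⟩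
  have hpos := R.infDist_vertices_pos hxv
  have hxD := R.mem_D_iff.1 hx
  have hnn : ∀ i, 0 ≤ R.coord x i * (R.sides i - R.coord x i) * Metric.infDist x R.vertices *
      fderivWithin ℝ u R.D x (R.unitVec i) ^ 2 := fun i =>
    mul_nonneg (mul_nonneg (mul_nonneg (hxD i).1 (sub_nonneg.2 (hxD i).2)) hpos.le) (sq_nonneg _)
  rw [fderivWithin_ascent]
  refine lt_of_le_of_ne (Finset.sum_nonneg fun i _ => hnn i) fun h0 => hcr ?_
  have hz := (Finset.sum_eq_zero_iff_of_nonneg fun i _ => hnn i).1 h0.symm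
  have hz' : ∀ i, 0 < R.coord x i ∧ R.coord x i < R.sides i →
      fderivWithin ℝ u R.D x (R.unitVec i) = 0 := by
    intro i hi
    have h1 : R.coord x i * (R.sides i - R.coord x i) * Metric.infDist x R.vertices ≠ 0 :=
      (mul_pos (mul_pos hi.1 (sub_pos.2 hi.2)) hpos).ne'
    exact pow_eq_zero_iff (two_ne_zero) |>.1
      ((mul_eq_zero.1 (hz i (Finset.mem_univ i))).resolve_left h1)
  have hx' := hx
  rw [D, ← R.cover_faces] at hx'
  obtain ⟨F, hF, hxF⟩ := hx'
  refine ⟨F, hF, hxF, fun v hv => ?_⟩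
  change fderivWithin ℝ u R.D x v = 0
  by_cases hint : F = interior R.D
  · subst hint
    rw [R.span_unitVec v, map_sum]
    refine Finset.sum_eq_zero fun i _ => ?_
    rw [map_smul, hz' i (R.mem_interior_iff.1 hxF i), smul_zero]
  rcases R.face_cases F hF hint with ⟨z, -, rfl⟩ | ⟨p, q, hpq, rfl, hsub⟩
  · rw [tangentSpaceAt_singleton, Submodule.mem_bot] at hv
    rw [hv, map_zero]
  · obtain ⟨i, -, hj, hlin⟩ := R.segment_face hsub hxF
    have hcurve := isCurveFace_openSegment hpq
    obtain ⟨s, hs, hsx⟩ := hcurve.image_eq.symm ▸ hxF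
    have hd : deriv (fun s : ℝ => p + s • (q - p)) s = q - p := by
      simpa using (((hasDerivAt_id s).smul_const (q - p)).const_add p).deriv
    have h1 := hcurve.tangentSpace_le s hs
    rw [show p + s • (q - p) = x from hsx, hd] at h1
    obtain ⟨μ, rfl⟩ := Submodule.mem_span_singleton.1 (h1 hv)
    rw [R.span_unitVec (q - p), map_smul, map_sum, smul_eq_zero]
    refine Or.inr (Finset.sum_eq_zero fun j _ => ?_)
    rw [map_smul]
    by_cases hji : j = i
    · rw [hji, hlin, zero_smul]
    · rw [hz' j (hj j hji), smul_zero]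

/-- Small steps in the ascent direction preserve the rectangle and each boundary face: the step is at
most half the distance to the end points of a segment, and it vanishes at the point faces. -/
lemma exists_step (hu : ContDiffOn ℝ 1 u R.D) : ∃ s₀ : ℝ, 0 < s₀ ∧ ∀ s ∈ Icc 0 s₀,
    (∀ x ∈ R.D, x + s • R.ascent u x ∈ R.D) ∧
    ∀ F ∈ R.faces, F ≠ interior R.D → ∀ x ∈ F, x + s • R.ascent u x ∈ F := by
  have hbd : ∃ B : ℝ, 0 < B ∧ ∀ x ∈ R.D, ∀ i, |Metric.infDist x R.vertices *
      fderivWithin ℝ u R.D x (R.unitVec i)| ≤ B := by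
    have h2 := Metric.continuous_infDist_pt R.vertices
    choose B hB using fun i : Fin 2 => R.isCompact_D.exists_bound_of_continuousOn
      (h2.continuousOn.mul (R.continuousOn_fderivWithin_unitVec hu i))
    refine ⟨|B 0| + |B 1| + 1, by positivity, fun x hx i => (hB i x hx).trans ?_⟩
    have h0 := le_abs_self (B 0)
    have h1 := le_abs_self (B 1)
    have := abs_nonneg (B 0)
    have := abs_nonneg (B 1)
    fin_cases i
    · simp only [Fin.zero_eta]; linarith
    · simp only [Fin.mk_one]; linarith
  obtain ⟨B, hB, hBx⟩ := hbd
  have hbd' : ∃ C : ℝ, 0 < C ∧ ∀ x ∈ R.D, ‖R.ascent u x‖ ≤ C * Metric.infDist x R.vertices := by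
    have hcont : ContinuousOn (fun x => ∑ i, (R.coord x i * (R.sides i - R.coord x i) *
        fderivWithin ℝ u R.D x (R.unitVec i)) • R.unitVec i) R.D := by
      refine R.continuousOn_sum_smul_unitVec fun i => ?_
      have h1 := (R.continuous_coord_apply i).continuousOn (s := R.D)
      exact (h1.mul (continuousOn_const.sub h1)).mul (R.continuousOn_fderivWithin_unitVec hu i)
    obtain ⟨C, hC⟩ := R.isCompact_D.exists_bound_of_continuousOn hcont
    refine ⟨max C 1, by positivity, fun x hx => ?_⟩
    have h1 : R.ascent u x = Metric.infDist x R.vertices • ∑ i, (R.coord x i *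
        (R.sides i - R.coord x i) * fderivWithin ℝ u R.D x (R.unitVec i)) • R.unitVec i := by
      rw [ascent, Finset.smul_sum]
      refine Finset.sum_congr rfl fun i _ => ?_
      rw [smul_smul]
      congr 1
      ring
    rw [h1, norm_smul, Real.norm_of_nonneg Metric.infDist_nonneg, mul_comm]
    exact mul_le_mul_of_nonneg_right ((hC x hx).trans (le_max_left _ _)) Metric.infDist_nonneg
  obtain ⟨C, hC, hCx⟩ := hbd'
  have hw := R.sides_pos 0
  have hh := R.sides_pos 1
  refine ⟨1 / (2 * C + B * (R.sides 0 + R.sides 1)), by positivity, fun s hs => ?_⟩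
  have hden : 0 < 2 * C + B * (R.sides 0 + R.sides 1) := by positivity
  have hs1 := (le_div_iff₀ hden).1 hs.2
  have hs0 := hs.1
  have hsC : s * C ≤ 1 / 2 := by
    have : 0 ≤ s * (B * (R.sides 0 + R.sides 1)) := by positivity
    linarith
  have hsB : ∀ i, s * B * R.sides i ≤ 1 := by
    have e0 : 0 ≤ s * C := by positivity
    have e1 : 0 ≤ s * B * R.sides 0 := by positivity
    have e2 : 0 ≤ s * B * R.sides 1 := by positivity
    have e3 : s * (2 * C + B * (R.sides 0 + R.sides 1)) =
      2 * (s * C) + s * B * R.sides 0 + s * B * R.sides 1 := by ring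
    intro i
    fin_cases i
    · simp only [Fin.zero_eta]; linarith
    · simp only [Fin.mk_one]; linarith
  refine ⟨fun x hx => ?_, fun F hF hint x hx => ?_⟩
  · rw [mem_D_iff]
    intro i
    obtain ⟨h0, h1⟩ := R.mem_D_iff.1 hx i
    have hb := abs_le.1 (hBx x hx i)
    set b := Metric.infDist x R.vertices * fderivWithin ℝ u R.D x (R.unitVec i) with hbdef
    have hco : R.coord (x + s • R.ascent u x) i =
        R.coord x i + R.coord x i * (R.sides i - R.coord x i) * (s * b) := by
      rw [coord_add, map_smul, PiLp.add_apply, PiLp.smul_apply, lin_ascent, smul_eq_mul, hbdef]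
      ring
    have hsb : |s * b| * R.sides i ≤ 1 := by
      rw [abs_mul, abs_of_nonneg hs0]
      refine le_trans ?_ (hsB i)
      exact mul_le_mul_of_nonneg_right (mul_le_mul_of_nonneg_left (hBx x hx i) hs0)
        (R.sides_pos i).le
    have hd : 0 ≤ R.sides i - R.coord x i := sub_nonneg.2 h1
    have hk1 : |s * b| * (R.sides i - R.coord x i) ≤ 1 :=
      (mul_le_mul_of_nonneg_left (by linarith) (abs_nonneg _)).trans hsb
    have hk2 : |s * b| * R.coord x i ≤ 1 :=
      (mul_le_mul_of_nonneg_left h1 (abs_nonneg _)).trans hsb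
    have habs := abs_le.1 (le_refl |s * b|)
    rw [hco]
    constructor
    · nlinarith [mul_nonneg h0 (sub_nonneg.2 hk1), mul_nonneg h0 hd]
    · nlinarith [mul_nonneg hd (sub_nonneg.2 hk2), mul_nonneg h0 hd]
  · have hFD : F ⊆ R.D := by
      rw [D, ← R.cover_faces]
      exact subset_sUnion_of_mem hF
    rcases R.face_cases F hF hint with ⟨z, -, rfl⟩ | ⟨p, q, hpq, rfl, hsub⟩
    · rw [mem_singleton_iff] at hx
      subst hx
      have h1 := hCx x (hFD rfl)
      rw [Metric.infDist_zero_of_mem (show x ∈ R.vertices from hF), mul_zero] at h1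
      rw [norm_le_zero_iff.1 h1, smul_zero, add_zero]
      rfl
    · obtain ⟨i, hi, -, hlin⟩ := R.segment_face hsub hx
      have hw0 : q - p ≠ 0 := sub_ne_zero.2 hpq.symm
      obtain ⟨μ, hμ⟩ := R.mem_span_of_lin_eq_zero (v := R.ascent u x) hw0 (i := i) (by
        rw [lin_ascent]
        rcases hi with hi | hi <;> simp [hi]) hlin
      have hV := hCx x (hFD hx)
      have hp := Metric.infDist_le_dist_of_mem (x := x) (R.left_mem_vertices hpq hF hsub)
      have hq := Metric.infDist_le_dist_of_mem (x := x) (R.right_mem_vertices hpq hF hsub)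
      rw [openSegment_eq_image'] at hx ⊢
      obtain ⟨θ, hθ, rfl⟩ := hx
      simp only at hμ hV hp hq ⊢
      set x := p + θ • (q - p) with hxdef
      have hn : 0 < ‖q - p‖ := norm_pos_iff.2 hw0
      rw [hμ, norm_smul, Real.norm_eq_abs] at hV
      rw [dist_eq_norm, hxdef, add_sub_cancel_left, norm_smul, Real.norm_of_nonneg hθ.1.le] at hp
      rw [dist_eq_norm, show x - q = (θ - 1) • (q - p) by rw [hxdef]; module, norm_smul,
        Real.norm_eq_abs, abs_of_nonpos (by linarith [hθ.2])] at hq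
      have hinf := Metric.infDist_nonneg (x := x) (s := R.vertices)
      have key : ∀ η : ℝ, Metric.infDist x R.vertices ≤ η * ‖q - p‖ → s * |μ| ≤ η / 2 := by
        intro η hη
        have h1 : s * |μ| * ‖q - p‖ ≤ η / 2 * ‖q - p‖ := by
          calc s * |μ| * ‖q - p‖ = s * (|μ| * ‖q - p‖) := by ring
            _ ≤ s * (C * Metric.infDist x R.vertices) := mul_le_mul_of_nonneg_left hV hs0
            _ = s * C * Metric.infDist x R.vertices := by ring
            _ ≤ 1 / 2 * Metric.infDist x R.vertices := mul_le_mul_of_nonneg_right hsC hinf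
            _ ≤ η / 2 * ‖q - p‖ := by linarith
        exact le_of_mul_le_mul_right h1 hn
      have k1 := key _ hp
      have k2 := key _ hq
      have habs := abs_le.1 (show |s * μ| ≤ s * |μ| by rw [abs_mul, abs_of_nonneg hs0])
      refine ⟨θ + s * μ, ⟨by linarith [hθ.1], by linarith [hθ.2]⟩, ?_⟩
      rw [hμ, hxdef]
      module

/-- The deformations are straight steps in the ascent direction, which is the same for all compact sets. -/
theorem hasAscendingDeformations (hu : ContDiffOn ℝ 1 u R.D) :
    (CrossingDomain.rectangle R).HasAscendingDeformations u := by
  intro N hN _ hcr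
  obtain ⟨s₀, hs₀, hstep⟩ := R.exists_step hu
  have hVc := R.continuousOn_ascent hu
  refine ⟨fun s x => x + s • R.ascent u x, fun _ x => R.ascent u x, s₀, ⟨hs₀, fun x _ => by simp,
    fun s hs x hx => (hstep s hs).1 x hx, ?_, ?_, fun x _ s _ => ?_, fun χ hχ hχ1 => ?_⟩,
    fun x hx => R.fderivWithin_ascent_pos (hN hx) (hcr x hx)⟩
  · exact continuousOn_snd.add (continuousOn_fst.smul (hVc.comp continuousOn_snd fun z hz => hz.2))
  · exact hVc.comp continuousOn_snd fun z hz => hz.2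
  · simpa using (((hasDerivAt_id s).smul_const (R.ascent u x)).const_add x).hasDerivWithinAt
  · filter_upwards [Icc_mem_nhdsGE hs₀] with τ hτ
    have hs : ∀ x, τ * χ x ∈ Icc 0 s₀ := fun x => ⟨mul_nonneg hτ.1 (hχ1 x).1,
      (mul_le_of_le_one_right hτ.1 (hχ1 x).2).trans hτ.2⟩
    have hc : ContinuousOn (fun x => x + (τ * χ x) • R.ascent u x) R.D :=
      continuousOn_id.add ((continuousOn_const.mul hχ.continuous.continuousOn).smul hVc)
    have hside : ∀ S ⊆ frontier R.D, (∃ G ⊆ R.faces, S = ⋃₀ G) →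
        MapsTo (fun x => x + (τ * χ x) • R.ascent u x) (closure S) (closure S) := by
      rintro S hS ⟨G, hG, rfl⟩
      refine MapsTo.closure_of_continuousOn ?_ (hc.mono ?_)
      · rintro x ⟨F, hF, hx⟩
        refine ⟨F, hF, (hstep _ (hs x)).2 F (hG hF) ?_ x hx⟩
        rintro rfl
        exact (hS ⟨_, hF, hx⟩).2 hx
      · exact closure_minimal (hS.trans R.isClosed_D.frontier_subset) R.isClosed_D
    exact CrossingDomain.isAdmissible_rectangle hc (fun x hx => (hstep _ (hs x)).1 x hx)
      (hside _ R.S₀_subset R.S₀_union) (hside _ R.S₂_subset R.S₂_union)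

end Ascent

end RectangleData

/-! ### Ascending deformations of an annulus -/

/-- Uniform approximation by smooth functions on a compact set. -/
lemma IsCompact.exists_contDiff_abs_sub_lt {D : Set Plane} (hD : IsCompact D) {f : Plane → ℝ}
    (hf : ContinuousOn f D) {δ : ℝ} (hδ : 0 < δ) :
    ∃ g : Plane → ℝ, ContDiff ℝ (⊤ : ℕ∞) g ∧ ∀ x ∈ D, |g x - f x| < δ := by
  obtain ⟨F, hF⟩ := ContinuousMap.exists_restrict_eq hD.isClosed
    (⟨D.domRestrict f, hf.domRestrict⟩ : C(D, ℝ))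
  have h := ContinuousMap.dense_setOfPred_contDiff (E := Plane) (F := ℝ) F
  rw [mem_closure_iff_nhds_basis
    (nhds_basis_uniformity Metric.uniformity_basis_dist.compactConvergenceUniformity)] at h
  obtain ⟨g, hg, hgD⟩ := h (D, δ) ⟨hD, hδ⟩
  refine ⟨g, hg, fun x hx => ?_⟩
  have h1 : F x = f x := congrArg (fun G : C(D, ℝ) => G ⟨x, hx⟩) hF
  have h2 := hgD x hx
  simp only [mem_ofPred_eq, Real.dist_eq, h1] at h2
  exact h2

/-- A small compactly supported smooth perturbation of the identity is a homeomorphism, as the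
perturbation is a contraction. -/
lemma eventually_exists_homeomorph_add {R : ℝ × Plane → Plane} (hR : ContDiff ℝ 1 R)
    (h0 : ∀ x, R (0, x) = 0) {K : Set Plane} (hK : IsCompact K)
    (hRK : ∀ τ, ∀ x ∉ K, R (τ, x) = 0) :
    ∀ᶠ τ in 𝓝 (0 : ℝ), ∃ Φ : Plane ≃ₜ Plane, ∀ x, Φ x = x + R (τ, x) := by
  let L : ℝ × Plane → (Plane →L[ℝ] Plane) := fun z =>
    (fderiv ℝ R z).comp (ContinuousLinearMap.inr ℝ ℝ Plane)
  have hL : ∀ τ x, HasFDerivAt (fun x => R (τ, x)) (L (τ, x)) x := fun τ x =>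
    ((hR.differentiable (by norm_num)) (τ, x)).hasFDerivAt.comp x (hasFDerivAt_prodMk_right τ x)
  have hLc : Continuous L :=
    (hR.continuous_fderiv (by norm_num)).clm_comp continuous_const
  obtain ⟨ε, hε, hεK⟩ := (isCompact_Icc (a := (-1 : ℝ)) (b := 1) |>.prod hK).exists_pos_forall_le
    (q := fun z => 1 / 2 - ‖L z‖) (d := fun z => |z.1|)
    (continuous_const.sub hLc.norm).continuousOn (by fun_prop) (fun z _ => abs_nonneg _) (by
      rintro ⟨τ, x⟩ - h
      simp only [abs_eq_zero] at h
      subst h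
      have h1 : (fun x => R (0, x)) = fun _ => 0 := funext h0
      have h2 := hL 0 x
      rw [h1] at h2
      have h3 : L (0, x) = 0 := h2.unique (hasFDerivAt_const _ _)
      simp only [h3, norm_zero]
      norm_num)
  filter_upwards [Icc_mem_nhds (show -(min ε 1) < 0 by simp [hε]) (show 0 < min ε 1 by simp [hε])]
    with τ hτ
  have hτ' : |τ| ≤ min ε 1 := abs_le.2 hτ
  have hbd : ∀ x, ‖L (τ, x)‖ ≤ 1 / 2 := by
    intro x
    by_cases hx : x ∈ K
    · have := hεK (τ, x) ⟨abs_le.1 (hτ'.trans (min_le_right _ _)), hx⟩ (hτ'.trans (min_le_left _ _))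
      linarith
    · have h1 : (fun x => R (τ, x)) =ᶠ[𝓝 x] fun _ => 0 := by
        filter_upwards [hK.isClosed.isOpen_compl.mem_nhds hx] with y hy using hRK τ y hy
      have h3 : L (τ, x) = 0 := (hL τ x).unique ((hasFDerivAt_const 0 x).congr_of_eventuallyEq h1)
      simp [h3]
  have hlip : LipschitzWith (1 / 2) (fun x => R (τ, x)) := by
    refine lipschitzWith_of_nnnorm_fderiv_le (𝕜 := ℝ) (fun x => (hL τ x).differentiableAt)
      fun x => ?_
    rw [(hL τ x).fderiv, ← NNReal.coe_le_coe]
    simpa using hbd x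
  have happ : ApproximatesLinearOn (fun x => x + R (τ, x))
      ((ContinuousLinearEquiv.refl ℝ Plane : Plane ≃L[ℝ] Plane) : Plane →L[ℝ] Plane) univ
      (1 / 2) := by
    intro x _ y _
    have h1 : x + R (τ, x) - (y + R (τ, y)) - (x - y) = R (τ, x) - R (τ, y) := by abel
    have h2 := hlip.dist_le_mul x y
    simp only [ContinuousLinearEquiv.coe_refl, ContinuousLinearMap.coe_id', id, h1]
    rw [← dist_eq_norm, ← dist_eq_norm]
    exact h2
  refine ⟨happ.toHomeomorph _ (Or.inr ?_), fun x => rfl⟩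
  have : ((ContinuousLinearEquiv.refl ℝ Plane).symm : Plane →L[ℝ] Plane) =
    ContinuousLinearMap.id ℝ Plane := rfl
  rw [this, ContinuousLinearMap.nnnorm_id, inv_one]
  rw [← NNReal.coe_lt_coe]
  norm_num

/-- The composition of the rotation of angle `β` and of the dilation of ratio `1 + α`. -/
def twist (α β : ℝ) (x : Plane) : Plane :=
  (1 + α) • (Real.cos β • x + Real.sin β • rot90 x)

lemma norm_twist (α β : ℝ) (x : Plane) : ‖twist α β x‖ = |1 + α| * ‖x‖ := by
  have h := norm_smul_add_smul_rot90_sq (Real.cos β) (Real.sin β) x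
  rw [Real.cos_sq_add_sin_sq, one_mul] at h
  rw [twist, norm_smul, Real.norm_eq_abs, (sq_eq_sq₀ (norm_nonneg _) (norm_nonneg _)).1 h]

lemma twist_zero_zero (x : Plane) : twist 0 0 x = x := by simp [twist]

namespace AnnulusData

variable (N : AnnulusData)

/-- A factor which vanishes on the boundary of the annulus. -/
def weight (x : Plane) : ℝ := (‖x‖ ^ 2 - N.inner ^ 2) * (N.outer ^ 2 - ‖x‖ ^ 2)

lemma weight_nonneg {x : Plane} (hx : x ∈ N.D) : 0 ≤ N.weight x := by
  have h1 := pow_le_pow_left₀ N.inner_pos.le hx.1 2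
  have h2 := pow_le_pow_left₀ (norm_nonneg x) hx.2 2
  exact mul_nonneg (by linarith) (by linarith)

lemma contDiff_weight : ContDiff ℝ (⊤ : ℕ∞) N.weight :=
  ((contDiff_norm_sq ℝ).sub contDiff_const).mul (contDiff_const.sub (contDiff_norm_sq ℝ))

/-- Small twists whose dilation factor vanishes on the boundary preserve the annulus. -/
lemma twist_mem {x : Plane} (hx : x ∈ N.D) {M s g : ℝ} (hg : |g| ≤ M) (hs : 0 ≤ s)
    (hsM : s * M * (2 * N.outer ^ 4) ≤ 1) (β : ℝ) : twist (s * (N.weight x * g)) β x ∈ N.D := by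
  obtain ⟨h1, h2⟩ := hx
  have ha := N.inner_pos
  have hb := N.outer_pos
  set t := ‖x‖
  have ht : 0 < t := ha.trans_le h1
  set k := s * g * ((t + N.inner) * (N.outer + t) * t) with hk
  have hk1 : |s * g| ≤ s * M := by
    rw [abs_mul, abs_of_nonneg hs]
    exact mul_le_mul_of_nonneg_left hg hs
  -- The two linear factors of the weight that are kept bound the displacement of the radius.
  have e1 : |s * g * ((t + N.inner) * (N.outer + t) * t) * (t - N.inner)| ≤ 1 := by
    have hA : (t + N.inner) * (t - N.inner) ≤ N.outer ^ 2 := by nlinarith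
    have hA0 : 0 ≤ (t + N.inner) * (t - N.inner) := mul_nonneg (by linarith) (by linarith)
    have hB : (N.outer + t) * t ≤ 2 * N.outer ^ 2 := by nlinarith
    have hB0 : 0 ≤ (N.outer + t) * t := by positivity
    have hAB : (t + N.inner) * (t - N.inner) * ((N.outer + t) * t) ≤ 2 * N.outer ^ 4 := by
      calc _ ≤ N.outer ^ 2 * (2 * N.outer ^ 2) := mul_le_mul hA hB hB0 (by positivity)
        _ = _ := by ring
    rw [show s * g * ((t + N.inner) * (N.outer + t) * t) * (t - N.inner) =
      (s * g) * ((t + N.inner) * (t - N.inner) * ((N.outer + t) * t)) by ring, abs_mul,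
      abs_of_nonneg (mul_nonneg hA0 hB0)]
    exact (mul_le_mul hk1 hAB (mul_nonneg hA0 hB0) ((abs_nonneg _).trans hk1)).trans hsM
  have e2 : |s * g * ((t + N.inner) * (N.outer + t) * t) * (N.outer - t)| ≤ 1 := by
    have hA : (N.outer + t) * (N.outer - t) ≤ N.outer ^ 2 := by nlinarith
    have hA0 : 0 ≤ (N.outer + t) * (N.outer - t) := mul_nonneg (by linarith) (by linarith)
    have hB : (t + N.inner) * t ≤ 2 * N.outer ^ 2 := by
      nlinarith [mul_le_mul h2 h2 ht.le hb.le, mul_le_mul (h1.trans h2) h2 ht.le hb.le]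
    have hB0 : 0 ≤ (t + N.inner) * t := by positivity
    have hAB : (N.outer + t) * (N.outer - t) * ((t + N.inner) * t) ≤ 2 * N.outer ^ 4 := by
      calc _ ≤ N.outer ^ 2 * (2 * N.outer ^ 2) := mul_le_mul hA hB hB0 (by positivity)
        _ = _ := by ring
    rw [show s * g * ((t + N.inner) * (N.outer + t) * t) * (N.outer - t) =
      (s * g) * ((N.outer + t) * (N.outer - t) * ((t + N.inner) * t)) by ring, abs_mul,
      abs_of_nonneg (mul_nonneg hA0 hB0)]
    exact (mul_le_mul hk1 hAB (mul_nonneg hA0 hB0) ((abs_nonneg _).trans hk1)).trans hsM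
  have hrad : (1 + s * (N.weight x * g)) * t = t + k * (t - N.inner) * (N.outer - t) := by
    simp only [weight, hk]
    change (1 + s * ((t ^ 2 - N.inner ^ 2) * (N.outer ^ 2 - t ^ 2) * g)) * t = _
    ring
  have f1 := abs_le.1 e1
  have f2 := abs_le.1 e2
  have hup : (1 + s * (N.weight x * g)) * t ≤ N.outer := by
    rw [hrad]
    nlinarith [mul_nonneg (sub_nonneg.2 f1.2) (sub_nonneg.2 h2)]
  have hlow : N.inner ≤ (1 + s * (N.weight x * g)) * t := by
    rw [hrad]
    nlinarith [mul_nonneg (by linarith [f2.1] : 0 ≤ k * (N.outer - t) + 1) (sub_nonneg.2 h1)]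
  have hpos : 0 < 1 + s * (N.weight x * g) := by
    by_contra hneg
    have := mul_nonpos_of_nonpos_of_nonneg (not_lt.1 hneg) ht.le
    linarith
  change N.inner ≤ ‖_‖ ∧ ‖_‖ ≤ N.outer
  rw [norm_twist, abs_of_pos hpos]
  exact ⟨hlow, hup⟩

variable {N} {u : Plane → ℝ}

/-- At a point which is not a stratified critical point, the gradient with its radial component
weighted does not vanish. -/
lemma weighted_gradient_pos {x : Plane} (hx : x ∈ N.D)
    (hcr : ¬ (CrossingDomain.annulus N).IsStratifiedCritical u x) :
    0 < N.weight x * fderivWithin ℝ u N.D x x ^ 2 + fderivWithin ℝ u N.D x (rot90 x) ^ 2 := by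
  have hw := N.weight_nonneg hx
  have hx0 : x ≠ 0 := by
    rintro rfl
    have := hx.1
    rw [norm_zero] at this
    exact absurd N.inner_pos this.not_gt
  refine lt_of_le_of_ne (by positivity) fun h0 => hcr ?_
  have hθ : fderivWithin ℝ u N.D x (rot90 x) = 0 := by
    have h1 : 0 ≤ N.weight x * fderivWithin ℝ u N.D x x ^ 2 := by positivity
    have h2 := sq_nonneg (fderivWithin ℝ u N.D x (rot90 x))
    exact pow_eq_zero_iff two_ne_zero |>.1 (by linarith)
  have hsphere : ∀ r, 0 < r → Metric.sphere 0 r ∈ (CrossingDomain.annulus N).faces → ‖x‖ = r →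
      (CrossingDomain.annulus N).IsStratifiedCritical u x := by
    intro r hr hF hxr
    have hxF : x ∈ Metric.sphere (0 : Plane) r := by simpa using hxr
    refine ⟨_, hF, hxF, fun v hv => ?_⟩
    have hcurve := isCurveFace_sphere hr
    obtain ⟨s, hs, hsx⟩ := hcurve.image_eq.symm ▸ hxF
    have h1 := hcurve.tangentSpace_le s hs
    rw [hsx, (hasDerivAt_circleCurve r s).deriv, hsx] at h1
    obtain ⟨μ, rfl⟩ := Submodule.mem_span_singleton.1 (h1 hv)
    change fderivWithin ℝ u N.D x (μ • rot90 x) = 0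
    rw [map_smul, hθ, smul_zero]
  rcases hx.1.eq_or_lt with h1 | h1
  · exact hsphere _ N.inner_pos (by simp [CrossingDomain.faces]) h1.symm
  rcases hx.2.eq_or_lt with h2 | h2
  · exact hsphere _ N.outer_pos (by simp [CrossingDomain.faces]) h2
  have hint : x ∈ interior N.D := N.mem_interior_iff.2 ⟨h1, h2⟩
  refine ⟨interior N.D, by simp [CrossingDomain.faces], hint, fun v _ => ?_⟩
  change fderivWithin ℝ u N.D x v = 0
  have hwpos : N.weight x ≠ 0 := by
    have h1 := pow_lt_pow_left₀ h1 N.inner_pos.le two_ne_zero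
    have h2 := pow_lt_pow_left₀ h2 (norm_nonneg x) two_ne_zero
    exact (mul_pos (by linarith) (by linarith)).ne'
  have hρ : fderivWithin ℝ u N.D x x = 0 := by
    rw [hθ] at h0
    have : N.weight x * fderivWithin ℝ u N.D x x ^ 2 = 0 := by linarith
    exact pow_eq_zero_iff two_ne_zero |>.1 ((mul_eq_zero.1 this).resolve_left hwpos)
  have hsq : x 0 ^ 2 + x 1 ^ 2 ≠ 0 := by
    rw [← Plane.norm_sq]
    exact pow_ne_zero 2 (norm_ne_zero_iff.2 hx0)
  have hv : v = ((v 0 * x 0 + v 1 * x 1) / (x 0 ^ 2 + x 1 ^ 2)) • x +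
      ((v 1 * x 0 - v 0 * x 1) / (x 0 ^ 2 + x 1 ^ 2)) • rot90 x := by
    ext i
    fin_cases i
    · simp
      field_simp
      ring
    · simp
      field_simp
      ring
  rw [hv, map_add, map_smul, map_smul, hρ, hθ, smul_zero, smul_zero, add_zero]

/-- The deformations rotate and dilate each point at speeds close to the weighted gradient. These speeds
are smooth, so that the deformations extend to homeomorphisms of the plane. -/
theorem hasAscendingDeformations (hu : ContDiffOn ℝ 1 u N.D) :
    (CrossingDomain.annulus N).HasAscendingDeformations u := by
  intro K hKD hK hcr
  change K ⊆ N.D at hKD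
  have hdu := hu.continuousOn_fderivWithin N.hasInwardFrame.uniqueDiffOn (by norm_num)
  have hρ : ContinuousOn (fun x => fderivWithin ℝ u N.D x x) N.D := hdu.clm_apply continuousOn_id
  have hθ : ContinuousOn (fun x => fderivWithin ℝ u N.D x (rot90 x)) N.D :=
    hdu.clm_apply rot90.continuous.continuousOn
  have hwc := N.contDiff_weight.continuous
  obtain ⟨m, hm, hmK⟩ := hK.exists_forall_le' (f := fun x => N.weight x *
    fderivWithin ℝ u N.D x x ^ 2 + fderivWithin ℝ u N.D x (rot90 x) ^ 2) (a := 0)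
    (((hwc.continuousOn.mul (hρ.pow 2)).add (hθ.pow 2)).mono hKD)
    fun x hx => weighted_gradient_pos (hKD hx) (hcr x hx)
  obtain ⟨B, hB⟩ := N.isCompact_D.exists_bound_of_continuousOn
    (f := fun x => N.weight x * |fderivWithin ℝ u N.D x x| + |fderivWithin ℝ u N.D x (rot90 x)|)
    ((hwc.continuousOn.mul hρ.abs).add hθ.abs)
  set δ := m / (2 * (|B| + 1)) with hδ
  have hδ0 : 0 < δ := by positivity
  have hδB : δ * |B| < m := by
    rw [hδ, div_mul_eq_mul_div, div_lt_iff₀ (by positivity)]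
    nlinarith [abs_nonneg B]
  -- Smooth approximations of the radial and of the angular derivatives.
  obtain ⟨g, hg, hgρ⟩ := N.isCompact_D.exists_contDiff_abs_sub_lt hρ hδ0
  obtain ⟨h, hh, hhθ⟩ := N.isCompact_D.exists_contDiff_abs_sub_lt hθ hδ0
  obtain ⟨M', hM'⟩ := N.isCompact_D.exists_bound_of_continuousOn hg.continuous.continuousOn
  set M := |M'| + 1
  have hM : ∀ x ∈ N.D, |g x| ≤ M := fun x hx =>
    (hM' x hx).trans ((le_abs_self _).trans (by simp [M]))
  have hM0 : 0 < M := by positivity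
  have hb := N.outer_pos
  set s₀ := 1 / (M * (2 * N.outer ^ 4)) with hs₀
  have hs₀0 : 0 < s₀ := by positivity
  have hs : ∀ s ∈ Icc 0 s₀, s * M * (2 * N.outer ^ 4) ≤ 1 := fun s hs => by
    rw [mul_assoc]
    exact (le_div_iff₀ (by positivity)).1 hs.2
  have hgc := hg.continuous
  have hhc := hh.continuous
  have hmem : ∀ s ∈ Icc 0 s₀, ∀ x ∈ N.D, twist (s * (N.weight x * g x)) (s * h x) x ∈ N.D :=
    fun s hs' x hx => N.twist_mem hx (hM x hx) hs'.1 (hs s hs') _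
  refine ⟨fun s x => twist (s * (N.weight x * g x)) (s * h x) x,
    fun s x => (N.weight x * g x) • (Real.cos (s * h x) • x + Real.sin (s * h x) • rot90 x) +
      (1 + s * (N.weight x * g x)) • ((-Real.sin (s * h x) * h x) • x +
        (Real.cos (s * h x) * h x) • rot90 x), s₀,
    ⟨hs₀0, fun x _ => by simp [twist_zero_zero], hmem, ?_, ?_, fun x _ s _ => ?_,
      fun χ hχ hχ1 => ?_⟩, fun x hx => ?_⟩
  · simp only [twist]
    fun_prop
  · fun_prop
  · have h1 : HasDerivAt (fun s : ℝ => s * h x) (h x) s := by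
      simpa using (hasDerivAt_id s).mul_const (h x)
    have h2 : HasDerivAt (fun s : ℝ => 1 + s * (N.weight x * g x)) (N.weight x * g x) s := by
      simpa using ((hasDerivAt_id s).mul_const (N.weight x * g x)).const_add 1
    have h3 := h2.smul ((h1.cos.smul_const x).add (h1.sin.smul_const (rot90 x)))
    refine (h3.congr_deriv ?_).hasDerivWithinAt
    rw [add_comm]
    rfl
  · let b : ContDiffBump (0 : Plane) := ⟨N.outer, N.outer + 1, hb, by linarith⟩
    have hbs : ContDiff ℝ 1 b := b.contDiff
    have hb1 : ∀ x ∈ N.D, b x = 1 := fun x hx =>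
      b.one_of_mem_closedBall (by simpa using hx.2)
    have hb0 : ∀ x ∉ Metric.closedBall (0 : Plane) (N.outer + 1), b x = 0 := fun x hx =>
      b.zero_of_le_dist (by
        rw [Metric.mem_closedBall, not_le] at hx
        exact hx.le)
    -- The displacement, extended by a cutoff to a compactly supported map on the plane.
    let R : ℝ × Plane → Plane := fun z =>
      twist (z.1 * (χ z.2 * (N.weight z.2 * g z.2))) (z.1 * (χ z.2 * h z.2)) (b z.2 • z.2) -
        b z.2 • z.2
    have hg1 : ContDiff ℝ 1 g := hg.of_le (by exact_mod_cast le_top)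
    have hh1 : ContDiff ℝ 1 h := hh.of_le (by exact_mod_cast le_top)
    have hw1 : ContDiff ℝ 1 N.weight := N.contDiff_weight.of_le (by exact_mod_cast le_top)
    have hR : ContDiff ℝ 1 R := by
      have e1 : ContDiff ℝ 1 fun z : ℝ × Plane => b z.2 • z.2 :=
        (hbs.comp contDiff_snd).smul contDiff_snd
      have e2 : ContDiff ℝ 1 fun z : ℝ × Plane => z.1 * (χ z.2 * (N.weight z.2 * g z.2)) :=
        contDiff_fst.mul ((hχ.comp contDiff_snd).mul ((hw1.comp contDiff_snd).mul
          (hg1.comp contDiff_snd)))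
      have e3 : ContDiff ℝ 1 fun z : ℝ × Plane => z.1 * (χ z.2 * h z.2) :=
        contDiff_fst.mul ((hχ.comp contDiff_snd).mul (hh1.comp contDiff_snd))
      have e4 : ContDiff ℝ 1 fun z : ℝ × Plane => rot90 (b z.2 • z.2) := rot90.contDiff.comp e1
      exact ((contDiff_const.add e2).smul ((e3.cos.smul e1).add (e3.sin.smul e4))).sub e1
    have hev := eventually_exists_homeomorph_add hR (fun x => by simp [R, twist_zero_zero])
      (isCompact_closedBall (0 : Plane) (N.outer + 1)) (fun τ x hx => by
        simp [R, hb0 x hx, twist])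
    filter_upwards [nhdsWithin_le_nhds hev, Icc_mem_nhdsGE hs₀0] with τ hΦ hτ
    obtain ⟨Φ, hΦ⟩ := hΦ
    have hΦD : EqOn Φ (fun x => twist (τ * χ x * (N.weight x * g x)) (τ * χ x * h x) x) N.D := by
      intro x hx
      simp only [hΦ, R, hb1 x hx, one_smul, mul_assoc]
      abel
    refine (CrossingDomain.isAdmissible_annulus Φ ?_ ?_).congr hΦD
    · simp [hΦ, R, twist]
    · intro x hx
      rw [hΦD hx]
      exact hmem _ ⟨mul_nonneg hτ.1 (hχ1 x).1,
        (mul_le_of_le_one_right hτ.1 (hχ1 x).2).trans hτ.2⟩ x hx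
  · change 0 < fderivWithin ℝ u N.D x _
    have hxD := hKD hx
    simp only [zero_mul, Real.cos_zero, Real.sin_zero, one_smul, zero_smul, add_zero, neg_zero,
      zero_add, one_mul, map_add, map_smul, smul_eq_mul]
    have h1 := hmK x hx
    have h2 := (le_abs_self _).trans (hB x hxD)
    have h3 := abs_lt.1 (hgρ x hxD)
    have h4 := abs_lt.1 (hhθ x hxD)
    have hw := N.weight_nonneg hxD
    set ρ := fderivWithin ℝ u N.D x x
    set θ := fderivWithin ℝ u N.D x (rot90 x)
    have h5 : -(δ * |ρ|) ≤ (g x - ρ) * ρ := by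
      have := (abs_le.1 (le_refl |(g x - ρ) * ρ|)).1
      rw [abs_mul] at this
      nlinarith [mul_le_mul_of_nonneg_right (hgρ x hxD).le (abs_nonneg ρ)]
    have h6 : -(δ * |θ|) ≤ (h x - θ) * θ := by
      have := (abs_le.1 (le_refl |(h x - θ) * θ|)).1
      rw [abs_mul] at this
      nlinarith [mul_le_mul_of_nonneg_right (hhθ x hxD).le (abs_nonneg θ)]
    have h7 : N.weight x * |ρ| + |θ| ≤ |B| :=
      (le_abs_self _).trans ((hB x hxD).trans (le_abs_self _))
    have h8 := mul_le_mul_of_nonneg_left h5 hw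
    have h9 := mul_le_mul_of_nonneg_left h7 hδ0.le
    have h10 : N.weight x * g x * ρ + h x * θ = (N.weight x * ρ ^ 2 + θ ^ 2) +
      N.weight x * ((g x - ρ) * ρ) + (h x - θ) * θ := by ring
    rw [h10]
    nlinarith

end AnnulusData

/-- Every `C¹` function has deformations which increase it away from its stratified critical
points. -/
theorem CrossingDomain.hasAscendingDeformations (𝔇 : CrossingDomain) {u : Plane → ℝ}
    (hu : ContDiffOn ℝ 1 u 𝔇.D) : 𝔇.HasAscendingDeformations u := by
  cases 𝔇 with
  | rectangle R => exact R.hasAscendingDeformations hu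
  | annulus N => exact AnnulusData.hasAscendingDeformations hu

/-! ### Differentiability of the threshold height -/

namespace CrossingDomain

variable {𝔇 : CrossingDomain} {u v : Plane → ℝ}

/-- A `C¹` function has a stratified critical point at the level of its threshold. Otherwise a constant
perturbation would change the threshold by less than its size. -/
theorem exists_isThresholdPoint (hu : ContDiffOn ℝ 1 u 𝔇.D) : ∃ x, 𝔇.IsThresholdPoint u x := by
  by_contra! hcon
  obtain ⟨B, hB⟩ := 𝔇.isCompact_D.isBounded.subset_closedBall 0
  -- Centre the excluded ball outside of the domain.
  let x₀ : Plane := EuclideanSpace.single 0 (|B| + 2)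
  have hx₀ : ∀ x ∈ 𝔇.D, ¬ dist x x₀ < 2 * 1 := by
    intro x hx h
    have h1 := mem_closedBall_zero_iff.1 (hB hx)
    have h2 : ‖x₀‖ = |B| + 2 := by
      rw [PiLp.norm_single, Real.norm_of_nonneg (by positivity)]
    have h3 := norm_sub_norm_le x₀ x
    rw [← dist_eq_norm, dist_comm, h2] at h3
    linarith [le_abs_self B]
  obtain ⟨ε, hε, h⟩ := T_add_le_of_small_near (𝔇.hasAscendingDeformations hu) hu (x₀ := x₀)
    (fun x hx hxc => absurd ⟨hx, hxc⟩ (hcon x)) one_pos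
  have := h ε hε le_rfl (ε / 4) (by positivity) (by linarith) (fun _ => 0) (fun _ => -ε)
    continuousOn_const continuousOn_const (by simp [hε.le]) (by simp [abs_of_pos hε])
    (fun x hx hd => absurd hd (hx₀ x hx)) (fun x hx hd => absurd hd (hx₀ x hx))
  rw [T_add_const hu.continuousOn] at this
  simp only [add_zero] at this
  linarith

lemma IsStratifiedCritical.mem {x : Plane} (h : 𝔇.IsStratifiedCritical u x) : x ∈ 𝔇.D := by
  obtain ⟨F, hF, hx, -⟩ := h
  exact 𝔇.isRegularStratification.face_subset hF hx

theorem IsPerfectMorse.existsUnique_isThresholdPoint (h : 𝔇.IsPerfectMorse u) :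
    ∃! x, 𝔇.IsThresholdPoint u x := by
  obtain ⟨x, hx⟩ := exists_isThresholdPoint (h.contDiffOn.of_le (by norm_num))
  refine ⟨x, hx, fun y hy => ?_⟩
  by_contra hne
  exact h.critical_values y x hy.1 hx.1 hne (hy.2.trans hx.2.symm)

lemma IsPerfectMorse.isThresholdPoint_S (h : 𝔇.IsPerfectMorse u) : 𝔇.IsThresholdPoint u (𝔇.S u) :=
  Classical.epsilon_spec h.existsUnique_isThresholdPoint.exists

lemma IsPerfectMorse.S_mem (h : 𝔇.IsPerfectMorse u) : 𝔇.S u ∈ 𝔇.D := h.isThresholdPoint_S.1.mem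

/-- The threshold height is differentiable at a perfect Morse function, and its derivative is minus
the evaluation at the threshold location. -/
theorem IsPerfectMorse.hasDerivAt_T (h : 𝔇.IsPerfectMorse u) (hv : ContinuousOn v 𝔇.D) :
    HasDerivAt (fun s : ℝ => 𝔇.T (fun x => u x + s * v x)) (-v (𝔇.S u)) 0 := by
  have hu : ContDiffOn ℝ 1 u 𝔇.D := h.contDiffOn.of_le (by norm_num)
  have huc := hu.continuousOn
  set x₀ := 𝔇.S u with hx₀
  have hx₀D : x₀ ∈ 𝔇.D := h.S_mem
  have huniq : ∀ x, 𝔇.IsStratifiedCritical u x → u x = -𝔇.T u → x = x₀ := fun x hx hxc =>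
    h.existsUnique_isThresholdPoint.unique ⟨hx, hxc⟩ h.isThresholdPoint_S
  -- Up to a constant, which shifts the threshold, the direction vanishes at `x₀`.
  let w : Plane → ℝ := fun x => v x - v x₀
  have hw : ContinuousOn w 𝔇.D := hv.sub continuousOn_const
  have hsw : ∀ s : ℝ, ContinuousOn (fun x => s * w x) 𝔇.D := fun s => continuousOn_const.mul hw
  obtain ⟨M, hM, hMw⟩ := exists_abs_le hw
  have hT : ∀ s, 𝔇.T (fun x => u x + s * v x) = 𝔇.T (fun x => u x + s * w x) - s * v x₀ := by
    intro s
    rw [← T_add_const (u := fun x => u x + s * w x) (huc.add (hsw s))]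
    congr 1
    ext x
    simp only [w]
    ring
  have h0 : (fun x => u x + 0 * v x) = u := by simp
  rw [hasDerivAt_iff_isLittleO, Asymptotics.isLittleO_iff]
  intro η hη
  set η' := min (η / 3) M
  have hη' : 0 < η' := by positivity
  have hcx : ∀ᶠ x in 𝓝[𝔇.D] x₀, |w x| < η' := by
    have h1 : Tendsto (fun x => |w x|) (𝓝[𝔇.D] x₀) (𝓝 |w x₀|) := (hw x₀ hx₀D).abs
    refine h1.eventually (gt_mem_nhds ?_)
    simpa [w] using hη'
  obtain ⟨r, hr, hrw⟩ := Metric.mem_nhdsWithin_iff.1 hcx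
  obtain ⟨ε₁, hε₁, hsmall⟩ := T_add_le_of_small_near (𝔇.hasAscendingDeformations hu) hu huniq
    (half_pos hr)
  filter_upwards [Metric.ball_mem_nhds (0 : ℝ) (div_pos hε₁ hM)] with s hs
  rw [Metric.mem_ball, dist_zero_right, Real.norm_eq_abs, lt_div_iff₀ hM] at hs
  rw [h0, hT]
  rcases eq_or_ne s 0 with rfl | hs0
  · simp
  have hsa : 0 < |s| := abs_pos.2 hs0
  have e1 : ∀ x ∈ 𝔇.D, |s * w x| ≤ |s| * M := fun x hx => by
    rw [abs_mul]
    exact mul_le_mul_of_nonneg_left (hMw x hx) hsa.le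
  have e2 : ∀ x ∈ 𝔇.D, dist x x₀ < 2 * (r / 2) → |s * w x| ≤ |s| * η' := fun x hx hd => by
    rw [abs_mul]
    refine mul_le_mul_of_nonneg_left ?_ hsa.le
    have : x ∈ Metric.ball x₀ r ∩ 𝔇.D := ⟨by rw [Metric.mem_ball]; linarith, hx⟩
    exact (hrw this).le
  have e3 : ∀ x ∈ 𝔇.D, |(0 : ℝ)| ≤ |s| * M := fun x _ => by simp; positivity
  have e4 : ∀ x ∈ 𝔇.D, dist x x₀ < 2 * (r / 2) → |(0 : ℝ)| ≤ |s| * η' := fun x _ _ => by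
    simp; positivity
  have hδε : |s| * η' ≤ |s| * M := mul_le_mul_of_nonneg_left (min_le_right _ _) hsa.le
  have k1 := hsmall (|s| * M) (by positivity) hs.le (|s| * η') (by positivity) hδε
    (fun _ => 0) (fun x => s * w x) continuousOn_const (hsw s) e3 e1 e4 e2
  have k2 := hsmall (|s| * M) (by positivity) hs.le (|s| * η') (by positivity) hδε
    (fun x => s * w x) (fun _ => 0) (hsw s) continuousOn_const e1 e3 e2 e4
  simp only [add_zero] at k1 k2
  have hη3 : |s| * η' ≤ |s| * (η / 3) := mul_le_mul_of_nonneg_left (min_le_left _ _) hsa.le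
  rw [Real.norm_eq_abs, Real.norm_eq_abs, sub_zero, smul_eq_mul, abs_le]
  constructor <;> nlinarith

end CrossingDomain

/-! ### Gateaux derivatives and rotation invariant measures -/

section GateauxDerivative

variable {E : Type*} [NormedAddCommGroup E]

/-- Exponential bounds for a function and for its local Lipschitz constants. -/
structure IsExpLipschitz (H : E → ℝ) (B b : ℝ) : Prop where
  nonneg_left : 0 ≤ B
  nonneg_right : 0 ≤ b
  continuous : Continuous H
  bound : ∀ u, |H u| ≤ B * Real.exp (b * ‖u‖)
  lip : ∀ R u w, ‖u‖ ≤ R → ‖w‖ ≤ R → |H u - H w| ≤ B * Real.exp (b * R) * ‖u - w‖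

variable {H : E → ℝ} {B b : ℝ}

lemma IsExpLipschitz.bound_of_le (h : IsExpLipschitz H B b) {R : ℝ} {u : E} (hu : ‖u‖ ≤ R) :
    |H u| ≤ B * Real.exp (b * R) :=
  (h.bound u).trans (mul_le_mul_of_nonneg_left
    (Real.exp_le_exp.2 (mul_le_mul_of_nonneg_left hu h.nonneg_right)) h.nonneg_left)

variable [NormedSpace ℝ E]

/-- `L` is the Gateaux derivative of `H` at `u`. -/
def HasGateauxDeriv (H : E → ℝ) (L : E →L[ℝ] ℝ) (u : E) : Prop :=
  ∀ v, HasDerivAt (fun s : ℝ => H (u + s • v)) (L v) 0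

/-- A locally Lipschitz function with a directional derivative is differentiable along the
differentiable curves with this direction. -/
lemma IsExpLipschitz.hasDerivAt_comp (h : IsExpLipschitz H B b) {c : ℝ → E} {q : E} {θ d : ℝ}
    (hc : HasDerivAt c q θ) (hd : HasDerivAt (fun s : ℝ => H (c θ + s • q)) d 0) :
    HasDerivAt (fun α => H (c α)) d θ := by
  have h1 : HasDerivAt (fun α => H (c θ + (α - θ) • q)) d θ := by
    have h2 : HasDerivAt (fun α : ℝ => α - θ) 1 θ := (hasDerivAt_id θ).sub_const θ
    have h3 := HasDerivAt.comp (h₂ := fun s : ℝ => H (c θ + s • q)) (h := fun α : ℝ => α - θ)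
      θ (by simpa using hd) h2
    simpa [Function.comp_def] using h3
  have h4 : HasDerivAt (fun α => H (c α) - H (c θ + (α - θ) • q)) 0 θ := by
    rw [hasDerivAt_iff_isLittleO] at hc ⊢
    have hl : Tendsto (fun α => c θ + (α - θ) • q) (𝓝 θ) (𝓝 (c θ)) := by
      have : Continuous fun α : ℝ => c θ + (α - θ) • q := by fun_prop
      simpa using this.tendsto θ
    have hcc : Tendsto c (𝓝 θ) (𝓝 (c θ)) := by
      have : HasDerivAt c q θ := hasDerivAt_iff_isLittleO.2 hc
      exact this.continuousAt
    have hR1 := hcc.norm.eventually (gt_mem_nhds (lt_add_one ‖c θ‖))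
    have hR2 := hl.norm.eventually (gt_mem_nhds (lt_add_one ‖c θ‖))
    refine Asymptotics.IsBigO.trans_isLittleO ?_ hc
    refine Asymptotics.IsBigO.of_bound (B * Real.exp (b * (‖c θ‖ + 1))) ?_
    filter_upwards [hR1, hR2] with α e1 e2
    have := h.lip _ _ _ e1.le e2.le
    simp only [sub_self, zero_smul, add_zero, smul_zero, sub_zero, Real.norm_eq_abs]
    refine this.trans_eq ?_
    congr 2
    abel
  have := h4.add h1
  rw [zero_add] at this
  refine this.congr_of_eventuallyEq (.of_forall fun α => ?_)
  simp

lemma IsExpLipschitz.abs_deriv_le (h : IsExpLipschitz H B b) {L : E →L[ℝ] ℝ} {u : E}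
    (hu : HasGateauxDeriv H L u) (v : E) :
    |L v| ≤ B * Real.exp (b * (‖u‖ + 1)) * ‖v‖ := by
  have hB := h.nonneg_left
  refine (hu v).le_of_lip' (by positivity) ?_
  have hl : Tendsto (fun s : ℝ => u + s • v) (𝓝 0) (𝓝 u) := by
    have : Continuous fun s : ℝ => u + s • v := by fun_prop
    simpa using this.tendsto 0
  filter_upwards [hl.norm.eventually (gt_mem_nhds (lt_add_one ‖u‖))] with s hs
  have := h.lip _ _ _ hs.le (show ‖u + (0 : ℝ) • v‖ ≤ ‖u‖ + 1 by simp)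
  rw [Real.norm_eq_abs]
  refine this.trans_eq ?_
  rw [zero_smul, add_zero, add_sub_cancel_left, norm_smul, sub_zero]
  ring

lemma hasDerivAt_cos_smul_add_sin_smul (u v : E) (θ : ℝ) :
    HasDerivAt (fun α => Real.cos α • u + Real.sin α • v)
      (-Real.sin θ • u + Real.cos θ • v) θ :=
  ((Real.hasDerivAt_cos θ).smul_const u).add ((Real.hasDerivAt_sin θ).smul_const v)

lemma norm_cos_smul_add_sin_smul_le (u v : E) (θ : ℝ) :
    ‖Real.cos θ • u + Real.sin θ • v‖ ≤ ‖u‖ + ‖v‖ := by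
  refine (norm_add_le _ _).trans (add_le_add ?_ ?_)
  · rw [norm_smul]
    exact mul_le_of_le_one_left (norm_nonneg _) (Real.abs_cos_le_one θ)
  · rw [norm_smul]
    exact mul_le_of_le_one_left (norm_nonneg _) (Real.abs_sin_le_one θ)

lemma norm_cos_smul_add_sin_smul_sub_le (u v : E) (α β : ℝ) :
    ‖(Real.cos α • u + Real.sin α • v) - (Real.cos β • u + Real.sin β • v)‖ ≤
      |α - β| * (‖u‖ + ‖v‖) := by
  have h1 : (Real.cos α • u + Real.sin α • v) - (Real.cos β • u + Real.sin β • v) =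
      (Real.cos α - Real.cos β) • u + (Real.sin α - Real.sin β) • v := by module
  rw [h1, mul_add]
  refine (norm_add_le _ _).trans (add_le_add ?_ ?_)
  · rw [norm_smul]
    exact mul_le_mul_of_nonneg_right (Real.abs_cos_sub_cos_le α β) (norm_nonneg _)
  · rw [norm_smul]
    exact mul_le_mul_of_nonneg_right (Real.abs_sin_sub_sin_le α β) (norm_nonneg _)

variable [MeasurableSpace E] [BorelSpace E] [SecondCountableTopology E]

/-- The Gateaux derivative of a continuous function is measurable, as a limit of difference
quotients. -/
lemma aestronglyMeasurable_gateauxDeriv (hH : Continuous H) {H' : E → E →L[ℝ] ℝ} {Ξ : Type*}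
    [MeasurableSpace Ξ] {ρ : Measure Ξ} {a c : Ξ → E} (ha : Measurable a) (hc : Measurable c)
    (h : ∀ᵐ ξ ∂ρ, HasGateauxDeriv H (H' (a ξ)) (a ξ)) :
    AEStronglyMeasurable (fun ξ => H' (a ξ) (c ξ)) ρ := by
  refine aestronglyMeasurable_of_tendsto_ae atTop
    (f := fun (n : ℕ) ξ => ((n : ℝ) + 1) * (H (a ξ + ((n : ℝ) + 1)⁻¹ • c ξ) - H (a ξ)))
    (fun n => ?_) ?_
  · have h1 : Measurable fun ξ => H (a ξ + ((n : ℝ) + 1)⁻¹ • c ξ) :=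
      hH.measurable.comp (ha.add (hc.const_smul _))
    exact ((h1.sub (hH.measurable.comp ha)).const_mul _).aestronglyMeasurable
  · filter_upwards [h] with ξ hξ
    have h1 := (hasDerivAt_iff_tendsto_slope_zero.1 (hξ (c ξ)))
    have h2 : Tendsto (fun n : ℕ => ((n : ℝ) + 1)⁻¹) atTop (𝓝[≠] 0) := by
      refine tendsto_nhdsWithin_iff.2 ⟨?_, .of_forall fun n => ?_⟩
      · exact tendsto_inv_atTop_zero.comp
          (tendsto_atTop_add_const_right _ _ tendsto_natCast_atTop_atTop)
      · exact (inv_ne_zero (by positivity : (n : ℝ) + 1 ≠ 0))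
    refine (h1.comp h2).congr fun n => ?_
    simp

end GateauxDerivative

section Rotation

variable {E : Type*} [NormedAddCommGroup E] [NormedSpace ℝ E] [MeasurableSpace E] [BorelSpace E]
  [SecondCountableTopology E]

/-- The law of a pair of independent copies of `μ` is invariant under rotations, as it is for a
centred Gaussian measure `μ`. -/
def IsRotationInvariant (μ : Measure E) : Prop :=
  ∀ θ, (μ.prod μ).map (ContinuousLinearMap.rotation θ) = μ.prod μ

variable {μ : Measure E}

namespace IsRotationInvariant

lemma measurePreserving (hμ : IsRotationInvariant μ) (θ : ℝ) :
    MeasurePreserving (ContinuousLinearMap.rotation θ : E × E →L[ℝ] E × E)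
      (μ.prod μ) (μ.prod μ) :=
  ⟨(ContinuousLinearMap.continuous _).measurable, hμ θ⟩

variable [IsProbabilityMeasure μ]

lemma measurePreserving_cos_sin (hμ : IsRotationInvariant μ) (θ : ℝ) :
    MeasurePreserving (fun p : E × E => Real.cos θ • p.1 + Real.sin θ • p.2) (μ.prod μ) μ :=
  measurePreserving_fst.comp (hμ.measurePreserving θ)

lemma measurePreserving_neg (hμ : IsRotationInvariant μ) :
    MeasurePreserving (fun u : E => -u) μ μ := by
  refine ⟨measurable_neg, ?_⟩
  have h1 := (hμ.measurePreserving_cos_sin Real.pi).map_eq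
  simp only [Real.cos_pi, Real.sin_pi, zero_smul, add_zero, neg_smul, one_smul] at h1
  have h2 : (fun p : E × E => -p.1) = (fun u : E => -u) ∘ Prod.fst := rfl
  rw [h2, ← Measure.map_map measurable_neg measurable_fst, Measure.map_fst_prod, measure_univ,
    one_smul] at h1
  exact h1

/-- The norm has exponential moments of all orders, by Fernique's theorem. -/
lemma integrable_exp_norm (hμ : IsRotationInvariant μ) (c : ℝ) :
    Integrable (fun u => Real.exp (c * ‖u‖)) μ := by
  obtain ⟨C, hC, hint⟩ := exists_integrable_exp_sq_of_map_rotation_eq_self (hμ (-(Real.pi / 4)))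
  refine (hint.mul_const (Real.exp (c ^ 2 / (4 * C)))).mono' (by fun_prop)
    (.of_forall fun u => ?_)
  rw [Real.norm_of_nonneg (Real.exp_pos _).le, ← Real.exp_add, Real.exp_le_exp]
  have h1 : C * ‖u‖ ^ 2 + c ^ 2 / (4 * C) - c * ‖u‖ = C * (‖u‖ - c / (2 * C)) ^ 2 := by
    field_simp
    ring
  have h2 : 0 ≤ C * (‖u‖ - c / (2 * C)) ^ 2 := by positivity
  linarith

lemma integrable_exp_norm_prod (hμ : IsRotationInvariant μ) (A c d : ℝ) :
    Integrable (fun p : E × E => A * Real.exp (c * ‖p.1‖ + d * ‖p.2‖)) (μ.prod μ) := by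
  simp only [Real.exp_add]
  exact ((hμ.integrable_exp_norm c).mul_prod (hμ.integrable_exp_norm d)).const_mul A

end IsRotationInvariant

end Rotation

/-! ### Gaussian integration by parts -/

section CovarianceFormula

variable {E : Type*} [NormedAddCommGroup E] [NormedSpace ℝ E] [MeasurableSpace E] [BorelSpace E]
  [SecondCountableTopology E] {μ : Measure E} [IsProbabilityMeasure μ]
  {H : E → ℝ} {H' : E → E →L[ℝ] ℝ} {B b : ℝ}

/-- **Gaussian integration by parts**: the derivative at the angle `0` of the integral of
`ℓ(-sin α x + cos α y) H(p + a (cos α x + sin α y))` vanishes, by rotation invariance. -/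
theorem integral_mul_eq_integral_gateauxDeriv (hμ : IsRotationInvariant μ)
    (hH : IsExpLipschitz H B b) (ℓ : E →L[ℝ] ℝ) (p : E) {a : ℝ} (ha : |a| ≤ 1)
    (hgood : ∀ᵐ v ∂μ, HasGateauxDeriv H (H' (p + a • v)) (p + a • v)) :
    Integrable (fun z : E × E => ℓ z.2 * H' (p + a • z.1) z.2) (μ.prod μ) ∧
    ∫ v, ℓ v * H (p + a • v) ∂μ =
      a * ∫ z : E × E, ℓ z.2 * H' (p + a • z.1) z.2 ∂(μ.prod μ) := by
  have hHc := hH.continuous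
  have hB := hH.nonneg_left
  have hb := hH.nonneg_right
  have hgood' : ∀ᵐ z ∂(μ.prod μ), HasGateauxDeriv H (H' (p + a • z.1)) (p + a • z.1) :=
    measurePreserving_fst.quasiMeasurePreserving.ae hgood
  have haz : ∀ x : E, ‖a • x‖ ≤ ‖x‖ := fun x => by
    rw [norm_smul]
    exact mul_le_of_le_one_left (norm_nonneg _) ha
  let F : ℝ → E × E → ℝ := fun α z => ℓ (-Real.sin α • z.1 + Real.cos α • z.2) *
    H (p + a • (Real.cos α • z.1 + Real.sin α • z.2))
  let F' : E × E → ℝ := fun z => ℓ (-z.1) * H (p + a • z.1) +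
    ℓ z.2 * (a * H' (p + a • z.1) z.2)
  -- The integral of `F α` does not depend on `α`, by rotation invariance.
  have hconst : ∀ α, ∫ z, F α z ∂(μ.prod μ) = ∫ z, F 0 z ∂(μ.prod μ) := by
    intro α
    have hF0 : Continuous (F 0) := by fun_prop
    conv_rhs => rw [← hμ α]
    rw [integral_map (ContinuousLinearMap.continuous _).aemeasurable
      hF0.aestronglyMeasurable]
    refine integral_congr_ae (.of_forall fun z => ?_)
    simp [F, ContinuousLinearMap.rotation_apply, -neg_smul]
  have hN : ∀ (z : E × E) α, ‖p + a • (Real.cos α • z.1 + Real.sin α • z.2)‖ ≤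
      ‖p‖ + ‖z.1‖ + ‖z.2‖ := fun z α => by
    refine (norm_add_le _ _).trans ?_
    have := (haz _).trans (norm_cos_smul_add_sin_smul_le z.1 z.2 α)
    linarith
  have hrot : ∀ (z : E × E) α, -Real.sin α • z.1 + Real.cos α • z.2 =
      Real.cos α • z.2 + Real.sin α • (-z.1) := fun z α => by module
  set A := 2 * (‖ℓ‖ * (B * Real.exp (b * ‖p‖))) with hA
  have hA0 : 0 ≤ A := by positivity
  have hbound := hμ.integrable_exp_norm_prod A (b + 2) (b + 2)
  have hE : ∀ S : ℝ, 0 ≤ S → S + S * S ≤ 2 * Real.exp (2 * S) := fun S hS => by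
    have h1 := Real.add_one_le_exp S
    have h2 : Real.exp (2 * S) = Real.exp S * Real.exp S := by rw [← Real.exp_add]; ring_nf
    rw [h2]
    nlinarith [Real.one_le_exp hS]
  have hlip : ∀ z : E × E, LipschitzOnWith
      (Real.nnabs (A * Real.exp ((b + 2) * ‖z.1‖ + (b + 2) * ‖z.2‖))) (F · z) univ := by
    intro z
    refine LipschitzOnWith.of_dist_le_mul fun α _ β _ => ?_
    rw [Real.coe_nnabs, abs_of_nonneg (by positivity), Real.dist_eq, Real.dist_eq]
    set S := ‖z.1‖ + ‖z.2‖ with hS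
    have hS0 : 0 ≤ S := by positivity
    set xα := -Real.sin α • z.1 + Real.cos α • z.2
    set xβ := -Real.sin β • z.1 + Real.cos β • z.2
    set wα := p + a • (Real.cos α • z.1 + Real.sin α • z.2)
    set wβ := p + a • (Real.cos β • z.1 + Real.sin β • z.2)
    have e1 : |ℓ (xα - xβ)| ≤ ‖ℓ‖ * (|α - β| * S) := by
      refine (ℓ.le_opNorm _).trans (mul_le_mul_of_nonneg_left ?_ (norm_nonneg _))
      have := norm_cos_smul_add_sin_smul_sub_le z.2 (-z.1) α β
      rw [← hrot, ← hrot, norm_neg, add_comm ‖z.2‖] at this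
      exact this
    have e2 : |ℓ xβ| ≤ ‖ℓ‖ * S := by
      refine (ℓ.le_opNorm _).trans (mul_le_mul_of_nonneg_left ?_ (norm_nonneg _))
      have := norm_cos_smul_add_sin_smul_le z.2 (-z.1) β
      rw [← hrot, norm_neg, add_comm ‖z.2‖] at this
      exact this
    have e3 : |H wα| ≤ B * Real.exp (b * (‖p‖ + S)) :=
      hH.bound_of_le ((hN z α).trans_eq (by ring))
    have e4 : |H wα - H wβ| ≤ B * Real.exp (b * (‖p‖ + S)) * (|α - β| * S) := by
      refine (hH.lip (‖p‖ + S) _ _ ((hN z α).trans_eq (by ring))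
        ((hN z β).trans_eq (by ring))).trans ?_
      refine mul_le_mul_of_nonneg_left ?_ (by positivity)
      have h1 : wα - wβ = a • ((Real.cos α • z.1 + Real.sin α • z.2) -
          (Real.cos β • z.1 + Real.sin β • z.2)) := by
        simp only [wα, wβ]
        module
      rw [h1]
      exact (haz _).trans (norm_cos_smul_add_sin_smul_sub_le _ _ _ _)
    have h1 : F α z - F β z = ℓ (xα - xβ) * H wα + ℓ xβ * (H wα - H wβ) := by
      simp only [F, map_sub]
      ring
    rw [h1]
    have hexp : Real.exp ((b + 2) * ‖z.1‖ + (b + 2) * ‖z.2‖) =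
        Real.exp (b * S) * Real.exp (2 * S) := by
      rw [← Real.exp_add, hS]
      ring_nf
    have hexp' : Real.exp (b * (‖p‖ + S)) = Real.exp (b * ‖p‖) * Real.exp (b * S) := by
      rw [← Real.exp_add]
      ring_nf
    calc |ℓ (xα - xβ) * H wα + ℓ xβ * (H wα - H wβ)|
        ≤ |ℓ (xα - xβ)| * |H wα| + |ℓ xβ| * |H wα - H wβ| := by
          rw [← abs_mul, ← abs_mul]
          exact abs_add_le _ _
      _ ≤ ‖ℓ‖ * (|α - β| * S) * (B * Real.exp (b * (‖p‖ + S))) +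
          ‖ℓ‖ * S * (B * Real.exp (b * (‖p‖ + S)) * (|α - β| * S)) :=
          add_le_add (mul_le_mul e1 e3 (abs_nonneg _) (by positivity))
            (mul_le_mul e2 e4 (abs_nonneg _) (by positivity))
      _ = ‖ℓ‖ * (B * Real.exp (b * ‖p‖)) * Real.exp (b * S) * |α - β| * (S + S * S) := by
          rw [hexp']
          ring
      _ ≤ ‖ℓ‖ * (B * Real.exp (b * ‖p‖)) * Real.exp (b * S) * |α - β| * (2 * Real.exp (2 * S)) :=
          mul_le_mul_of_nonneg_left (hE S hS0) (by positivity)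
      _ = A * Real.exp ((b + 2) * ‖z.1‖ + (b + 2) * ‖z.2‖) * |α - β| := by
          rw [hexp, hA]
          ring
  have hmeas' : AEStronglyMeasurable (fun z : E × E => H' (p + a • z.1) z.2) (μ.prod μ) :=
    aestronglyMeasurable_gateauxDeriv hHc (by fun_prop) measurable_snd hgood'
  have hFc : ∀ α, Continuous (F α) := fun α => by fun_prop
  have hF0int : Integrable (F 0) (μ.prod μ) := by
    refine hbound.mono' (hFc 0).aestronglyMeasurable (.of_forall fun z => ?_)
    have e3 := hH.bound_of_le (hN z 0)
    have e2 : |ℓ z.2| ≤ ‖ℓ‖ * ‖z.2‖ := ℓ.le_opNorm _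
    simp only [F, Real.sin_zero, Real.cos_zero, neg_zero, zero_smul, one_smul, zero_add,
      add_zero] at e3 ⊢
    rw [Real.norm_eq_abs, abs_mul]
    have h4 : ‖z.2‖ ≤ 2 * Real.exp (2 * (‖z.1‖ + ‖z.2‖)) := by
      refine le_trans ?_ (hE _ (by positivity))
      nlinarith [norm_nonneg z.1, norm_nonneg z.2]
    have hexp : B * Real.exp (b * (‖p‖ + ‖z.1‖ + ‖z.2‖)) = B * Real.exp (b * ‖p‖) *
        Real.exp (b * (‖z.1‖ + ‖z.2‖)) := by
      rw [mul_assoc, ← Real.exp_add]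
      ring_nf
    calc |ℓ z.2| * |H (p + a • z.1)| ≤ ‖ℓ‖ * (2 * Real.exp (2 * (‖z.1‖ + ‖z.2‖))) *
          (B * Real.exp (b * ‖p‖) * Real.exp (b * (‖z.1‖ + ‖z.2‖))) :=
          mul_le_mul (e2.trans (mul_le_mul_of_nonneg_left h4 (norm_nonneg _))) (e3.trans_eq hexp)
            (abs_nonneg _) (by positivity)
      _ = A * (Real.exp (b * (‖z.1‖ + ‖z.2‖)) * Real.exp (2 * (‖z.1‖ + ‖z.2‖))) := by
          rw [hA]
          ring
      _ = _ := by
          rw [← Real.exp_add]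
          ring_nf
  have hder : ∀ᵐ z ∂(μ.prod μ), HasDerivAt (F · z) (F' z) 0 := by
    filter_upwards [hgood'] with z hz
    have h1 : HasDerivAt (fun α => -Real.sin α • z.1 + Real.cos α • z.2) (-z.1) 0 := by
      have := hasDerivAt_cos_smul_add_sin_smul z.2 (-z.1) 0
      simp only [Real.sin_zero, Real.cos_zero, neg_zero, zero_smul, zero_add, one_smul] at this
      simpa only [hrot] using this
    have h2 : HasDerivAt (fun α => p + a • (Real.cos α • z.1 + Real.sin α • z.2)) (a • z.2) 0 := by
      have := ((hasDerivAt_cos_smul_add_sin_smul z.1 z.2 0).const_smul a).const_add p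
      simpa using this
    have h3 : HasDerivAt (fun α => H (p + a • (Real.cos α • z.1 + Real.sin α • z.2)))
        (H' (p + a • z.1) (a • z.2)) 0 := by
      refine hH.hasDerivAt_comp h2 ?_
      simpa using hz (a • z.2)
    have h4 := (ℓ.hasFDerivAt.comp_hasDerivAt 0 h1).mul h3
    refine h4.congr_deriv ?_
    simp [F']
  have hF'm : AEStronglyMeasurable F' (μ.prod μ) := by
    have h1 : Continuous fun z : E × E => ℓ (-z.1) * H (p + a • z.1) := by fun_prop
    have h2 : Continuous fun z : E × E => ℓ z.2 := by fun_prop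
    exact h1.aestronglyMeasurable.add (h2.aestronglyMeasurable.mul (hmeas'.const_mul a))
  obtain ⟨hF'int, hF'der⟩ := hasDerivAt_integral_of_dominated_loc_of_lip (𝕜 := ℝ) (F := F)
    univ_mem (.of_forall fun α => (hFc α).aestronglyMeasurable) hF0int hF'm
    (.of_forall hlip) hbound hder
  have hzero : ∫ z, F' z ∂(μ.prod μ) = 0 := by
    simp only [hconst] at hF'der
    exact hF'der.unique (hasDerivAt_const _ _)
  have hint2 : Integrable (fun z : E × E => ℓ z.2 * H' (p + a • z.1) z.2) (μ.prod μ) := by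
    have hc : Continuous fun z : E × E => ℓ z.2 := by fun_prop
    refine (hμ.integrable_exp_norm_prod (A * Real.exp b) b 2).mono'
      (hc.aestronglyMeasurable.mul hmeas') ?_
    filter_upwards [hgood'] with z hz
    have e1 := hH.abs_deriv_le hz z.2
    have e2 : |ℓ z.2| ≤ ‖ℓ‖ * ‖z.2‖ := ℓ.le_opNorm _
    have e3 : ‖p + a • z.1‖ ≤ ‖p‖ + ‖z.1‖ := (norm_add_le _ _).trans (by linarith [haz z.1])
    have e4 : B * Real.exp (b * (‖p + a • z.1‖ + 1)) ≤
        B * (Real.exp (b * ‖p‖) * Real.exp b * Real.exp (b * ‖z.1‖)) := by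
      rw [← Real.exp_add, ← Real.exp_add]
      refine mul_le_mul_of_nonneg_left (Real.exp_le_exp.2 ?_) hB
      nlinarith
    have e5 : ‖z.2‖ * ‖z.2‖ ≤ 2 * Real.exp (2 * ‖z.2‖) :=
      le_trans (by linarith [norm_nonneg z.2]) (hE _ (norm_nonneg z.2))
    rw [Real.norm_eq_abs, abs_mul]
    calc |ℓ z.2| * |H' (p + a • z.1) z.2| ≤ ‖ℓ‖ * ‖z.2‖ *
          (B * (Real.exp (b * ‖p‖) * Real.exp b * Real.exp (b * ‖z.1‖)) * ‖z.2‖) :=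
          mul_le_mul e2 (e1.trans (mul_le_mul_of_nonneg_right e4 (norm_nonneg _)))
            (abs_nonneg _) (by positivity)
      _ = ‖ℓ‖ * (B * (Real.exp (b * ‖p‖) * Real.exp b * Real.exp (b * ‖z.1‖))) *
          (‖z.2‖ * ‖z.2‖) := by ring
      _ ≤ ‖ℓ‖ * (B * (Real.exp (b * ‖p‖) * Real.exp b * Real.exp (b * ‖z.1‖))) *
          (2 * Real.exp (2 * ‖z.2‖)) := mul_le_mul_of_nonneg_left e5 (by positivity)
      _ = _ := by
          rw [Real.exp_add, hA]
          ring
  refine ⟨hint2, ?_⟩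
  have hint1 : Integrable (fun z : E × E => ℓ z.1 * H (p + a • z.1)) (μ.prod μ) := by
    refine ((hint2.const_mul a).sub hF'int).congr (.of_forall fun z => ?_)
    simp only [F', Pi.sub_apply, map_neg]
    ring
  have hsum : ∫ z, F' z ∂(μ.prod μ) = a * ∫ z : E × E, ℓ z.2 * H' (p + a • z.1) z.2 ∂(μ.prod μ) -
      ∫ z : E × E, ℓ z.1 * H (p + a • z.1) ∂(μ.prod μ) := by
    rw [← integral_const_mul, ← integral_sub (hint2.const_mul a) hint1]
    refine integral_congr_ae (.of_forall fun z => ?_)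
    simp only [F', map_neg]
    ring
  have hfst := integral_fun_fst (μ := μ) (ν := μ) (fun v => ℓ v * H (p + a • v))
  rw [probReal_univ, one_smul] at hfst
  rw [← hfst]
  linarith

end CovarianceFormula

/-! ### The covariance formula on a normed space -/

section Variance

variable {E : Type*} [NormedAddCommGroup E] [NormedSpace ℝ E] [MeasurableSpace E] [BorelSpace E]
  [SecondCountableTopology E] {μ : Measure E} [IsProbabilityMeasure μ]
  {H : E → ℝ} {H' : E → E →L[ℝ] ℝ} {B b : ℝ}

/-- The covariance under the centred measure `μ` of the functionals `H' u` and `H' w`. -/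
def gateauxCov (μ : Measure E) (H' : E → E →L[ℝ] ℝ) (u w : E) : ℝ :=
  ∫ z, H' u z * H' w z ∂μ

lemma IsRotationInvariant.ae_cos_sin (hμ : IsRotationInvariant μ) {q : E → Prop}
    (h : ∀ᵐ u ∂μ, q u) (θ : ℝ) :
    ∀ᵐ p : E × E ∂(μ.prod μ), q (Real.cos θ • p.1 + Real.sin θ • p.2) :=
  (hμ.measurePreserving_cos_sin θ).quasiMeasurePreserving.ae h

/-- The integral `E[H(X) H(X_θ)]` for a rotated copy `X_θ` is differentiable in `θ`. -/
lemma hasDerivAt_integral_rotation (hμ : IsRotationInvariant μ) (hH : IsExpLipschitz H B b)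
    (hgood : ∀ᵐ u ∂μ, HasGateauxDeriv H (H' u) u) (θ : ℝ) :
    Integrable (fun p : E × E => H p.1 * H' (Real.cos θ • p.1 + Real.sin θ • p.2)
      (-Real.sin θ • p.1 + Real.cos θ • p.2)) (μ.prod μ) ∧
    HasDerivAt (fun θ => ∫ p : E × E, H p.1 * H (Real.cos θ • p.1 + Real.sin θ • p.2) ∂(μ.prod μ))
      (∫ p : E × E, H p.1 * H' (Real.cos θ • p.1 + Real.sin θ • p.2)
        (-Real.sin θ • p.1 + Real.cos θ • p.2) ∂(μ.prod μ)) θ := by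
  have hHc := hH.continuous
  have hB := hH.nonneg_left
  have hb := hH.nonneg_right
  have hg := hμ.ae_cos_sin hgood θ
  have hbound := hμ.integrable_exp_norm_prod (B * B) (2 * b + 1) (b + 1)
  have hexp : ∀ p : E × E, Real.exp ((2 * b + 1) * ‖p.1‖ + (b + 1) * ‖p.2‖) =
      Real.exp (b * ‖p.1‖) * Real.exp (b * (‖p.1‖ + ‖p.2‖)) * Real.exp (‖p.1‖ + ‖p.2‖) := by
    intro p
    rw [← Real.exp_add, ← Real.exp_add]
    ring_nf
  have hS1 : ∀ p : E × E, ‖p.1‖ + ‖p.2‖ ≤ Real.exp (‖p.1‖ + ‖p.2‖) := fun p => by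
    linarith [Real.add_one_le_exp (‖p.1‖ + ‖p.2‖)]
  have hFc : ∀ α, Continuous fun p : E × E => H p.1 * H (Real.cos α • p.1 + Real.sin α • p.2) :=
    fun α => by fun_prop
  refine hasDerivAt_integral_of_dominated_loc_of_lip (𝕜 := ℝ)
    (F := fun θ (p : E × E) => H p.1 * H (Real.cos θ • p.1 + Real.sin θ • p.2)) univ_mem
    (.of_forall fun α => (hFc α).aestronglyMeasurable) ?_ ?_ (.of_forall fun p => ?_) hbound ?_
  · refine hbound.mono' (hFc θ).aestronglyMeasurable (.of_forall fun p => ?_)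
    rw [Real.norm_eq_abs, abs_mul, hexp]
    have e1 := hH.bound p.1
    have e2 := hH.bound_of_le (norm_cos_smul_add_sin_smul_le p.1 p.2 θ)
    calc _ ≤ B * Real.exp (b * ‖p.1‖) * (B * Real.exp (b * (‖p.1‖ + ‖p.2‖))) :=
          mul_le_mul e1 e2 (abs_nonneg _) (by positivity)
      _ ≤ B * Real.exp (b * ‖p.1‖) * (B * Real.exp (b * (‖p.1‖ + ‖p.2‖))) *
          Real.exp (‖p.1‖ + ‖p.2‖) :=
          le_mul_of_one_le_right (by positivity) (Real.one_le_exp (by positivity))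
      _ = _ := by ring
  · exact (hHc.comp continuous_fst).aestronglyMeasurable.mul
      (aestronglyMeasurable_gateauxDeriv hHc (by fun_prop) (by fun_prop) hg)
  · refine LipschitzOnWith.of_dist_le_mul fun α _ β _ => ?_
    rw [Real.coe_nnabs, abs_of_nonneg (by positivity), Real.dist_eq, Real.dist_eq, ← mul_sub,
      abs_mul, hexp]
    have e1 := hH.bound p.1
    have e2 := (hH.lip _ _ _ (norm_cos_smul_add_sin_smul_le p.1 p.2 α)
      (norm_cos_smul_add_sin_smul_le p.1 p.2 β)).trans (mul_le_mul_of_nonneg_left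
        (norm_cos_smul_add_sin_smul_sub_le p.1 p.2 α β) (by positivity))
    calc _ ≤ B * Real.exp (b * ‖p.1‖) * (B * Real.exp (b * (‖p.1‖ + ‖p.2‖)) *
          (|α - β| * (‖p.1‖ + ‖p.2‖))) := mul_le_mul e1 e2 (abs_nonneg _) (by positivity)
      _ = B * Real.exp (b * ‖p.1‖) * (B * Real.exp (b * (‖p.1‖ + ‖p.2‖)) * |α - β|) *
          (‖p.1‖ + ‖p.2‖) := by ring
      _ ≤ B * Real.exp (b * ‖p.1‖) * (B * Real.exp (b * (‖p.1‖ + ‖p.2‖)) * |α - β|) *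
          Real.exp (‖p.1‖ + ‖p.2‖) := mul_le_mul_of_nonneg_left (hS1 p) (by positivity)
      _ = _ := by ring
  · filter_upwards [hg] with p hp
    exact (hH.hasDerivAt_comp (hasDerivAt_cos_smul_add_sin_smul p.1 p.2 θ) (hp _)).const_mul _

/-- Integrability of the covariances of the derivatives, with a bound which does not depend on the
angle. -/
lemma integrable_gateauxCov (hμ : IsRotationInvariant μ) (hH : IsExpLipschitz H B b)
    (hgood : ∀ᵐ u ∂μ, HasGateauxDeriv H (H' u) u) : ∃ C, ∀ θ,
    Integrable (fun p : E × E => gateauxCov μ H' p.1 (Real.cos θ • p.1 + Real.sin θ • p.2))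
      (μ.prod μ) ∧
    |∫ p : E × E, gateauxCov μ H' p.1 (Real.cos θ • p.1 + Real.sin θ • p.2) ∂(μ.prod μ)| ≤ C := by
  have hHc := hH.continuous
  have hB := hH.nonneg_left
  have hb := hH.nonneg_right
  have hbd := (hμ.integrable_exp_norm_prod (2 * (B * B * Real.exp (2 * b))) (2 * b) b).mul_prod
    (hμ.integrable_exp_norm 2)
  have hint : ∀ θ, Integrable (fun q : (E × E) × E => H' q.1.1 q.2 *
      H' (Real.cos θ • q.1.1 + Real.sin θ • q.1.2) q.2) ((μ.prod μ).prod μ) ∧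
      ∀ᵐ q : (E × E) × E ∂((μ.prod μ).prod μ), ‖H' q.1.1 q.2 *
        H' (Real.cos θ • q.1.1 + Real.sin θ • q.1.2) q.2‖ ≤
        2 * (B * B * Real.exp (2 * b)) * Real.exp (2 * b * ‖q.1.1‖ + b * ‖q.1.2‖) *
          Real.exp (2 * ‖q.2‖) := by
    intro θ
    have h1 : ∀ᵐ q : (E × E) × E ∂((μ.prod μ).prod μ), HasGateauxDeriv H (H' q.1.1) q.1.1 :=
      (measurePreserving_fst.comp measurePreserving_fst).quasiMeasurePreserving.ae hgood
    have h2 : ∀ᵐ q : (E × E) × E ∂((μ.prod μ).prod μ),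
        HasGateauxDeriv H (H' (Real.cos θ • q.1.1 + Real.sin θ • q.1.2))
          (Real.cos θ • q.1.1 + Real.sin θ • q.1.2) :=
      measurePreserving_fst.quasiMeasurePreserving.ae (hμ.ae_cos_sin hgood θ)
    have h3 : ∀ᵐ q : (E × E) × E ∂((μ.prod μ).prod μ), ‖H' q.1.1 q.2 *
        H' (Real.cos θ • q.1.1 + Real.sin θ • q.1.2) q.2‖ ≤
        2 * (B * B * Real.exp (2 * b)) * Real.exp (2 * b * ‖q.1.1‖ + b * ‖q.1.2‖) *
          Real.exp (2 * ‖q.2‖) := by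
      filter_upwards [h1, h2] with q e1 e2
      have f1 := hH.abs_deriv_le e1 q.2
      have f2 := hH.abs_deriv_le e2 q.2
      have f3 : B * Real.exp (b * (‖Real.cos θ • q.1.1 + Real.sin θ • q.1.2‖ + 1)) ≤
          B * Real.exp (b * (‖q.1.1‖ + ‖q.1.2‖ + 1)) := by
        refine mul_le_mul_of_nonneg_left (Real.exp_le_exp.2 ?_) hB
        exact mul_le_mul_of_nonneg_left
          (by linarith [norm_cos_smul_add_sin_smul_le q.1.1 q.1.2 θ]) hb
      have f4 : ‖q.2‖ * ‖q.2‖ ≤ 2 * Real.exp (2 * ‖q.2‖) := by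
        have h1 := Real.add_one_le_exp ‖q.2‖
        have h2 : Real.exp (2 * ‖q.2‖) = Real.exp ‖q.2‖ * Real.exp ‖q.2‖ := by
          rw [← Real.exp_add]
          ring_nf
        rw [h2]
        nlinarith [norm_nonneg q.2]
      rw [Real.norm_eq_abs, abs_mul]
      calc _ ≤ B * Real.exp (b * (‖q.1.1‖ + 1)) * ‖q.2‖ *
            (B * Real.exp (b * (‖q.1.1‖ + ‖q.1.2‖ + 1)) * ‖q.2‖) :=
            mul_le_mul f1 (f2.trans (mul_le_mul_of_nonneg_right f3 (norm_nonneg _)))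
              (abs_nonneg _) (by positivity)
        _ = B * B * (Real.exp (b * (‖q.1.1‖ + 1)) * Real.exp (b * (‖q.1.1‖ + ‖q.1.2‖ + 1))) *
            (‖q.2‖ * ‖q.2‖) := by ring
        _ = B * B * (Real.exp (2 * b) * Real.exp (2 * b * ‖q.1.1‖ + b * ‖q.1.2‖)) *
            (‖q.2‖ * ‖q.2‖) := by
            rw [← Real.exp_add, ← Real.exp_add]
            ring_nf
        _ ≤ B * B * (Real.exp (2 * b) * Real.exp (2 * b * ‖q.1.1‖ + b * ‖q.1.2‖)) *
            (2 * Real.exp (2 * ‖q.2‖)) := mul_le_mul_of_nonneg_left f4 (by positivity)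
        _ = _ := by ring
    refine ⟨hbd.mono' ?_ h3, h3⟩
    exact (aestronglyMeasurable_gateauxDeriv hHc (by fun_prop) (by fun_prop) h1).mul
      (aestronglyMeasurable_gateauxDeriv hHc (by fun_prop) (by fun_prop) h2)
  refine ⟨∫ q : (E × E) × E, 2 * (B * B * Real.exp (2 * b)) *
    Real.exp (2 * b * ‖q.1.1‖ + b * ‖q.1.2‖) * Real.exp (2 * ‖q.2‖) ∂((μ.prod μ).prod μ),
    fun θ => ⟨(hint θ).1.integral_prod_left, ?_⟩⟩
  have h1 := integral_prod _ (hint θ).1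
  simp only [gateauxCov]
  rw [← h1, ← Real.norm_eq_abs]
  exact norm_integral_le_of_norm_le hbd (hint θ).2

/-- The derivative of the integral `E[H(X) H(X_θ)]`: after a rotation of angle `-θ`, it is computed by
integration by parts in the second variable, against the functional `H' u`. -/
lemma integral_rotation_eq (hμ : IsRotationInvariant μ) (hH : IsExpLipschitz H B b)
    (hgood : ∀ᵐ u ∂μ, HasGateauxDeriv H (H' u) u) (θ : ℝ) :
    ∫ p : E × E, H p.1 * H' (Real.cos θ • p.1 + Real.sin θ • p.2)
        (-Real.sin θ • p.1 + Real.cos θ • p.2) ∂(μ.prod μ) =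
      -(Real.sin θ * ∫ p : E × E, gateauxCov μ H' p.1 (Real.cos θ • p.1 + Real.sin θ • p.2)
        ∂(μ.prod μ)) := by
  have hHc := hH.continuous
  let G : E × E → ℝ := fun p => H' p.1 p.2 * H (Real.cos θ • p.1 + (-Real.sin θ) • p.2)
  have hg1 : ∀ᵐ p : E × E ∂(μ.prod μ), HasGateauxDeriv H (H' p.1) p.1 :=
    measurePreserving_fst.quasiMeasurePreserving.ae hgood
  have hGm : AEStronglyMeasurable G (μ.prod μ) :=
    (aestronglyMeasurable_gateauxDeriv hHc measurable_fst measurable_snd hg1).mul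
      (by fun_prop : Continuous fun p : E × E =>
        H (Real.cos θ • p.1 + (-Real.sin θ) • p.2)).aestronglyMeasurable
  have hGrot : ∀ p : E × E, G (ContinuousLinearMap.rotation θ p) =
      H p.1 * H' (Real.cos θ • p.1 + Real.sin θ • p.2)
        (-Real.sin θ • p.1 + Real.cos θ • p.2) := by
    intro p
    have h1 : Real.cos θ • (Real.cos θ • p.1 + Real.sin θ • p.2) +
        (-Real.sin θ) • (-Real.sin θ • p.1 + Real.cos θ • p.2) = p.1 := by
      have : Real.cos θ • (Real.cos θ • p.1 + Real.sin θ • p.2) +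
        (-Real.sin θ) • (-Real.sin θ • p.1 + Real.cos θ • p.2) =
        (Real.cos θ ^ 2 + Real.sin θ ^ 2) • p.1 := by module
      rw [this, Real.cos_sq_add_sin_sq, one_smul]
    simp only [G, ContinuousLinearMap.rotation_apply, h1]
    ring
  have hGm' : AEStronglyMeasurable G
      ((μ.prod μ).map (ContinuousLinearMap.rotation θ : E × E →L[ℝ] E × E)) := by
    rwa [hμ θ]
  have hrm : AEMeasurable (ContinuousLinearMap.rotation θ : E × E →L[ℝ] E × E) (μ.prod μ) :=
    (ContinuousLinearMap.continuous _).aemeasurable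
  have hGint : Integrable G (μ.prod μ) := by
    rw [← hμ θ, integrable_map_measure hGm' hrm]
    exact (hasDerivAt_integral_rotation hμ hH hgood θ).1.congr
      (.of_forall fun p => (hGrot p).symm)
  have h1 : ∫ p : E × E, H p.1 * H' (Real.cos θ • p.1 + Real.sin θ • p.2)
        (-Real.sin θ • p.1 + Real.cos θ • p.2) ∂(μ.prod μ) = ∫ p, G p ∂(μ.prod μ) := by
    conv_rhs => rw [← hμ θ]
    rw [integral_map hrm hGm']
    exact integral_congr_ae (.of_forall fun p => (hGrot p).symm)
  have hg2 : ∀ᵐ u ∂μ, ∀ᵐ v ∂μ, HasGateauxDeriv H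
      (H' (Real.cos θ • u + (-Real.sin θ) • v)) (Real.cos θ • u + (-Real.sin θ) • v) := by
    have := hμ.ae_cos_sin hgood (-θ)
    simp only [Real.cos_neg, Real.sin_neg] at this
    exact Measure.ae_ae_of_ae_prod this
  have h2 : ∀ᵐ u ∂μ, ∫ v, G (u, v) ∂μ = -(Real.sin θ *
      ∫ v, gateauxCov μ H' u (Real.cos θ • u + Real.sin θ • v) ∂μ) := by
    filter_upwards [hg2] with u hu
    obtain ⟨hi, he⟩ := integral_mul_eq_integral_gateauxDeriv hμ hH (H' u) (Real.cos θ • u)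
      (a := -Real.sin θ) (by rw [abs_neg]; exact Real.abs_sin_le_one θ) hu
    simp only [G]
    rw [he, integral_prod _ hi, neg_mul]
    congr 2
    rw [← hμ.measurePreserving_neg.integral_comp (Homeomorph.neg E).measurableEmbedding]
    simp only [gateauxCov, smul_neg, neg_smul, neg_neg]
  obtain ⟨C, hC⟩ := integrable_gateauxCov hμ hH hgood
  rw [h1, integral_prod _ hGint, integral_congr_ae h2, integral_neg, integral_const_mul,
    integral_prod _ (hC θ).1]

/-- The covariance formula for the variance of a function under a rotation invariant measure: the
function `E[H(X) H(X_θ)]` increases from `E[H]²` to `E[H²]` as `θ` decreases from `π / 2` to `0`, and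
`cos θ = exp (-t)`. -/
theorem variance_eq_integral_gateauxCov (hμ : IsRotationInvariant μ) (hH : IsExpLipschitz H B b)
    (hgood : ∀ᵐ u ∂μ, HasGateauxDeriv H (H' u) u) :
    MemLp H 2 μ ∧
    (∀ t, 0 ≤ t → Integrable (fun p : E × E => gateauxCov μ H' p.1
      (Real.exp (-t) • p.1 + √(1 - Real.exp (-2 * t)) • p.2)) (μ.prod μ)) ∧
    IntegrableOn (fun t => (∫ p : E × E, gateauxCov μ H' p.1
      (Real.exp (-t) • p.1 + √(1 - Real.exp (-2 * t)) • p.2) ∂(μ.prod μ)) * Real.exp (-t))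
      (Ioi 0) ∧
    Var[H; μ] = ∫ t in Ioi (0 : ℝ), (∫ p : E × E, gateauxCov μ H' p.1
      (Real.exp (-t) • p.1 + √(1 - Real.exp (-2 * t)) • p.2) ∂(μ.prod μ)) * Real.exp (-t) := by
  have hHc := hH.continuous
  have hB := hH.nonneg_left
  have hmem : MemLp H 2 μ := by
    rw [memLp_two_iff_integrable_sq hHc.aestronglyMeasurable]
    refine ((hμ.integrable_exp_norm (2 * b)).const_mul (B * B)).mono'
      (hHc.pow 2).aestronglyMeasurable (.of_forall fun u => ?_)
    have h1 := hH.bound u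
    have h2 : Real.exp (2 * b * ‖u‖) = Real.exp (b * ‖u‖) * Real.exp (b * ‖u‖) := by
      rw [← Real.exp_add]
      ring_nf
    rw [Real.norm_eq_abs, abs_pow, h2, sq]
    calc _ ≤ (B * Real.exp (b * ‖u‖)) * (B * Real.exp (b * ‖u‖)) :=
          mul_le_mul h1 h1 (abs_nonneg _) (by positivity)
      _ = _ := by ring
  obtain ⟨C, hC⟩ := integrable_gateauxCov hμ hH hgood
  let φ : ℝ → ℝ := fun θ =>
    ∫ p : E × E, H p.1 * H (Real.cos θ • p.1 + Real.sin θ • p.2) ∂(μ.prod μ)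
  let Q : ℝ → ℝ := fun θ =>
    ∫ p : E × E, gateauxCov μ H' p.1 (Real.cos θ • p.1 + Real.sin θ • p.2) ∂(μ.prod μ)
  have hφ : ∀ θ, HasDerivAt φ (-(Real.sin θ * Q θ)) θ := fun θ => by
    have := (hasDerivAt_integral_rotation hμ hH hgood θ).2
    rwa [integral_rotation_eq hμ hH hgood θ] at this
  have hφc : Continuous φ := continuous_iff_continuousAt.2 fun θ => (hφ θ).continuousAt
  let ϑ : ℝ → ℝ := fun t => Real.arccos (Real.exp (-t))
  have hϑ : ∀ t, 0 < t → HasDerivAt (fun t => φ (ϑ t)) (-(Q (ϑ t) * Real.exp (-t))) t := by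
    intro t ht
    have he1 : Real.exp (-t) < 1 := Real.exp_lt_one_iff.2 (by linarith)
    have he0 := Real.exp_pos (-t)
    have hd : HasDerivAt ϑ (-(1 / √(1 - Real.exp (-t) ^ 2)) * (-Real.exp (-t))) t := by
      have h1 : HasDerivAt (fun t : ℝ => Real.exp (-t)) (-Real.exp (-t)) t := by
        simpa using (hasDerivAt_neg t).exp
      exact HasDerivAt.comp (h₂ := Real.arccos) t
        (Real.hasDerivAt_arccos (by linarith) he1.ne) h1
    refine ((hφ (ϑ t)).comp t hd).congr_deriv ?_
    have hs : 0 < √(1 - Real.exp (-t) ^ 2) := Real.sqrt_pos.2 (by nlinarith)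
    have : Real.sin (ϑ t) = √(1 - Real.exp (-t) ^ 2) := Real.sin_arccos _
    rw [this]
    field_simp
  have hint : IntegrableOn (fun t => -(Q (ϑ t) * Real.exp (-t))) (Ioi 0) := by
    refine ((integrableOn_exp_neg_Ioi 0).const_mul C).mono' ?_ ?_
    · refine (measurable_deriv (fun t => φ (ϑ t))).aestronglyMeasurable.congr ?_
      filter_upwards [self_mem_ae_restrict measurableSet_Ioi] with t ht using (hϑ t ht).deriv
    · refine .of_forall fun t => ?_
      rw [norm_neg, norm_mul, Real.norm_of_nonneg (Real.exp_pos _).le]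
      exact mul_le_mul_of_nonneg_right (hC _).2 (Real.exp_pos _).le
  have hlim : Tendsto (fun t => φ (ϑ t)) atTop (𝓝 (φ (Real.pi / 2))) := by
    have h1 : Tendsto (fun t : ℝ => Real.exp (-t)) atTop (𝓝 0) :=
      Real.tendsto_exp_neg_atTop_nhds_zero
    have h2 := (hφc.tendsto _).comp ((Real.continuous_arccos.tendsto 0).comp h1)
    rwa [Real.arccos_zero] at h2
  have hcont : Continuous fun t => φ (ϑ t) :=
    hφc.comp (Real.continuous_arccos.comp (by fun_prop))
  have hFTC := integral_Ioi_of_hasDerivAt_of_tendsto hcont.continuousWithinAt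
    (fun t ht => hϑ t ht) hint hlim
  have hQ : ∀ t, 0 ≤ t → Q (ϑ t) = ∫ p : E × E, gateauxCov μ H' p.1
      (Real.exp (-t) • p.1 + √(1 - Real.exp (-2 * t)) • p.2) ∂(μ.prod μ) := by
    intro t ht
    rw [(exp_neg_eq_cos ht).2]
    nth_rewrite 1 [(exp_neg_eq_cos ht).1]
    rfl
  have h0 : φ (ϑ 0) = ∫ u, H u ^ 2 ∂μ := by
    have := integral_fun_fst (μ := μ) (ν := μ) (fun u => H u ^ 2)
    rw [probReal_univ, one_smul] at this
    rw [← this]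
    simp [φ, ϑ, sq]
  have hpi : φ (Real.pi / 2) = (∫ u, H u ∂μ) ^ 2 := by
    simp only [φ, Real.cos_pi_div_two, Real.sin_pi_div_two, zero_smul, one_smul, zero_add]
    rw [integral_prod_mul, sq]
  refine ⟨hmem, fun t ht => ?_, ?_, ?_⟩
  · have := (hC (ϑ t)).1
    simp only [ϑ, ← (exp_neg_eq_cos ht).1, ← (exp_neg_eq_cos ht).2] at this
    exact this
  · refine hint.neg.congr_fun (fun t ht => ?_) measurableSet_Ioi
    simp only [Pi.neg_apply, neg_neg]
    rw [hQ t (le_of_lt ht)]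
  · rw [variance_eq_sub hmem]
    have : ∫ t in Ioi (0 : ℝ), -(Q (ϑ t) * Real.exp (-t)) = -∫ t in Ioi (0 : ℝ),
        (∫ p : E × E, gateauxCov μ H' p.1 (Real.exp (-t) • p.1 + √(1 - Real.exp (-2 * t)) • p.2)
          ∂(μ.prod μ)) * Real.exp (-t) := by
      rw [integral_neg]
      congr 1
      refine setIntegral_congr_fun measurableSet_Ioi fun t ht => ?_
      rw [hQ t (le_of_lt ht)]
    rw [this, h0, hpi] at hFTC
    simp only [Pi.pow_apply]
    linarith

end Variance

/-! ### Lipschitz functions on spaces of continuous functions -/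

section ContinuousFunctions

variable {X : Type*} [MetricSpace X] [CompactSpace X] [MeasurableSpace C(X, ℝ)] [BorelSpace C(X, ℝ)]

/-- A continuous function is a measurable function of its values: the map below reads them on
a dense sequence. -/
lemma exists_measurable_toContinuousMap [Nonempty X] :
    ∃ Θ : (X → ℝ) → C(X, ℝ), Measurable Θ ∧ ∀ u : C(X, ℝ), Θ u = u := by
  let κ : C(X, ℝ) → ℕ → ℝ := fun u n => u (TopologicalSpace.denseSeq X n)
  have hκc : Continuous κ := by fun_prop
  have hκi : Function.Injective κ := fun u w h => by
    exact DFunLike.coe_injective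
      ((TopologicalSpace.denseRange_denseSeq X).equalizer u.continuous w.continuous h)
  obtain ⟨G, hG, hGκ⟩ := (hκc.measurableEmbedding hκi).exists_measurable_extend
    (g := fun u : C(X, ℝ) => u) measurable_id (fun _ => ⟨0⟩)
  exact ⟨fun u => G fun n => u (TopologicalSpace.denseSeq X n), hG.comp (by fun_prop),
    fun u => congrFun hGκ u⟩

end ContinuousFunctions

section Lipschitz

lemma continuous_of_abs_sub_le {E : Type*} [NormedAddCommGroup E] {T : E → ℝ}
    (hT : ∀ u w, |T u - T w| ≤ ‖u - w‖) : Continuous T :=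
  (LipschitzWith.of_dist_le_mul (K := 1) fun u w => by
    simpa [Real.dist_eq, dist_eq_norm] using hT u w).continuous

variable {E : Type*} [NormedAddCommGroup E] [NormedSpace ℝ E]

/-- For a Lipschitz function, a dense set of directions suffices to test Gateaux
differentiability. -/
lemma hasGateauxDeriv_of_dense {T : E → ℝ} (hT : ∀ u w, |T u - T w| ≤ ‖u - w‖) {L : E →L[ℝ] ℝ}
    {u : E} {V : Set E} (hV : Dense V)
    (h : ∀ v ∈ V, HasDerivAt (fun s : ℝ => T (u + s • v)) (L v) 0) : HasGateauxDeriv T L u := by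
  intro v
  rw [hasDerivAt_iff_isLittleO, Asymptotics.isLittleO_iff]
  intro ε hε
  obtain ⟨w, hw, hvw⟩ := hV.exists_dist_lt v (ε := ε / (2 * (1 + ‖L‖))) (by positivity)
  have h1 := (Asymptotics.isLittleO_iff.1 (hasDerivAt_iff_isLittleO.1 (h w hw))) (half_pos hε)
  filter_upwards [h1] with s hs
  simp only [sub_zero, zero_smul, add_zero, Real.norm_eq_abs, smul_eq_mul] at hs ⊢
  rw [dist_eq_norm, lt_div_iff₀ (by positivity)] at hvw
  have e1 : |T (u + s • v) - T (u + s • w)| ≤ |s| * ‖v - w‖ := by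
    refine (hT _ _).trans_eq ?_
    rw [add_sub_add_left_eq_sub, ← smul_sub, norm_smul, Real.norm_eq_abs]
  have e2 : |s * L v - s * L w| ≤ |s| * (‖L‖ * ‖v - w‖) := by
    rw [← mul_sub, abs_mul, ← map_sub]
    exact mul_le_mul_of_nonneg_left (L.le_opNorm _) (abs_nonneg _)
  have e3 : T (u + s • v) - T u - s * L v =
      (T (u + s • v) - T (u + s • w)) + (T (u + s • w) - T u - s * L w) - (s * L v - s * L w) := by
    ring
  rw [e3]
  refine (abs_sub _ _).trans ((add_le_add ((abs_add_le _ _).trans (add_le_add e1 hs)) e2).trans ?_)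
  nlinarith [abs_nonneg s]

/-- The chain rule for the Gateaux derivative. -/
lemma HasGateauxDeriv.comp_hasDerivAt {T : E → ℝ} {L : E →L[ℝ] ℝ} {u : E}
    (hL : HasGateauxDeriv T L u) {h : ℝ → ℝ} {d : ℝ} (hh : HasDerivAt h d (T u)) :
    HasGateauxDeriv (fun w => h (T w)) (d • L) u := by
  intro v
  exact HasDerivAt.comp (h₂ := h) (h := fun s : ℝ => T (u + s • v)) 0 (by simpa using hh) (hL v)

lemma HasGateauxDeriv.unique {T : E → ℝ} {L L' : E →L[ℝ] ℝ} {u : E}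
    (h : HasGateauxDeriv T L u) (h' : HasGateauxDeriv T L' u) : L = L' :=
  ContinuousLinearMap.ext fun v => (h v).unique (h' v)

/-- A function whose derivative grows exponentially, composed with a Lipschitz function, has
exponential local Lipschitz constants. The constant `c + 1` absorbs the linear factor from the mean
value inequality. -/
lemma isExpLipschitz_comp {E : Type*} [NormedAddCommGroup E] {T : E → ℝ}
    (hT : ∀ u w, |T u - T w| ≤ ‖u - w‖) (hT0 : ∀ u, |T u| ≤ ‖u‖)
    {h : ℝ → ℝ} (hh : Differentiable ℝ h) {c : ℝ} (hc : 0 < c)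
    (hb : ∀ s, |deriv h s| ≤ c * Real.exp (c * |s|)) :
    IsExpLipschitz (fun u => h (T u)) (|h 0| + c) (c + 1) := by
  have hTc := continuous_of_abs_sub_le hT
  have key : ∀ R a b : ℝ, |a| ≤ R → |b| ≤ R → |h a - h b| ≤ c * Real.exp (c * R) * |a - b| := by
    intro R a b ha hb'
    refine Convex.norm_image_sub_le_of_norm_deriv_le (s := Icc (-R) R) (fun x _ => hh x)
      (fun x hx => ?_) (convex_Icc _ _) (abs_le.1 hb') (abs_le.1 ha)
    refine (hb x).trans ?_
    have := abs_le.2 hx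
    gcongr
  refine ⟨by positivity, by positivity, hh.continuous.comp hTc, fun u => ?_, fun R u w hu hw => ?_⟩
  · have h1 := key ‖u‖ (T u) 0 (hT0 u) (by simp)
    rw [sub_zero] at h1
    have h2 : |h (T u)| ≤ |h 0| + |h (T u) - h 0| := by
      have := abs_add_le (h 0) (h (T u) - h 0)
      simpa using this
    have h3 : ‖u‖ ≤ Real.exp ‖u‖ := (by linarith : ‖u‖ ≤ ‖u‖ + 1).trans (Real.add_one_le_exp _)
    have h4 : Real.exp ((c + 1) * ‖u‖) = Real.exp (c * ‖u‖) * Real.exp ‖u‖ := by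
      rw [← Real.exp_add]
      ring_nf
    have h5 : c * Real.exp (c * ‖u‖) * |T u| ≤ c * Real.exp ((c + 1) * ‖u‖) := by
      rw [h4, ← mul_assoc]
      exact mul_le_mul_of_nonneg_left ((hT0 u).trans h3) (by positivity)
    have h6 : |h 0| ≤ |h 0| * Real.exp ((c + 1) * ‖u‖) :=
      le_mul_of_one_le_right (abs_nonneg _) (Real.one_le_exp (by positivity))
    linarith
  · refine (key R _ _ ((hT0 u).trans hu) ((hT0 w).trans hw)).trans ?_
    have hR : 0 ≤ R := (norm_nonneg u).trans hu
    have h1 : c * R ≤ (c + 1) * R := by nlinarith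
    exact mul_le_mul (mul_le_mul (by linarith [abs_nonneg (h 0)]) (Real.exp_le_exp.2 h1)
      (Real.exp_pos _).le (by positivity)) (hT u w) (abs_nonneg _) (by positivity)

end Lipschitz

section Measurability

variable {X : Type*} [MetricSpace X] [CompactSpace X] [MeasurableSpace C(X, ℝ)] [BorelSpace C(X, ℝ)]

/-- The points where a Lipschitz function is differentiable with derivative `v ↦ -v x` for some
`x` form a measurable set, as the evaluations form a compact set. -/
lemma measurableSet_exists_hasGateauxDeriv {T : C(X, ℝ) → ℝ}
    (hT : ∀ u w, |T u - T w| ≤ ‖u - w‖) :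
    MeasurableSet {u | ∃ x : X, HasGateauxDeriv T (-(ContinuousMap.evalCLM ℝ x)) u} := by
  let v : ℕ → C(X, ℝ) := TopologicalSpace.denseSeq C(X, ℝ)
  have hTc := continuous_of_abs_sub_le hT
  have hcont : ∀ n, Continuous (Function.uncurry fun (u : C(X, ℝ)) (s : ℝ) => T (u + s • v n)) :=
    fun n => by
      have : Continuous fun p : C(X, ℝ) × ℝ => p.1 + p.2 • v n := by fun_prop
      exact hTc.comp this
  have hm0 : Measurable fun u : C(X, ℝ) => (u, (0 : ℝ)) := by fun_prop
  have h1 : MeasurableSet {u : C(X, ℝ) |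
      ∀ n, DifferentiableAt ℝ (fun s : ℝ => T (u + s • v n)) 0} := by
    rw [show {u : C(X, ℝ) | ∀ n, DifferentiableAt ℝ (fun s : ℝ => T (u + s • v n)) 0} =
      ⋂ n, {u : C(X, ℝ) | DifferentiableAt ℝ (fun s : ℝ => T (u + s • v n)) 0} by ext; simp]
    exact .iInter fun n => hm0 (measurableSet_of_differentiableAt_with_param ℝ (hcont n))
  have h2 : Measurable fun (u : C(X, ℝ)) (n : ℕ) => deriv (fun s : ℝ => T (u + s • v n)) 0 :=
    measurable_pi_lambda _ fun n => (measurable_deriv_with_param (hcont n)).comp hm0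
  have h3 : IsCompact (range fun (x : X) (n : ℕ) => -(v n x)) :=
    isCompact_range (by fun_prop)
  convert! h1.inter (h2 h3.isClosed.measurableSet) using 1
  ext u
  constructor
  · rintro ⟨x, hx⟩
    refine ⟨fun n => (hx (v n)).differentiableAt, x, ?_⟩
    ext n
    exact ((hx (v n)).deriv).symm
  · rintro ⟨hd, x, hx⟩
    refine ⟨x, hasGateauxDeriv_of_dense hT (TopologicalSpace.denseRange_denseSeq C(X, ℝ)) ?_⟩
    rintro _ ⟨n, rfl⟩
    exact (hd n).hasDerivAt.congr_deriv (congrFun hx n).symm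

end Measurability

/-! ### The covariance formula for the threshold height -/

section RandomContinuousMap

variable {Ω : Type*} [MeasurableSpace Ω] {P : Measure Ω} [IsProbabilityMeasure P]
  {D : Set Plane} {f g : Ω → Plane → ℝ}
  [CompactSpace D] [Nonempty D] [MeasurableSpace C(D, ℝ)] [BorelSpace C(D, ℝ)]

/-- The restrictions to `D` of a nondegenerate Gaussian field and of its independent copy are
random elements of `C(D, ℝ)`, whose common law is rotation invariant. -/
lemma exists_randomContinuousMap (hf : IsNondegenerateGaussianField D P f)
    (hg : IsIndependentCopy D P f g) :
    ∃ F G : Ω → C(D, ℝ), AEMeasurable F P ∧ AEMeasurable G P ∧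
      (∀ᵐ ω ∂P, ∀ x : D, F ω x = f ω x) ∧ (∀ᵐ ω ∂P, ∀ x : D, G ω x = g ω x) ∧
      P.map (fun ω => (F ω, G ω)) = (P.map F).prod (P.map F) ∧ IsRotationInvariant (P.map F) := by
  obtain ⟨Θ, hΘ, hΘu⟩ := exists_measurable_toContinuousMap (X := D)
  have hfm := hg.identDistrib.aemeasurable_fst
  have hgm := hg.identDistrib.aemeasurable_snd
  let F : Ω → C(D, ℝ) := fun ω => Θ fun x => f ω x
  let G : Ω → C(D, ℝ) := fun ω => Θ fun x => g ω x
  have hF : AEMeasurable F P := hΘ.comp_aemeasurable hfm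
  have hG : AEMeasurable G P := hΘ.comp_aemeasurable hgm
  have hext : ∀ u : Plane → ℝ, ContDiffOn ℝ 3 u D → ∀ x : D, Θ (fun x => u x) x = u x :=
    fun u hu => by
      let U : C(D, ℝ) := ⟨fun x => u x, hu.continuousOn.domRestrict⟩
      intro x
      exact DFunLike.congr_fun (hΘu U) x
  have hFf : ∀ᵐ ω ∂P, ∀ x : D, F ω x = f ω x := by
    filter_upwards [hf.smooth] with ω h using hext _ h
  have hGg : ∀ᵐ ω ∂P, ∀ x : D, G ω x = g ω x := by
    filter_upwards [hg.smooth] with ω h using hext _ h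
  have hlaw : P.map (fun ω => (F ω, G ω)) = (P.map F).prod (P.map F) := by
    have h1 : IndepFun F G P := hg.indep.comp hΘ hΘ
    have h2 : P.map F = P.map G := (hg.identDistrib.comp hΘ).map_eq
    rw [(indepFun_iff_map_prod_eq_prod_map_map hF hG).1 h1, ← h2]
  refine ⟨F, G, hF, hG, hFf, hGg, hlaw, fun θ => ?_⟩
  have hrot : Measurable (ContinuousLinearMap.rotation θ :
      C(D, ℝ) × C(D, ℝ) →L[ℝ] C(D, ℝ) × C(D, ℝ)) := by fun_prop
  rw [← hlaw, AEMeasurable.map_map_of_aemeasurable hrot.aemeasurable (hF.prodMk hG)]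
  have h3 := ((identDistrib_rotation hf hg θ).comp (u := fun z => (Θ z.1, Θ z.2))
    (by fun_prop)).map_eq
  refine Eq.trans (Measure.map_congr ?_) h3.symm
  filter_upwards [hf.smooth, hg.smooth, hFf, hGg] with ω s1 s2 e1 e2
  have s3 : ContDiffOn ℝ 3 (fun x => Real.cos θ * f ω x + Real.sin θ * g ω x) D :=
    (contDiffOn_const.mul s1).add (contDiffOn_const.mul s2)
  have s4 : ContDiffOn ℝ 3 (fun x => -Real.sin θ * f ω x + Real.cos θ * g ω x) D :=
    (contDiffOn_const.mul s1).add (contDiffOn_const.mul s2)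
  simp only [Function.comp_apply, ContinuousLinearMap.rotation_apply]
  refine Prod.ext (ContinuousMap.ext fun x => ?_) (ContinuousMap.ext fun x => ?_)
  · refine Eq.trans ?_ (hext _ s3 x).symm
    simp [e1, e2]
  · refine Eq.trans ?_ (hext _ s4 x).symm
    simp [e1, e2]

end RandomContinuousMap

namespace CrossingDomain

variable {𝔇 : CrossingDomain}

/-- The threshold height as a function on `C(D, ℝ)`; the extension by zero outside `D` is
immaterial. -/
def thresholdHeight (𝔇 : CrossingDomain) (u : C(𝔇.D, ℝ)) : ℝ :=
  𝔇.T (Function.extend Subtype.val u 0)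

lemma extend_apply_mem {u : 𝔇.D → ℝ} (x : 𝔇.D) :
    Function.extend Subtype.val u 0 (x : Plane) = u x :=
  Subtype.val_injective.extend_apply _ _ _

lemma continuousOn_extend (u : C(𝔇.D, ℝ)) :
    ContinuousOn (Function.extend Subtype.val u 0 : Plane → ℝ) 𝔇.D := by
  rw [continuousOn_iff_continuous_domRestrict]
  convert! u.continuous using 1
  ext x
  exact extend_apply_mem x

lemma thresholdHeight_eq {u : C(𝔇.D, ℝ)} {u₀ : Plane → ℝ} (h : ∀ x : 𝔇.D, u x = u₀ x) :
    𝔇.thresholdHeight u = 𝔇.T u₀ :=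
  T_congr fun x hx => (extend_apply_mem (⟨x, hx⟩ : 𝔇.D)).trans (h _)

variable [CompactSpace 𝔇.D]

lemma abs_thresholdHeight_sub_le (u w : C(𝔇.D, ℝ)) :
    |𝔇.thresholdHeight u - 𝔇.thresholdHeight w| ≤ ‖u - w‖ := by
  refine abs_T_sub_le (continuousOn_extend u) (continuousOn_extend w) fun x hx => ?_
  have h1 := extend_apply_mem (u := u) (⟨x, hx⟩ : 𝔇.D)
  have h2 := extend_apply_mem (u := w) (⟨x, hx⟩ : 𝔇.D)
  simp only at h1 h2
  rw [h1, h2]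
  exact (u - w).norm_coe_le_norm ⟨x, hx⟩

lemma abs_thresholdHeight_le (u : C(𝔇.D, ℝ)) : |𝔇.thresholdHeight u| ≤ ‖u‖ := by
  have h0 : 𝔇.thresholdHeight 0 = 0 :=
    (thresholdHeight_eq (u₀ := fun _ => 0) fun _ => rfl).trans T_zero
  simpa [h0] using abs_thresholdHeight_sub_le u 0

/-- The Gateaux derivative at a perfect Morse function is minus the evaluation at the threshold
location. -/
lemma IsPerfectMorse.hasGateauxDeriv_thresholdHeight {u₀ : Plane → ℝ} (h : 𝔇.IsPerfectMorse u₀)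
    {u : C(𝔇.D, ℝ)} (hu : ∀ x : 𝔇.D, u x = u₀ x) :
    HasGateauxDeriv 𝔇.thresholdHeight (-(ContinuousMap.evalCLM ℝ ⟨𝔇.S u₀, h.S_mem⟩)) u := by
  intro v
  convert! h.hasDerivAt_T (continuousOn_extend v) using 1
  · ext s
    refine thresholdHeight_eq fun x => ?_
    rw [extend_apply_mem, ← hu]
    simp
  · have := extend_apply_mem (u := v) (⟨𝔇.S u₀, h.S_mem⟩ : 𝔇.D)
    simp only at this
    rw [this]
    rfl

end CrossingDomain

section Covariance

variable {Ω : Type*} [MeasurableSpace Ω] {P : Measure Ω} {𝔇 : CrossingDomain}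
  {f g : Ω → Plane → ℝ}

lemma IsNondegenerateGaussianField.covKernel_eq {D : Set Plane}
    (hf : IsNondegenerateGaussianField D P f) {x y : Plane} (hx : x ∈ D) (hy : y ∈ D) :
    covKernel P f x y = ∫ ω, f ω x * f ω y ∂P := by
  simp [covKernel, covariance, hf.centred x hx, hf.centred y hy]

variable [IsProbabilityMeasure P]

lemma ae_isPerfectMorse_interpolate (hf : IsNondegenerateGaussianField 𝔇.D P f)
    (hg : IsIndependentCopy 𝔇.D P f g) {t : ℝ} (ht : 0 ≤ t) :
    ∀ᵐ ω ∂P, 𝔇.IsPerfectMorse (interpolate f g t ω) :=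
  ae_isPerfectMorse 𝔇 (hf.interpolate 𝔇.isRegularStratification.frame hg ht)

/-- The covariance formula for a function of the threshold height. -/
theorem variance_threshold (hf : IsNondegenerateGaussianField 𝔇.D P f)
    (hg : IsIndependentCopy 𝔇.D P f g) {h : ℝ → ℝ} (hh : ContDiff ℝ 1 h) {c : ℝ} (hc : 0 < c)
    (hb : ∀ s : ℝ, |deriv h s| ≤ c * Real.exp (c * |s|)) :
    MemLp (fun ω => h (𝔇.T (f ω))) 2 P ∧
      (∀ t : ℝ, 0 ≤ t → Integrable (fun ω =>
        covKernel P f (𝔇.S (f ω)) (𝔇.S (interpolate f g t ω)) *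
          deriv h (𝔇.T (f ω)) * deriv h (𝔇.T (interpolate f g t ω))) P) ∧
      IntegrableOn (fun t : ℝ => (∫ ω, covKernel P f (𝔇.S (f ω)) (𝔇.S (interpolate f g t ω)) *
          deriv h (𝔇.T (f ω)) * deriv h (𝔇.T (interpolate f g t ω)) ∂P) * Real.exp (-t))
        (Ioi 0) volume ∧
      Var[fun ω => h (𝔇.T (f ω)); P] =
        ∫ t in Ioi (0 : ℝ), (∫ ω, covKernel P f (𝔇.S (f ω)) (𝔇.S (interpolate f g t ω)) *
          deriv h (𝔇.T (f ω)) * deriv h (𝔇.T (interpolate f g t ω)) ∂P) * Real.exp (-t) := by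
  have : CompactSpace 𝔇.D := isCompact_iff_compactSpace.1 𝔇.isCompact_D
  have hmorse := ae_isPerfectMorse 𝔇 hf
  have : Nonempty 𝔇.D := by
    obtain ⟨ω, hω⟩ := hmorse.exists
    exact ⟨⟨_, hω.S_mem⟩⟩
  let : MeasurableSpace C(𝔇.D, ℝ) := borel _
  have : BorelSpace C(𝔇.D, ℝ) := ⟨rfl⟩
  obtain ⟨F, G, hF, hG, hFf, hGg, hlaw, hrot⟩ := exists_randomContinuousMap hf hg
  have : IsProbabilityMeasure (P.map F) := Measure.isProbabilityMeasure_map hF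
  have hT := CrossingDomain.abs_thresholdHeight_sub_le (𝔇 := 𝔇)
  let H : C(𝔇.D, ℝ) → ℝ := fun u => h (𝔇.thresholdHeight u)
  have hdiff : Differentiable ℝ h := hh.differentiable one_ne_zero
  have hH : IsExpLipschitz H _ _ :=
    isExpLipschitz_comp hT CrossingDomain.abs_thresholdHeight_le hdiff hc hb
  -- The Gateaux derivative of `H` where it exists, and `0` elsewhere.
  classical
  let H' : C(𝔇.D, ℝ) → C(𝔇.D, ℝ) →L[ℝ] ℝ := fun u =>
    if hu : ∃ L, HasGateauxDeriv H L u then hu.choose else 0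
  have hH' : ∀ {u L}, HasGateauxDeriv H L u → H' u = L := fun {u L} hL => by
    have hex : ∃ L, HasGateauxDeriv H L u := ⟨L, hL⟩
    simp only [H', dif_pos hex]
    exact hex.choose_spec.unique hL
  -- The derivative at a perfect Morse function.
  have hval : ∀ {u₀ : Plane → ℝ} (hm : 𝔇.IsPerfectMorse u₀) {u : C(𝔇.D, ℝ)}
      (_ : ∀ x : 𝔇.D, u x = u₀ x), H' u = deriv h (𝔇.T u₀) •
        -(ContinuousMap.evalCLM ℝ (⟨𝔇.S u₀, hm.S_mem⟩ : 𝔇.D)) := fun {u₀} hm {u} hu => by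
    refine hH' ((hm.hasGateauxDeriv_thresholdHeight hu).comp_hasDerivAt ?_)
    rw [CrossingDomain.thresholdHeight_eq hu]
    exact (hdiff _).hasDerivAt
  have hgood : ∀ᵐ u ∂(P.map F), HasGateauxDeriv H (H' u) u := by
    have h1 : ∀ᵐ u ∂(P.map F), ∃ x : 𝔇.D, HasGateauxDeriv 𝔇.thresholdHeight
        (-(ContinuousMap.evalCLM ℝ x)) u := by
      rw [ae_map_iff hF (measurableSet_exists_hasGateauxDeriv hT)]
      filter_upwards [hmorse, hFf] with ω hm hω
      exact ⟨_, hm.hasGateauxDeriv_thresholdHeight hω⟩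
    filter_upwards [h1] with u hu
    obtain ⟨x, hx⟩ := hu
    have h2 := hx.comp_hasDerivAt (hdiff _).hasDerivAt
    rw [hH' h2]
    exact h2
  obtain ⟨v1, v2, v3, v4⟩ := variance_eq_integral_gateauxCov hrot hH hgood
  -- Transfer from the law on `C(D, ℝ)` to the probability space.
  have hHf : H ∘ F =ᵐ[P] fun ω => h (𝔇.T (f ω)) := by
    filter_upwards [hFf] with ω hω
    simp only [Function.comp_apply, H, CrossingDomain.thresholdHeight_eq hω]
  have hcov : ∀ t : ℝ, 0 ≤ t → (fun ω => gateauxCov (P.map F) H' (F ω)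
      (Real.exp (-t) • F ω + √(1 - Real.exp (-2 * t)) • G ω)) =ᵐ[P] fun ω =>
        covKernel P f (𝔇.S (f ω)) (𝔇.S (interpolate f g t ω)) *
          deriv h (𝔇.T (f ω)) * deriv h (𝔇.T (interpolate f g t ω)) := fun t ht => by
    filter_upwards [hmorse, ae_isPerfectMorse_interpolate hf hg ht, hFf, hGg] with ω m1 m2 e1 e2
    have e3 : ∀ x : 𝔇.D, (Real.exp (-t) • F ω + √(1 - Real.exp (-2 * t)) • G ω) x =
        interpolate f g t ω x := fun x => by simp [interpolate, e1, e2]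
    rw [gateauxCov, hval m1 e1, hval m2 e3, hf.covKernel_eq m1.S_mem m2.S_mem]
    have h1 : ∀ z : C(𝔇.D, ℝ), (deriv h (𝔇.T (f ω)) •
        -(ContinuousMap.evalCLM ℝ (⟨𝔇.S (f ω), m1.S_mem⟩ : 𝔇.D))) z *
        (deriv h (𝔇.T (interpolate f g t ω)) •
        -(ContinuousMap.evalCLM ℝ (⟨𝔇.S (interpolate f g t ω), m2.S_mem⟩ : 𝔇.D))) z =
        (z ⟨𝔇.S (f ω), m1.S_mem⟩ * z ⟨𝔇.S (interpolate f g t ω), m2.S_mem⟩) *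
          (deriv h (𝔇.T (f ω)) * deriv h (𝔇.T (interpolate f g t ω))) := fun z => by
      simp only [_root_.smul_apply, _root_.neg_apply, ContinuousMap.evalCLM_apply, smul_eq_mul]
      ring
    simp only [h1]
    rw [integral_mul_const, integral_map hF (by fun_prop), ← mul_assoc]
    congr 2
    refine integral_congr_ae ?_
    filter_upwards [hFf] with ω' hω'
    rw [hω', hω']
  have hFG : AEMeasurable (fun ω => (F ω, G ω)) P := hF.prodMk hG
  rw [← hlaw] at v2
  have hint : ∀ t : ℝ, 0 ≤ t → ∫ p : C(𝔇.D, ℝ) × C(𝔇.D, ℝ), gateauxCov (P.map F) H' p.1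
      (Real.exp (-t) • p.1 + √(1 - Real.exp (-2 * t)) • p.2) ∂((P.map F).prod (P.map F)) =
      ∫ ω, covKernel P f (𝔇.S (f ω)) (𝔇.S (interpolate f g t ω)) *
          deriv h (𝔇.T (f ω)) * deriv h (𝔇.T (interpolate f g t ω)) ∂P := fun t ht => by
    rw [← hlaw, integral_map hFG (v2 t ht).aestronglyMeasurable]
    exact integral_congr_ae (hcov t ht)
  refine ⟨?_, fun t ht => ?_, ?_, ?_⟩
  · rw [← memLp_congr_ae hHf]
    exact v1.comp_of_map hF
  · rw [← integrable_congr (hcov t ht)]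
    exact (integrable_map_measure (v2 t ht).aestronglyMeasurable hFG).1 (v2 t ht)
  · refine v3.congr_fun (fun t ht => ?_) measurableSet_Ioi
    simp only [hint t (mem_Ioi.1 ht).le]
  · rw [← variance_congr hHf, ← variance_map v1.aestronglyMeasurable.aemeasurable hF, v4]
    refine setIntegral_congr_fun measurableSet_Ioi fun t ht => ?_
    simp only [hint t (mem_Ioi.1 ht).le]

end Covariance

end

theorem lemma3p1 {Ω : Type*} [MeasurableSpace Ω] (P : Measure Ω) [IsProbabilityMeasure P]
    (𝔇 : CrossingDomain) (f g : Ω → Plane → ℝ)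
    (hf : IsNondegenerateGaussianField 𝔇.D P f) (hg : IsIndependentCopy 𝔇.D P f g) :
    -- the threshold map is almost surely well defined at `f_t` (and at `f_0 = f`)
    (∀ t : ℝ, 0 ≤ t → ∀ᵐ ω ∂P, 𝔇.IsPerfectMorse (interpolate f g t ω) ∧
      ∃! x, 𝔇.IsThresholdPoint (interpolate f g t ω) x) ∧
    -- the covariance formula
    (∀ h : ℝ → ℝ, ContDiff ℝ 1 h →
      (∃ c : ℝ, 0 < c ∧ ∀ s : ℝ, |deriv h s| ≤ c * Real.exp (c * |s|)) →
      MemLp (fun ω => h (𝔇.T (f ω))) 2 P ∧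
      (∀ t : ℝ, 0 ≤ t → Integrable (fun ω =>
        covKernel P f (𝔇.S (f ω)) (𝔇.S (interpolate f g t ω)) *
          deriv h (𝔇.T (f ω)) * deriv h (𝔇.T (interpolate f g t ω))) P) ∧
      IntegrableOn (fun t : ℝ => (∫ ω, covKernel P f (𝔇.S (f ω)) (𝔇.S (interpolate f g t ω)) *
          deriv h (𝔇.T (f ω)) * deriv h (𝔇.T (interpolate f g t ω)) ∂P) * Real.exp (-t))
        (Ioi 0) volume ∧
      Var[fun ω => h (𝔇.T (f ω)); P] =
        ∫ t in Ioi (0 : ℝ), (∫ ω, covKernel P f (𝔇.S (f ω)) (𝔇.S (interpolate f g t ω)) *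
          deriv h (𝔇.T (f ω)) * deriv h (𝔇.T (interpolate f g t ω)) ∂P) * Real.exp (-t)) ∧
    -- the particular case of the identity function
    Var[fun ω => 𝔇.T (f ω); P] =
      ∫ t in Ioi (0 : ℝ), (∫ ω, covKernel P f (𝔇.S (f ω)) (𝔇.S (interpolate f g t ω)) ∂P) *
        Real.exp (-t) := by
  refine ⟨fun t ht => ?_, fun h hh ⟨c, hc, hb⟩ => variance_threshold hf hg hh hc hb, ?_⟩
  · filter_upwards [ae_isPerfectMorse_interpolate hf hg ht] with ω hω
    exact ⟨hω, hω.existsUnique_isThresholdPoint⟩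
  · have h1 := (variance_threshold hf hg (h := fun s => s) contDiff_id one_pos
      fun s => by simp [Real.one_le_exp (abs_nonneg s)]).2.2.2
    simpa using h1
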